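/- Let $X,Y\subset\mathbb R^n$ be two strata, that is, disjoint (embedded) $C^2$ submanifolds with $X\subset\overline{Y}$ and $X\cup Y$ locally closed, both definable in one o-minimal structure expanding the real field. Let $0\in X$, let $\dim Y=\dim X+1$, and suppose that $Y\cap B(0,\varepsilon)$ is connected for all sufficiently small $\varepsilon>0$. Notation: $\pi$ is the nearest point retraction onto $X$ (defined near $X$), $\mu(w)=w/\|w\|$, $T$ and $N$ denote tangent and normal spaces, and for $y\in Y$ $$\alpha(y)=\max\{\langle\mu(a),\mu(b)\rangle : a\in N_yY\setminus\{0\},\ b\in T_{\pi(y)}X\setminus\{0\}\},\qquad \beta(y)=\max\{\langle\mu(a),\mu(\pi(y)-y)\rangle : a\in N_yY\setminus\{0\}\}$$ (a maximum over the empty set being $0$). The pair $(Y,X)$ satisfies $(b)$ if $\alpha(y)\to0$ and $\beta(y)\to0$ as $y\to x$, $y\in Y$, for every $x\in X$. With $S=X\cup Y$, the normal cone $C_XS$ is the set of points over $X$ of the closure in $\mathbb R^n\times\mathbb R^n$ of $\{(y,\mu(\pi(y)-y)) : y\in S\setminus X\}$, and $(Y,X)$ satisfies $(npf)$ if the projection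 $C_XS\to X$ is an open map. All properties below are understood near $0$, i.e. for $X\cap U$ and $Y\cap U$ with some open neighbourhood $U$ of $0$. Then $(Y,X)$ satisfies $(b)$ and $(npf)$ near $0$ if and only if $Y\cup X$ is, near $0$, a $C^1$ submanifold with boundary of $\mathbb R^n$ of dimension $\dim Y$. In that case its boundary is $X$ near $0$. -/

import Mathlib

open Set Filter Topology

universe u v

noncomputable section

/-- An o-minimal structure expanding the real field: a first-order structure on `ℝ` in which (with
real parameters) addition and multiplication are definable, and every definable subset of the line
is a finite union of intervals. An order-connected subset of `ℝ` is exactly an interval of any kind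
(possibly empty, a point, or unbounded). The order is definable from the field operations. -/
structure IsOMinimalExpansionOfRealField (L : FirstOrder.Language.{u, v}) [L.Structure ℝ] :
    Prop where
  definable_add : (univ : Set ℝ).Definable L {w : Fin 3 → ℝ | w 0 + w 1 = w 2}
  definable_mul : (univ : Set ℝ).Definable L {w : Fin 3 → ℝ | w 0 * w 1 = w 2}
  finite_union_intervals : ∀ s : Set ℝ, (univ : Set ℝ).Definable₁ L s →
    ∃ F : Set (Set ℝ), F.Finite ∧ (∀ I ∈ F, I.OrdConnected) ∧ s = ⋃₀ F

/-- Euclidean `n`-space. -/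
abbrev RSpace (n : ℕ) : Type := EuclideanSpace ℝ (Fin n)

/-- A subset of Euclidean space is definable (with real parameters) in the structure `L` on `ℝ`. -/
def IsDefinableSet (L : FirstOrder.Language.{u, v}) [L.Structure ℝ] {n : ℕ}
    (A : Set (RSpace n)) : Prop :=
  (univ : Set ℝ).Definable L {w : Fin n → ℝ | WithLp.toLp 2 w ∈ A}

/-- The linear model `ℝ^d × {0} ⊆ ℝ^n`. -/
def linearModel (n d : ℕ) : Set (RSpace n) :=
  {w | ∀ i : Fin n, d ≤ (i : ℕ) → w i = 0}

/-- The half-space model `ℝ^(d-1) × [0, ∞) × {0} ⊆ ℝ^n` (for `1 ≤ d ≤ n`); the distinguished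
coordinate is the `d`-th one, of index `d - 1`. -/
def halfModel (n d : ℕ) : Set (RSpace n) :=
  {w | w ∈ linearModel n d ∧ ∀ i : Fin n, (i : ℕ) + 1 = d → 0 ≤ w i}

/-- `Φ` is a `C^r` diffeomorphism between open subsets of `ℝ^n`, defined near `p`, which carries `M`
onto the model set `A`. -/
def IsStraightening {n : ℕ} (r : WithTop ℕ∞) (M A : Set (RSpace n)) (p : RSpace n)
    (Φ : OpenPartialHomeomorph (RSpace n) (RSpace n)) : Prop :=
  p ∈ Φ.source ∧ ContDiffOn ℝ r Φ Φ.source ∧ ContDiffOn ℝ r Φ.symm Φ.target ∧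
    ∀ q ∈ Φ.source, q ∈ M ↔ Φ q ∈ A

/-- `M` is an (embedded, not necessarily closed) `C^r` submanifold of `ℝ^n` of dimension `d`. -/
def IsSubmanifold {n : ℕ} (r : WithTop ℕ∞) (d : ℕ) (M : Set (RSpace n)) : Prop :=
  d ≤ n ∧ ∀ p ∈ M, ∃ Φ, IsStraightening r M (linearModel n d) p Φ

/-- `M` is a `C^r` submanifold with boundary of `ℝ^n` of dimension `d`. (At an interior point the
straightening can be taken with image in the open half-space.) -/
def IsSubmanifoldWithBoundary {n : ℕ} (r : WithTop ℕ∞) (d : ℕ) (M : Set (RSpace n)) : Prop :=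
  d ≤ n ∧ ∀ p ∈ M, ∃ Φ, IsStraightening r M (halfModel n d) p Φ

/-- The boundary of a `d`-dimensional `C^r` submanifold with boundary: the points that some
straightening maps into the boundary hyperplane of the half-space. -/
def submanifoldBoundary {n : ℕ} (r : WithTop ℕ∞) (d : ℕ) (M : Set (RSpace n)) : Set (RSpace n) :=
  {p | p ∈ M ∧ ∃ Φ, IsStraightening r M (halfModel n d) p Φ ∧
    ∃ i : Fin n, (i : ℕ) + 1 = d ∧ Φ p i = 0}

/-- The tangent space `T_p M`: velocities at `p` of curves in `M`. -/
def tangentVectors {n : ℕ} (M : Set (RSpace n)) (p : RSpace n) : Set (RSpace n) :=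
  {w | ∃ γ : ℝ → RSpace n, γ 0 = p ∧ (∀ᶠ t in 𝓝 0, γ t ∈ M) ∧ HasDerivAt γ w 0}

/-- The normal space `N_p M`, the orthogonal complement of `T_p M`. -/
def normalVectors {n : ℕ} (M : Set (RSpace n)) (p : RSpace n) : Set (RSpace n) :=
  {w | ∀ z ∈ tangentVectors M p, inner ℝ z w = 0}

/-- `μ(w) = w / |w|`. -/
def unitVector {n : ℕ} (w : RSpace n) : RSpace n := ‖w‖⁻¹ • w

/-- The retraction `π` onto `X`: a point of `X` nearest to `y`. Near every point of a `C^2`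
submanifold `X` such a point exists and is unique; elsewhere the value is irrelevant. -/
def nearestPoint {n : ℕ} (X : Set (RSpace n)) (y : RSpace n) : RSpace n :=
  Classical.epsilon fun x => x ∈ X ∧ dist y x = Metric.infDist y X

/-- `α_{Y,X}(y)`, the distance of `T_{π(y)} X` to `T_y Y`: the maximum of `⟨μ(a), μ(b)⟩` over nonzero
`a ∈ N_y Y` and `b ∈ T_{π(y)} X` (zero if there are no such vectors). -/
def whitneyAlpha {n : ℕ} (X Y : Set (RSpace n)) (y : RSpace n) : ℝ :=
  sSup {s | ∃ a ∈ normalVectors Y y, ∃ b ∈ tangentVectors X (nearestPoint X y),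
    a ≠ 0 ∧ b ≠ 0 ∧ s = inner ℝ (unitVector a) (unitVector b)}

/-- `β_{Y,X}(y)`, the angle of the secant `π(y) - y` to `T_y Y`: the maximum of
`⟨μ(a), μ(π(y) - y)⟩` over nonzero `a ∈ N_y Y` (zero if there are no such vectors). -/
def whitneyBeta {n : ℕ} (X Y : Set (RSpace n)) (y : RSpace n) : ℝ :=
  sSup {s | ∃ a ∈ normalVectors Y y,
    a ≠ 0 ∧ s = inner ℝ (unitVector a) (unitVector (nearestPoint X y - y))}

/-- The pair `(Y, X)` satisfies Whitney's condition (b) at every point of `X`. -/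
def WhitneyB {n : ℕ} (X Y : Set (RSpace n)) : Prop :=
  ∀ x ∈ X, Tendsto (whitneyAlpha X Y) (𝓝[Y] x) (𝓝 0) ∧
    Tendsto (whitneyBeta X Y) (𝓝[Y] x) (𝓝 0)

/-- The normal cone `C_X S`: the restriction to `X` of the closure of the set of pairs
`(y, μ(π(y) - y))`, `y ∈ S \ X`. -/
def normalCone {n : ℕ} (X S : Set (RSpace n)) : Set (RSpace n × RSpace n) :=
  {q | q.1 ∈ X ∧ q ∈ closure ((fun y => (y, unitVector (nearestPoint X y - y))) '' (S \ X))}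

/-- `S` is normally pseudo-flat along `X`: the projection `C_X S → X` is open. -/
def NormallyPseudoFlat {n : ℕ} (X S : Set (RSpace n)) : Prop :=
  IsOpenMap (fun q : normalCone X S => (⟨(q : RSpace n × RSpace n).1, q.2.1⟩ : X))

end

/-! Near 0, `X` is the image of a C^1 section `g` of a linear map `P` onto `ℝ^k` (`exists_isTube`).
Each point y near X then has collar coordinates (P y, |y - g(P y)|) and a direction θ(y), the unit
vector of y - g(P y).

From (b) and (npf) to a manifold with boundary. The nearest point and g(P y) differ by a secant of
X, which is almost tangent to X; hence α → 0 and β → 0 say that the frame (v, t) ↦ Dg v + tθ is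
almost tangent to Y (`eventually_inner_frameMap`). This frame is a right inverse of the differential
of the collar coordinates, so these are local coordinates on Y, and the inverse frame on Y is close
to the model frame (`eventually_frame`). Local closedness makes the collar map proper on Y, hence a
covering of the convex set ball × (0, δ). The fibre over (0, r) lies on the sphere of radius r about
0, and Y is connected in small balls, so the covering has one sheet: Y is the image of a C^1 map
s(u, r) (`existsUnique_collar`, `exists_collar_section`).

It remains to let r tend to 0. For fixed u, s(u, ·) parametrizes a slice of a definable set by
spheres, so (s(u, r) - g u)/r converges by o-minimality in one variable (`exists_tendsto_slice`). A
Baire argument turns these pointwise limits into limits of θ(y), as y → g u in Y, for a dense set of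
u (`exists_tendsto_prod_of_tendsto`). There the normal cone has a single point in its fibre. If θ
had two cluster values at some g u, the cone would have two points there, and openness of its
projection would give two points over all nearby u, a contradiction
(`tendsto_collarDir_of_normallyPseudoFlat`). So θ converges at every point. Since Ds is asymptotic
to the frame, s - g extends oddly in r to a C^1 map, and g plus this extension is an immersion of a
full neighbourhood whose half r ≥ 0 parametrizes X ∪ Y (`exists_isStraightening`).

Conversely, a chart of the manifold with boundary extends it to a (k+1)-dimensional manifold without
boundary, in which X is the zero set of a height. Connectedness of Y puts Y on one side of X, and a
sign argument shows that Y is the whole side and X the boundary (`exists_isCollar`). A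
parametrization that is C^1 up to X gives (b) by continuity of its derivative, and gives (npf)
because the directions converge, so that the normal cone is a continuous graph over X. -/

noncomputable section

/-! ### Coordinates -/

/-- The first `d` coordinates. -/
def firstCoords (n d : ℕ) (h : d ≤ n) : RSpace n →L[ℝ] RSpace d :=
  ((EuclideanSpace.equiv (Fin d) ℝ).symm : (Fin d → ℝ) →L[ℝ] RSpace d) ∘L
    ContinuousLinearMap.pi fun i => EuclideanSpace.proj (Fin.castLE h i)

/-- The coordinates of index at least `d`. -/
def lastCoords (n d : ℕ) : RSpace n →L[ℝ] ({i : Fin n // d ≤ (i : ℕ)} → ℝ) :=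
  ContinuousLinearMap.pi fun i => EuclideanSpace.proj i.1

/-- The inclusion of `ℝ^d` as the first `d` coordinates of `ℝ^n`. -/
def inclCoords (n d : ℕ) : RSpace d →L[ℝ] RSpace n :=
  ((EuclideanSpace.equiv (Fin n) ℝ).symm : (Fin n → ℝ) →L[ℝ] RSpace n) ∘L
    ContinuousLinearMap.pi fun i =>
      if h : (i : ℕ) < d then (EuclideanSpace.proj (⟨i, h⟩ : Fin d) : RSpace d →L[ℝ] ℝ) else 0

@[simp] lemma firstCoords_apply {n d : ℕ} (h : d ≤ n) (w : RSpace n) (i : Fin d) :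
    firstCoords n d h w i = w (Fin.castLE h i) := rfl

@[simp] lemma lastCoords_apply {n d : ℕ} (w : RSpace n) (i : {i : Fin n // d ≤ (i : ℕ)}) :
    lastCoords n d w i = w i := rfl

lemma inclCoords_apply_of_lt {n d : ℕ} (w : RSpace d) (i : Fin n) (h : (i : ℕ) < d) :
    inclCoords n d w i = w ⟨i, h⟩ := by
  simp [inclCoords, h]

lemma inclCoords_apply_of_le {n d : ℕ} (w : RSpace d) (i : Fin n) (h : d ≤ (i : ℕ)) :
    inclCoords n d w i = 0 := by
  simp [inclCoords, not_lt.2 h]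

lemma firstCoords_inclCoords {n d : ℕ} (h : d ≤ n) (w : RSpace d) :
    firstCoords n d h (inclCoords n d w) = w := by
  ext i
  rw [firstCoords_apply, inclCoords_apply_of_lt _ _ (by simp)]
  rfl

lemma inclCoords_firstCoords {n d : ℕ} (h : d ≤ n) {w : RSpace n} (hw : w ∈ linearModel n d) :
    inclCoords n d (firstCoords n d h w) = w := by
  ext i
  by_cases hi : (i : ℕ) < d
  · rw [inclCoords_apply_of_lt _ _ hi]; rfl
  · rw [inclCoords_apply_of_le _ _ (not_lt.1 hi), hw i (not_lt.1 hi)]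

lemma mem_linearModel_iff {n d : ℕ} {w : RSpace n} : w ∈ linearModel n d ↔ lastCoords n d w = 0 := by
  simp [linearModel, funext_iff]

lemma inclCoords_mem {n d : ℕ} (w : RSpace d) : inclCoords n d w ∈ linearModel n d :=
  fun _ hi => inclCoords_apply_of_le _ _ hi

lemma card_coords_ge (n d : ℕ) : Fintype.card {i : Fin n // d ≤ (i : ℕ)} = n - d := by
  have h := Fintype.card_subtype_compl (fun i : Fin n => (i : ℕ) < d)
  have h2 : Fintype.card {i : Fin n // (i : ℕ) < d} = min n d := by
    rw [Fintype.card_subtype]; exact Fin.card_filter_val_lt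
  simp only [not_lt] at h
  rw [h, h2, Fintype.card_fin]
  omega

/-! ### The inverse function theorem -/

lemma exists_continuousLinearEquiv_of_injective {E F : Type*} [NormedAddCommGroup E]
    [NormedSpace ℝ E] [NormedAddCommGroup F] [NormedSpace ℝ F] [FiniteDimensional ℝ E]
    [FiniteDimensional ℝ F] (hEF : Module.finrank ℝ E = Module.finrank ℝ F) (A : E →L[ℝ] F)
    (hA : ∀ v, A v = 0 → v = 0) : ∃ B : E ≃L[ℝ] F, (B : E →L[ℝ] F) = A := by
  have hinj : Function.Injective (A : E →ₗ[ℝ] F) :=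
    (injective_iff_map_eq_zero (A : E →ₗ[ℝ] F)).2 hA
  refine ⟨((A : E →ₗ[ℝ] F).linearEquivOfInjective hinj hEF).toContinuousLinearEquiv, ?_⟩
  ext v
  rfl

/-- The inverse function theorem gives the homeomorphism; shrinking to an open set on which both `f`
and the inverse at the image point are C^1 makes the regularity hold on all of source and target. -/
lemma exists_local_diffeo {E F : Type*} [NormedAddCommGroup E]
    [NormedSpace ℝ E] [NormedAddCommGroup F] [NormedSpace ℝ F] [FiniteDimensional ℝ E]
    [FiniteDimensional ℝ F] (hEF : Module.finrank ℝ E = Module.finrank ℝ F) {f : E → F} {p : E}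
    (hf : ContDiffAt ℝ 1 f p) (hinj : ∀ v, fderiv ℝ f p v = 0 → v = 0) :
    ∃ e : OpenPartialHomeomorph E F, p ∈ e.source ∧ ⇑e = f ∧ ContDiffOn ℝ 1 e e.source ∧
      ContDiffOn ℝ 1 e.symm e.target := by
  have : CompleteSpace E := FiniteDimensional.complete ℝ E
  obtain ⟨B, hB⟩ := exists_continuousLinearEquiv_of_injective hEF _ hinj
  have hd : HasFDerivAt f (B : E →L[ℝ] F) p := by
    rw [hB]; exact (hf.differentiableAt (by simp)).hasFDerivAt
  let e₀ := hf.toOpenPartialHomeomorph f hd one_ne_zero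
  have hp : p ∈ e₀.source := hf.mem_toOpenPartialHomeomorph_source hd one_ne_zero
  have hc : (e₀ : E → F) = f := hf.toOpenPartialHomeomorph_coe hd one_ne_zero
  have h1 : ∀ᶠ x in 𝓝 p, ContDiffAt ℝ 1 f x := hf.eventually (by simp)
  have h2 : ∀ᶠ y in 𝓝 (f p), ContDiffAt ℝ 1 e₀.symm y :=
    (hf.to_localInverse hd one_ne_zero).eventually (by simp)
  have h3 : ∀ᶠ x in 𝓝 p, ContDiffAt ℝ 1 e₀.symm (f x) := hf.continuousAt.eventually h2
  obtain ⟨N, hN, hNo, hpN⟩ := eventually_nhds_iff.1 (h1.and h3)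
  refine ⟨e₀.restrOpen N hNo, ⟨hp, hpN⟩, hc, ?_, ?_⟩
  · intro x hx
    have := (hN x hx.2).1.contDiffWithinAt (s := (e₀.restrOpen N hNo).source)
    rwa [← hc] at this
  · intro y hy
    have hx := (e₀.restrOpen N hNo).map_target hy
    have hxy : f (e₀.symm y) = y := by
      rw [← hc]; exact (e₀.restrOpen N hNo).right_inv hy
    have := (hN _ hx.2).2
    change ContDiffAt ℝ 1 e₀.symm (f (e₀.symm y)) at this
    rw [hxy] at this
    exact this.contDiffWithinAt

/-! ### Charts and tangent spaces -/

variable {n d : ℕ} {r : WithTop ℕ∞} {M A : Set (RSpace n)} {p : RSpace n}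
  {Φ : OpenPartialHomeomorph (RSpace n) (RSpace n)}

lemma IsStraightening.of_le (h : IsStraightening r M A p Φ) {s : WithTop ℕ∞} (hs : s ≤ r) :
    IsStraightening s M A p Φ :=
  ⟨h.1, h.2.1.of_le hs, h.2.2.1.of_le hs, h.2.2.2⟩

lemma IsStraightening.exists_equiv (h : IsStraightening 1 M A p Φ) :
    ∃ B : RSpace n ≃L[ℝ] RSpace n, HasFDerivAt Φ (B : RSpace n →L[ℝ] RSpace n) p ∧
      HasFDerivAt Φ.symm (B.symm : RSpace n →L[ℝ] RSpace n) (Φ p) := by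
  obtain ⟨hp, h1, h2, -⟩ := h
  have hd1 : HasFDerivAt Φ (fderiv ℝ Φ p) p :=
    ((h1.contDiffAt (Φ.open_source.mem_nhds hp)).differentiableAt (by simp)).hasFDerivAt
  have hd2 : HasFDerivAt Φ.symm (fderiv ℝ Φ.symm (Φ p)) (Φ p) :=
    ((h2.contDiffAt (Φ.open_target.mem_nhds (Φ.map_source hp))).differentiableAt
      (by simp)).hasFDerivAt
  have hinj : ∀ v, fderiv ℝ Φ p v = 0 → v = 0 := by
    intro v hv
    have hc := hd2.comp p hd1
    have hid : HasFDerivAt (Φ.symm ∘ Φ) (ContinuousLinearMap.id ℝ (RSpace n)) p := by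
      refine (hasFDerivAt_id p).congr_of_eventuallyEq ?_
      filter_upwards [Φ.open_source.mem_nhds hp] with q hq
      exact Φ.left_inv hq
    have := congrArg (fun L => L v) (hc.unique hid)
    simpa [hv] using this.symm
  obtain ⟨B, hB⟩ := exists_continuousLinearEquiv_of_injective rfl _ hinj
  refine ⟨B, hB ▸ hd1, Φ.hasFDerivAt_symm (Φ.map_source hp) ?_⟩
  rw [Φ.left_inv hp, hB]
  exact hd1

/-- The velocities at `p` of curves in `M` are the vectors tangent to the model. -/
lemma IsStraightening.mem_tangentVectors_iff
    (h : IsStraightening 1 M (linearModel n d) p Φ) (hp : p ∈ M) (v : RSpace n) :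
    v ∈ tangentVectors M p ↔ fderiv ℝ Φ p v ∈ linearModel n d := by
  obtain ⟨B, hB, hB'⟩ := h.exists_equiv
  rw [hB.fderiv]
  constructor
  · rintro ⟨γ, rfl, hγ, hd⟩ i hi
    have hs : ∀ᶠ t in 𝓝 (0 : ℝ), γ t ∈ Φ.source :=
      hd.continuousAt.eventually (Φ.open_source.mem_nhds h.1)
    have h1 : HasDerivAt (fun t => Φ (γ t)) (B v) 0 := hB.comp_hasDerivAt 0 hd
    have h2 : HasDerivAt (fun t => Φ (γ t) i) (B v i) 0 :=
      (EuclideanSpace.proj (𝕜 := ℝ) i).hasFDerivAt.comp_hasDerivAt 0 h1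
    refine h2.unique ((hasDerivAt_const 0 (0 : ℝ)).congr_of_eventuallyEq ?_)
    filter_upwards [hγ, hs] with t ht hts
    exact (h.2.2.2 _ hts).1 ht i hi
  · intro hv
    have hl : HasDerivAt (fun t : ℝ => Φ p + t • B v) (B v) 0 := by
      simpa using ((hasDerivAt_id (0 : ℝ)).smul_const (B v)).const_add (Φ p)
    have h0 : (fun t : ℝ => Φ p + t • B v) 0 = Φ p := by simp
    refine ⟨fun t => Φ.symm (Φ p + t • B v), by simp [Φ.left_inv h.1], ?_, ?_⟩
    · have hc : Tendsto (fun t : ℝ => Φ p + t • B v) (𝓝 0) (𝓝 (Φ p)) := by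
        simpa [h0] using hl.continuousAt.tendsto
      filter_upwards [hc.eventually (Φ.open_target.mem_nhds (Φ.map_source h.1))] with t ht
      rw [h.2.2.2 _ (Φ.map_target ht), Φ.right_inv ht]
      intro i hi
      have := (h.2.2.2 p h.1).1 hp i hi
      have h3 : B v i = 0 := hv i hi
      simp [this, h3]
    · rw [← h0] at hB'
      have h4 := hB'.comp_hasDerivAt 0 hl
      rw [ContinuousLinearEquiv.coe_coe, B.symm_apply_apply] at h4
      exact h4

/-- A curve in a manifold with boundary through a boundary point is tangent to the boundary. -/
lemma IsStraightening.tangentVectors_boundary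
    (h : IsStraightening 1 M (halfModel n (d + 1)) p Φ) {i : Fin n} (hi : (i : ℕ) = d)
    (hp : Φ p i = 0) {v : RSpace n} (hv : v ∈ tangentVectors M p) :
    fderiv ℝ Φ p v ∈ linearModel n d := by
  obtain ⟨B, hB, hB'⟩ := h.exists_equiv
  rw [hB.fderiv]
  obtain ⟨γ, rfl, hγ, hd⟩ := hv
  have hs : ∀ᶠ t in 𝓝 (0 : ℝ), γ t ∈ Φ.source :=
    hd.continuousAt.eventually (Φ.open_source.mem_nhds h.1)
  have h1 : HasDerivAt (fun t => Φ (γ t)) (B v) 0 := hB.comp_hasDerivAt 0 hd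
  intro j hj
  have h2 : HasDerivAt (fun t => Φ (γ t) j) (B v j) 0 :=
    (EuclideanSpace.proj (𝕜 := ℝ) j).hasFDerivAt.comp_hasDerivAt 0 h1
  -- Curves are two-sided: the distinguished coordinate is nonnegative along the curve and 0 at time
  -- 0, so it has a minimum there. The later coordinates vanish along the curve.
  rcases hj.eq_or_lt with hj | hj
  · have hji : j = i := Fin.ext (by omega)
    subst hji
    refine IsLocalMin.hasDerivAt_eq_zero (a := 0) ?_ h2
    filter_upwards [hγ, hs] with t ht hts
    rw [hp]
    exact ((h.2.2.2 _ hts).1 ht).2 j (by omega)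
  · refine h2.unique ((hasDerivAt_const 0 (0 : ℝ)).congr_of_eventuallyEq ?_)
    filter_upwards [hγ, hs] with t ht hts
    exact ((h.2.2.2 _ hts).1 ht).1 j (by omega)

/-- The tangent space of a manifold is a linear subspace of dimension `d`. -/
lemma IsStraightening.exists_submodule (h : IsStraightening 1 M (linearModel n d) p Φ)
    (hp : p ∈ M) (hd : d ≤ n) :
    ∃ S : Submodule ℝ (RSpace n), (S : Set (RSpace n)) = tangentVectors M p ∧
      Module.finrank ℝ S = d := by
  obtain ⟨B, hB, hB'⟩ := h.exists_equiv
  let j : RSpace d →ₗ[ℝ] RSpace n :=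
    ((B.symm : RSpace n →L[ℝ] RSpace n) ∘L inclCoords n d : RSpace d →L[ℝ] RSpace n)
  have hj : Function.Injective j := by
    intro a b hab
    have h1 : inclCoords n d a = inclCoords n d b := B.symm.injective hab
    rw [← firstCoords_inclCoords hd a, h1, firstCoords_inclCoords hd b]
  refine ⟨LinearMap.range j, ?_, ?_⟩
  · ext v
    rw [h.mem_tangentVectors_iff hp, hB.fderiv]
    constructor
    · rintro ⟨w, rfl⟩
      have : B (j w) = inclCoords n d w := B.apply_symm_apply _
      change B (j w) ∈ _
      rw [this]
      exact inclCoords_mem w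
    · intro hv
      refine ⟨firstCoords n d hd (B v), ?_⟩
      change B.symm (inclCoords n d _) = v
      have hv' : B v ∈ linearModel n d := hv
      rw [inclCoords_firstCoords hd hv', B.symm_apply_apply]
  · rw [LinearMap.finrank_range_of_inj hj]
    simp

/-- Local parametrisation of a manifold by a map to a space of the same dimension, the derivative of
which is injective on the tangent space. -/
lemma IsStraightening.exists_local_param (h : IsStraightening 1 M (linearModel n d) p Φ)
    (hp : p ∈ M) (hd : d ≤ n) {G : Type*} [NormedAddCommGroup G] [NormedSpace ℝ G]
    [FiniteDimensional ℝ G] (hG : Module.finrank ℝ G = d) {f : RSpace n → G}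
    (hf : ContDiffAt ℝ 1 f p) (hinj : ∀ v ∈ tangentVectors M p, fderiv ℝ f p v = 0 → v = 0) :
    ∃ (O : Set (RSpace n)) (O' : Set G) (g : G → RSpace n), IsOpen O ∧ p ∈ O ∧ IsOpen O' ∧
      f p ∈ O' ∧ ContDiffOn ℝ 1 g O' ∧ (∀ b ∈ O', g b ∈ M ∧ g b ∈ O ∧ f (g b) = b) ∧
      ∀ m ∈ M, m ∈ O → f m ∈ O' ∧ g (f m) = m := by
  have hΦ : ContDiffAt ℝ 1 Φ p := h.2.1.contDiffAt (Φ.open_source.mem_nhds h.1)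
  -- Completing `f` by the chart coordinates that cut out `M` gives a local diffeomorphism of the
  -- ambient space. It carries `M` to the slice with second component 0, and its inverse on that
  -- slice is the parametrization.
  let F : RSpace n → G × ({i : Fin n // d ≤ (i : ℕ)} → ℝ) := fun q => (f q, lastCoords n d (Φ q))
  have hF : ContDiffAt ℝ 1 F p := hf.prodMk ((lastCoords n d).contDiff.contDiffAt.comp p hΦ)
  have hd1 := (hf.differentiableAt one_ne_zero).hasFDerivAt
  have hd2 := (hΦ.differentiableAt one_ne_zero).hasFDerivAt
  have hdF := hd1.prodMk ((lastCoords n d).hasFDerivAt.comp p hd2)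
  have hinjF : ∀ v, fderiv ℝ F p v = 0 → v = 0 := by
    intro v hv
    rw [show fderiv ℝ F p = _ from hdF.fderiv] at hv
    have hv1 : fderiv ℝ f p v = 0 := congrArg Prod.fst hv
    have hv2 : lastCoords n d (fderiv ℝ Φ p v) = 0 := congrArg Prod.snd hv
    exact hinj v ((h.mem_tangentVectors_iff hp v).2 (mem_linearModel_iff.2 hv2)) hv1
  obtain ⟨e, hpe, hef, he1, he2⟩ := exists_local_diffeo (by
    simp [hG, card_coords_ge]; omega) hF hinjF
  let e' := e.restrOpen Φ.source Φ.open_source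
  have hs : e'.source = e.source ∩ Φ.source := rfl
  have hpe' : p ∈ e'.source := ⟨hpe, h.1⟩
  have hc : ∀ q, e' q = F q := fun q => congrFun hef q
  have hMF : ∀ q ∈ e'.source, q ∈ M ↔ (F q).2 = 0 := fun q hq => by
    rw [h.2.2.2 q hq.2, mem_linearModel_iff]
  let ι : G → G × ({i : Fin n // d ≤ (i : ℕ)} → ℝ) := fun b => (b, 0)
  have hι : Continuous ι := by fun_prop
  refine ⟨e'.source, ι ⁻¹' e'.target, fun b => e'.symm (ι b), e'.open_source, hpe',
    e'.open_target.preimage hι, ?_, ?_, ?_, ?_⟩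
  · have := e'.map_source hpe'
    rw [hc] at this
    have h0 := (hMF p hpe').1 hp
    change (f p, (0 : {i : Fin n // d ≤ (i : ℕ)} → ℝ)) ∈ e'.target
    rwa [← h0]
  · have h1 : ContDiffOn ℝ 1 e'.symm e'.target := by
      refine he2.mono ?_
      intro y hy
      exact hy.1
    exact h1.comp (by fun_prop) (fun b hb => hb)
  · intro b hb
    have h1 : F (e'.symm (ι b)) = ι b := by rw [← hc]; exact e'.right_inv hb
    have h2 := e'.map_target hb
    exact ⟨(hMF _ h2).2 (congrArg Prod.snd h1), h2, congrArg Prod.fst h1⟩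
  · intro m hm hmO
    have h1 : F m = ι (f m) := Prod.ext rfl ((hMF m hmO).1 hm)
    have h2 := e'.map_source hmO
    rw [hc, h1] at h2
    refine ⟨h2, ?_⟩
    change e'.symm (ι (f m)) = m
    rw [← h1, ← hc, e'.left_inv hmO]

end


noncomputable section

open Metric (ball closedBall)

/-! ### Manifolds as graphs over a linear projection -/

/-- The points `y` over the ball of radius `δ` at distance less than `δ` from the point of the graph
of `g` with the same image under `P`. -/
def tubeSet {n k : ℕ} (P : RSpace n →L[ℝ] RSpace k) (g : RSpace k → RSpace n) (δ : ℝ) :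
    Set (RSpace n) :=
  {y | ‖P y‖ < δ ∧ ‖y - g (P y)‖ < δ}

/-- Inside its `δ`-tube, `X` is the image of the `C^1` section `g` of the linear map `P`. -/
structure IsTube {n k : ℕ} (X : Set (RSpace n)) (P : RSpace n →L[ℝ] RSpace k)
    (g : RSpace k → RSpace n) (δ : ℝ) : Prop where
  pos : 0 < δ
  zero : g 0 = 0
  smooth : ContDiffOn ℝ 1 g (ball 0 δ)
  proj : ∀ u ∈ ball (0 : RSpace k) δ, P (g u) = u
  mem_iff : ∀ y ∈ tubeSet P g δ, y ∈ X ↔ y = g (P y)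

variable {n k : ℕ} {X Y : Set (RSpace n)} {P : RSpace n →L[ℝ] RSpace k}
  {g : RSpace k → RSpace n} {δ : ℝ}

lemma tubeSet_mono {δ' : ℝ} (h : δ' ≤ δ) : tubeSet P g δ' ⊆ tubeSet P g δ :=
  fun _ hy => ⟨hy.1.trans_le h, hy.2.trans_le h⟩

namespace IsTube

lemma mono (h : IsTube X P g δ) {δ' : ℝ} (h0 : 0 < δ') (hδ : δ' ≤ δ) : IsTube X P g δ' :=
  ⟨h0, h.zero, h.smooth.mono (Metric.ball_subset_ball hδ),
    fun u hu => h.proj u (Metric.ball_subset_ball hδ hu),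
    fun y hy => h.mem_iff y (tubeSet_mono hδ hy)⟩

lemma congr (h : IsTube X P g δ) {X' : Set (RSpace n)}
    (hX : ∀ y ∈ tubeSet P g δ, y ∈ X' ↔ y ∈ X) : IsTube X' P g δ :=
  ⟨h.pos, h.zero, h.smooth, h.proj, fun y hy => (hX y hy).trans (h.mem_iff y hy)⟩

lemma contDiffAt (h : IsTube X P g δ) {u : RSpace k} (hu : u ∈ ball (0 : RSpace k) δ) :
    ContDiffAt ℝ 1 g u := h.smooth.contDiffAt (Metric.isOpen_ball.mem_nhds hu)

lemma hasStrictFDerivAt (h : IsTube X P g δ) {u : RSpace k} (hu : u ∈ ball (0 : RSpace k) δ) :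
    HasStrictFDerivAt g (fderiv ℝ g u) u := (h.contDiffAt hu).hasStrictFDerivAt one_ne_zero

lemma continuousAt_fderiv (h : IsTube X P g δ) {u : RSpace k} (hu : u ∈ ball (0 : RSpace k) δ) :
    ContinuousAt (fderiv ℝ g) u :=
  (h.contDiffAt hu).continuousAt_fderiv one_ne_zero

lemma proj_fderiv (h : IsTube X P g δ) {u : RSpace k} (hu : u ∈ ball (0 : RSpace k) δ)
    (v : RSpace k) : P (fderiv ℝ g u v) = v := by
  have h1 := P.hasFDerivAt.comp u (h.hasStrictFDerivAt hu).hasFDerivAt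
  have h2 : HasFDerivAt (P ∘ g) (ContinuousLinearMap.id ℝ (RSpace k)) u := by
    refine (hasFDerivAt_id u).congr_of_eventuallyEq ?_
    filter_upwards [Metric.isOpen_ball.mem_nhds hu] with w hw using h.proj w hw
  exact congrArg (fun L => L v) (h1.unique h2)

lemma isOpen_tubeSet (h : IsTube X P g δ) : IsOpen (tubeSet P g δ) := by
  have h1 : ContinuousOn (fun y => y - g (P y)) (P ⁻¹' ball 0 δ) :=
    continuousOn_id.sub (h.smooth.continuousOn.comp P.continuous.continuousOn fun _ hy => hy)
  have h2 := h1.isOpen_inter_preimage (Metric.isOpen_ball.preimage P.continuous)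
    (Metric.isOpen_ball (x := (0 : RSpace n)) (ε := δ))
  convert h2 using 1
  ext y
  simp [tubeSet]

lemma section_mem_tubeSet (h : IsTube X P g δ) {u : RSpace k} (hu : u ∈ ball (0 : RSpace k) δ) :
    g u ∈ tubeSet P g δ := by
  have := h.pos
  refine ⟨?_, ?_⟩ <;> rw [h.proj u hu]
  · simpa using hu
  · simpa

lemma section_mem (h : IsTube X P g δ) {u : RSpace k} (hu : u ∈ ball (0 : RSpace k) δ) :
    g u ∈ X := by
  rw [h.mem_iff _ (h.section_mem_tubeSet hu), h.proj u hu]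

lemma tubeSet_mem_nhds (h : IsTube X P g δ) {u : RSpace k} (hu : u ∈ ball (0 : RSpace k) δ) :
    tubeSet P g δ ∈ 𝓝 (g u) := h.isOpen_tubeSet.mem_nhds (h.section_mem_tubeSet hu)

lemma zero_mem_ball (h : IsTube X P g δ) : (0 : RSpace k) ∈ ball (0 : RSpace k) δ := by
  simpa using h.pos

/-- The tubes form a neighbourhood basis of the origin. -/
lemma exists_tubeSet_subset (h : IsTube X P g δ) {N : Set (RSpace n)} (hN : N ∈ 𝓝 0) :
    ∃ δ', 0 < δ' ∧ δ' ≤ δ ∧ tubeSet P g δ' ⊆ N := by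
  obtain ⟨ε, hε, hεN⟩ := Metric.mem_nhds_iff.1 hN
  have hc : ContinuousAt g 0 := (h.contDiffAt h.zero_mem_ball).continuousAt
  obtain ⟨η, hη, hηg⟩ := Metric.continuousAt_iff.1 hc (ε / 2) (by positivity)
  refine ⟨min δ (min η (ε / 2)), by have := h.pos; positivity, min_le_left _ _, fun y hy => ?_⟩
  apply hεN
  have h1 : ‖P y‖ < η := hy.1.trans_le ((min_le_right _ _).trans (min_le_left _ _))
  have h2 : ‖y - g (P y)‖ < ε / 2 := hy.2.trans_le ((min_le_right _ _).trans (min_le_right _ _))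
  have h3 := hηg (x := P y) (by simpa using h1)
  rw [h.zero, dist_zero_right] at h3
  rw [mem_ball_zero_iff]
  calc ‖y‖ = ‖(y - g (P y)) + g (P y)‖ := by congr 1; abel
    _ ≤ ‖y - g (P y)‖ + ‖g (P y)‖ := norm_add_le _ _
    _ < ε := by linarith

lemma tendsto_proj (h : IsTube X P g δ) {u : RSpace k} (hu : u ∈ ball (0 : RSpace k) δ) :
    Tendsto P (𝓝 (g u)) (𝓝 u) := by
  have := P.continuous.tendsto (g u)
  rwa [h.proj u hu] at this

/-- A curve in `X` satisfies γ = g ∘ P ∘ γ near time 0, so its velocity is Dg applied to something;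
conversely `g` carries lines into `X`. -/
lemma tangentVectors_eq (h : IsTube X P g δ) {u : RSpace k} (hu : u ∈ ball (0 : RSpace k) δ) :
    tangentVectors X (g u) = range (fderiv ℝ g u) := by
  have hg := (h.hasStrictFDerivAt hu).hasFDerivAt
  apply Subset.antisymm
  · rintro w ⟨γ, hγ0, hγ, hd⟩
    refine ⟨P w, ?_⟩
    have hγc : Tendsto γ (𝓝 0) (𝓝 (g u)) := hγ0 ▸ hd.continuousAt.tendsto
    have h1 : HasDerivAt (fun t => P (γ t)) (P w) 0 := P.hasFDerivAt.comp_hasDerivAt 0 hd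
    have hg' : HasFDerivAt g (fderiv ℝ g u) (P (γ 0)) := by rwa [hγ0, h.proj u hu]
    have h2 : HasDerivAt (fun t => g (P (γ t))) (fderiv ℝ g u (P w)) 0 :=
      hg'.comp_hasDerivAt 0 h1
    refine h2.unique (hd.congr_of_eventuallyEq ?_)
    filter_upwards [hγ, hγc.eventually (h.tubeSet_mem_nhds hu)] with t ht ht'
    exact ((h.mem_iff _ ht').1 ht).symm
  · rintro w ⟨v, rfl⟩
    have hl : HasDerivAt (fun t : ℝ => u + t • v) v 0 := by
      simpa using ((hasDerivAt_id (0 : ℝ)).smul_const v).const_add u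
    have h0 : (fun t : ℝ => u + t • v) 0 = u := by simp
    refine ⟨fun t => g (u + t • v), by simp, ?_, ?_⟩
    · have hc : Tendsto (fun t : ℝ => u + t • v) (𝓝 0) (𝓝 u) := by
        simpa [h0] using hl.continuousAt.tendsto
      filter_upwards [hc.eventually (Metric.isOpen_ball.mem_nhds hu)] with t ht
      exact h.section_mem ht
    · rw [← h0] at hg
      have := hg.comp_hasDerivAt 0 hl
      rw [h0] at this
      exact this

/-! ### The nearest point -/

/-- `X` need not be closed, but inside a small closed ball about `g u` it is the compact set where y
= g(P y). Points of `X` outside that ball are farther away than `g u` from any y in the ball of half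
the radius. Uniqueness of the minimizer plays no role. -/
lemma eventually_nearestPoint (h : IsTube X P g δ) {u : RSpace k}
    (hu : u ∈ ball (0 : RSpace k) δ) :
    ∀ᶠ y in 𝓝 (g u), nearestPoint X y ∈ X ∧ dist y (nearestPoint X y) = Metric.infDist y X := by
  obtain ⟨R, hR, hRt⟩ := Metric.nhds_basis_closedBall.mem_iff.1 (h.tubeSet_mem_nhds hu)
  have hcont : ContinuousOn (fun y => g (P y)) (closedBall (g u) R) :=
    h.smooth.continuousOn.comp P.continuous.continuousOn fun y hy => by
      simpa using (hRt hy).1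
  have hK : IsCompact (X ∩ closedBall (g u) R) := by
    have h1 : IsClosed {y | y ∈ closedBall (g u) R ∧ y = g (P y)} :=
      Metric.isClosed_closedBall.isClosed_eq continuousOn_id hcont
    have h2 : X ∩ closedBall (g u) R = {y | y ∈ closedBall (g u) R ∧ y = g (P y)} := by
      ext y
      constructor
      · rintro ⟨h1, h2⟩; exact ⟨h2, (h.mem_iff _ (hRt h2)).1 h1⟩
      · rintro ⟨h1, h2⟩; exact ⟨(h.mem_iff _ (hRt h1)).2 h2, h1⟩
    rw [h2]
    exact (isCompact_closedBall (g u) R).of_isClosed_subset h1 fun y hy => hy.1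
  have hne : (X ∩ closedBall (g u) R).Nonempty :=
    ⟨g u, h.section_mem hu, Metric.mem_closedBall_self hR.le⟩
  filter_upwards [Metric.ball_mem_nhds (g u) (half_pos hR)] with y hy
  obtain ⟨x₀, hx₀, hx₀d⟩ := hK.exists_infDist_eq_dist hne y
  apply Classical.epsilon_spec (p := fun x => x ∈ X ∧ dist y x = Metric.infDist y X)
  refine ⟨x₀, hx₀.1, le_antisymm ?_ (Metric.infDist_le_dist_of_mem hx₀.1)⟩
  rw [Metric.le_infDist ⟨x₀, hx₀.1⟩]
  intro x hx
  rw [Metric.mem_ball] at hy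
  by_cases hxR : x ∈ closedBall (g u) R
  · rw [← hx₀d]; exact Metric.infDist_le_dist_of_mem ⟨hx, hxR⟩
  · rw [Metric.mem_closedBall, not_le] at hxR
    have h1 : dist y x₀ ≤ dist y (g u) := by
      rw [← hx₀d]
      exact Metric.infDist_le_dist_of_mem ⟨h.section_mem hu, Metric.mem_closedBall_self hR.le⟩
    have h2 := dist_triangle x y (g u)
    rw [dist_comm x y] at h2
    linarith

lemma tendsto_nearestPoint (h : IsTube X P g δ) {u : RSpace k}
    (hu : u ∈ ball (0 : RSpace k) δ) : Tendsto (nearestPoint X) (𝓝 (g u)) (𝓝 (g u)) := by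
  rw [tendsto_iff_dist_tendsto_zero]
  have h0 : Tendsto (fun y => 2 * dist y (g u)) (𝓝 (g u)) (𝓝 0) := by
    have : Tendsto (fun y => dist y (g u)) (𝓝 (g u)) (𝓝 0) :=
      tendsto_iff_dist_tendsto_zero.1 tendsto_id
    simpa using this.const_mul 2
  refine squeeze_zero' (Eventually.of_forall fun _ => dist_nonneg) ?_ h0
  filter_upwards [h.eventually_nearestPoint hu] with y hy
  have h1 : dist y (nearestPoint X y) ≤ dist y (g u) := by
    rw [hy.2]; exact Metric.infDist_le_dist_of_mem (h.section_mem hu)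
  have h2 := dist_triangle (nearestPoint X y) y (g u)
  rw [dist_comm _ y] at h2
  linarith

end IsTube

/-- First variation: along a curve in `X` through x, the squared distance to y is minimal at time 0.
-/
lemma inner_tangent_nearest {x y z : RSpace n} (hd : dist y x = Metric.infDist y X)
    (hz : z ∈ tangentVectors X x) : inner ℝ z (y - x) = 0 := by
  obtain ⟨γ, rfl, hγ, hd'⟩ := hz
  have h1 : HasDerivAt (fun t => y - γ t) (-z) 0 := hd'.const_sub y
  have h2 := h1.norm_sq
  have hmin : IsLocalMin (fun t => ‖y - γ t‖ ^ 2) 0 := by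
    filter_upwards [hγ] with t ht
    have := Metric.infDist_le_dist_of_mem (x := y) ht
    rw [← hd, dist_eq_norm, dist_eq_norm] at this
    gcongr
  have h3 := hmin.hasDerivAt_eq_zero h2
  rw [inner_neg_right, real_inner_comm] at h3
  linarith

namespace IsTube

/-- The nearest point lies on the graph, close to the base point, and the segment to it is
orthogonal to the tangent space there. -/
lemma eventually_nearestPoint_section (h : IsTube X P g δ) {u : RSpace k}
    (hu : u ∈ ball (0 : RSpace k) δ) {B : Set (RSpace k)} (hB : B ∈ 𝓝 u) :
    ∀ᶠ y in 𝓝 (g u), P y ∈ ball (0 : RSpace k) δ ∧ P y ∈ B ∧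
      P (nearestPoint X y) ∈ ball (0 : RSpace k) δ ∧ P (nearestPoint X y) ∈ B ∧
      nearestPoint X y = g (P (nearestPoint X y)) ∧
      ‖y - nearestPoint X y‖ ≤ ‖y - g (P y)‖ ∧
      ∀ v, inner ℝ (fderiv ℝ g (P (nearestPoint X y)) v) (y - nearestPoint X y) = 0 := by
  have hb := Metric.isOpen_ball.mem_nhds hu
  have hπ := h.tendsto_nearestPoint hu
  have hP := h.tendsto_proj hu
  filter_upwards [h.eventually_nearestPoint hu, hπ.eventually (h.tubeSet_mem_nhds hu),
    hP.eventually hb, hP.eventually hB, (hP.comp hπ).eventually hb, (hP.comp hπ).eventually hB]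
    with y h1 h2 h3 h4 h5 h6
  have h7 := (h.mem_iff _ h2).1 h1.1
  refine ⟨h3, h4, h5, h6, h7, ?_, fun v => ?_⟩
  · rw [← dist_eq_norm, ← dist_eq_norm, h1.2]
    exact Metric.infDist_le_dist_of_mem (h.section_mem h3)
  · have h5' : P (nearestPoint X y) ∈ ball (0 : RSpace k) δ := h5
    have h8 : fderiv ℝ g (P (nearestPoint X y)) v ∈ tangentVectors X (g (P (nearestPoint X y))) := by
      rw [h.tangentVectors_eq h5']; exact mem_range_self v
    rw [← h7] at h8
    exact inner_tangent_nearest h1.2 h8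

/-- The secant between the two retractions of `y` is almost tangent. -/
lemma eventually_secant (h : IsTube X P g δ) {u : RSpace k}
    (hu : u ∈ ball (0 : RSpace k) δ) {η : ℝ} (hη : 0 < η) :
    ∀ᶠ y in 𝓝 (g u), ‖P y - P (nearestPoint X y)‖ ≤ 2 * ‖P‖ * ‖y - g (P y)‖ ∧
      ‖g (P y) - nearestPoint X y - fderiv ℝ g u (P y - P (nearestPoint X y))‖ ≤
        η * ‖y - g (P y)‖ := by
  -- The base points are at distance at most 2‖P‖ times |y - g(P y)|; the summand 1 only keeps the
  -- denominator positive.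
  have hη' : 0 < η / (2 * ‖P‖ + 1) := by positivity
  have hs := (hasStrictFDerivAt_iff_isLittleO.1 (h.hasStrictFDerivAt hu)).def hη'
  obtain ⟨B, hB, hBs⟩ : ∃ B ∈ 𝓝 u, ∀ a ∈ B, ∀ b ∈ B,
      ‖g a - g b - fderiv ℝ g u (a - b)‖ ≤ η / (2 * ‖P‖ + 1) * ‖a - b‖ := by
    rw [nhds_prod_eq] at hs
    obtain ⟨B, hB, hBs⟩ := (eventually_prod_self_iff (r := fun a b =>
      ‖g a - g b - fderiv ℝ g u (a - b)‖ ≤ η / (2 * ‖P‖ + 1) * ‖a - b‖)).1 hs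
    exact ⟨B, hB, fun a ha b hb => hBs a ha b hb⟩
  filter_upwards [h.eventually_nearestPoint_section hu hB] with y ⟨h1, h2, h3, h4, h5, h6, h7⟩
  have e1 : ‖P y - P (nearestPoint X y)‖ ≤ 2 * ‖P‖ * ‖y - g (P y)‖ := by
    have e2 : P y - P (nearestPoint X y) = P (g (P y) - nearestPoint X y) := by
      rw [map_sub, h.proj _ h1]
    have e3 : ‖g (P y) - nearestPoint X y‖ ≤ 2 * ‖y - g (P y)‖ := by
      calc ‖g (P y) - nearestPoint X y‖ = ‖(y - nearestPoint X y) - (y - g (P y))‖ := by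
            congr 1; abel
        _ ≤ ‖y - nearestPoint X y‖ + ‖y - g (P y)‖ := norm_sub_le _ _
        _ ≤ _ := by linarith
    rw [e2]
    calc _ ≤ ‖P‖ * ‖g (P y) - nearestPoint X y‖ := P.le_opNorm _
      _ ≤ ‖P‖ * (2 * ‖y - g (P y)‖) := by gcongr
      _ = _ := by ring
  refine ⟨e1, ?_⟩
  have e4 := hBs _ h2 _ h4
  rw [← h5] at e4
  refine e4.trans ?_
  calc _ ≤ η / (2 * ‖P‖ + 1) * (2 * ‖P‖ * ‖y - g (P y)‖) := by gcongr
    _ ≤ η / (2 * ‖P‖ + 1) * ((2 * ‖P‖ + 1) * ‖y - g (P y)‖) := by gcongr; linarith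
    _ = _ := by field_simp

end IsTube

/-- Take for `P` the first `k` coordinates of the derivative of a chart at 0. It is injective on the
tangent space, so `X` is locally parametrized by its values under `P`. -/
lemma exists_isTube (hX : IsSubmanifold 1 k X) (h0 : (0 : RSpace n) ∈ X) :
    ∃ (P : RSpace n →L[ℝ] RSpace k) (g : RSpace k → RSpace n) (δ : ℝ), IsTube X P g δ := by
  obtain ⟨hkn, hX⟩ := hX
  obtain ⟨Φ, hΦ⟩ := hX 0 h0
  obtain ⟨B, hB, -⟩ := hΦ.exists_equiv
  let P : RSpace n →L[ℝ] RSpace k := firstCoords n k hkn ∘L (B : RSpace n →L[ℝ] RSpace n)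
  obtain ⟨O, O', g, hO, h0O, hO', h0O', hg, hgO, hgm⟩ :=
    hΦ.exists_local_param h0 hkn (G := RSpace k) (by simp) (f := P) P.contDiff.contDiffAt (by
      intro v hv hPv
      rw [hΦ.mem_tangentVectors_iff h0, hB.fderiv] at hv
      rw [P.fderiv] at hPv
      have h1 := inclCoords_firstCoords hkn hv
      have h2 : firstCoords n k hkn (B v) = 0 := hPv
      rw [ContinuousLinearEquiv.coe_coe, h2, map_zero] at h1
      exact (map_eq_zero_iff B B.injective).1 h1.symm)
  rw [map_zero] at h0O'
  have hg0 : g 0 = 0 := by simpa using (hgm 0 h0 h0O).2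
  obtain ⟨δ₁, hδ₁, hδO⟩ := Metric.isOpen_iff.1 hO' 0 h0O'
  -- The parametrization only describes `X ∩ O`; a thinner tube lies inside `O`, where the
  -- intersection is invisible.
  have hT : IsTube (X ∩ O) P g δ₁ → ∃ δ, IsTube X P g δ := by
    intro hT
    obtain ⟨δ, hδ, hδ', hδs⟩ := hT.exists_tubeSet_subset (hO.mem_nhds h0O)
    refine ⟨δ, (hT.mono hδ hδ').congr fun y hy => ?_⟩
    exact ⟨fun h => ⟨h, hδs hy⟩, fun h => h.1⟩
  refine ⟨P, g, hT ⟨hδ₁, hg0, hg.mono hδO, fun u hu => (hgO u (hδO hu)).2.2, ?_⟩⟩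
  intro y hy
  constructor
  · rintro ⟨h1, h2⟩
    exact (hgm y h1 h2).2.symm
  · intro h1
    have h2 := hgO (P y) (hδO (by simpa using hy.1))
    rw [← h1] at h2
    exact ⟨h2.1, h2.2.1⟩

end


noncomputable section

open Metric (ball closedBall)
open Asymptotics

variable {n k : ℕ} {X Y : Set (RSpace n)} {P : RSpace n →L[ℝ] RSpace k}
  {g : RSpace k → RSpace n} {δ : ℝ}

/-! ### Unit vectors -/

lemma norm_unitVector {w : RSpace n} (hw : w ≠ 0) : ‖unitVector w‖ = 1 := by
  rw [unitVector, norm_smul, norm_inv, norm_norm, inv_mul_cancel₀ (norm_ne_zero_iff.2 hw)]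

lemma norm_smul_unitVector (w : RSpace n) : ‖w‖ • unitVector w = w := by
  by_cases hw : w = 0
  · simp [hw]
  · rw [unitVector, smul_smul, mul_inv_cancel₀ (norm_ne_zero_iff.2 hw), one_smul]

lemma unitVector_smul {c : ℝ} (hc : 0 < c) (w : RSpace n) : unitVector (c • w) = unitVector w := by
  rw [unitVector, unitVector, norm_smul, Real.norm_of_nonneg hc.le, smul_smul, mul_inv,
    mul_right_comm, inv_mul_cancel₀ hc.ne', one_mul]

lemma unitVector_neg (w : RSpace n) : unitVector (-w) = -unitVector w := by
  simp [unitVector]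

lemma continuousAt_unitVector {w : RSpace n} (hw : w ≠ 0) : ContinuousAt unitVector w :=
  (continuousAt_id.norm.inv₀ (norm_ne_zero_iff.2 hw)).smul continuousAt_id

/-- The orthogonal projection to the normal space of the graph of `g` at `g u`. -/
def normalProj (g : RSpace k → RSpace n) (u : RSpace k) : RSpace n →L[ℝ] RSpace n :=
  (LinearMap.range (fderiv ℝ g u : RSpace k →ₗ[ℝ] RSpace n))ᗮ.starProjection

lemma normalProj_fderiv (g : RSpace k → RSpace n) (u v : RSpace k) :
    normalProj g u (fderiv ℝ g u v) = 0 := by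
  rw [normalProj, Submodule.starProjection_apply_eq_zero_iff]
  exact Submodule.le_orthogonal_orthogonal _ ⟨v, rfl⟩

lemma norm_normalProj_le (g : RSpace k → RSpace n) (u : RSpace k) (w : RSpace n) :
    ‖normalProj g u w‖ ≤ ‖w‖ :=
  Submodule.norm_starProjection_apply_le _ _

namespace IsTube

lemma eq_zero_of_normalProj (h : IsTube X P g δ) {u : RSpace k}
    (hu : u ∈ ball (0 : RSpace k) δ) {w : RSpace n} (hw : P w = 0) (h0 : normalProj g u w = 0) :
    w = 0 := by
  rw [normalProj, Submodule.starProjection_apply_eq_zero_iff,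
    Submodule.orthogonal_orthogonal] at h0
  obtain ⟨v, rfl⟩ := h0
  have : v = 0 := by rw [← h.proj_fderiv hu v]; exact hw
  simp [this]

/-- The normal projection is injective on the kernel of `P`, because that kernel meets the tangent
space only in 0. Equal image directions thus force two unit vectors to be positive multiples of each
other, hence equal. -/
lemma unitVector_normalProj_injective (h : IsTube X P g δ) {u : RSpace k}
    (hu : u ∈ ball (0 : RSpace k) δ) {w w' : RSpace n} (hw : P w = 0) (hw' : P w' = 0)
    (h1 : ‖w‖ = 1) (h1' : ‖w'‖ = 1)
    (he : unitVector (normalProj g u w) = unitVector (normalProj g u w')) : w = w' := by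
  have hne : normalProj g u w ≠ 0 := fun h0 => by
    simp [h.eq_zero_of_normalProj hu hw h0] at h1
  have hne' : normalProj g u w' ≠ 0 := fun h0 => by
    simp [h.eq_zero_of_normalProj hu hw' h0] at h1'
  set c := ‖normalProj g u w‖ with hc
  set c' := ‖normalProj g u w'‖ with hc'
  have e1 : normalProj g u (c' • w - c • w') = 0 := by
    rw [map_sub, map_smul, map_smul, ← norm_smul_unitVector (normalProj g u w),
      ← norm_smul_unitVector (normalProj g u w'), he, smul_smul, smul_smul, ← hc, ← hc',
      mul_comm, sub_self]
  have e2 := h.eq_zero_of_normalProj hu (by simp [hw, hw']) e1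
  have e3 : c' • w = c • w' := sub_eq_zero.1 e2
  have hcc : c' = c := by
    have := congrArg norm e3
    rwa [norm_smul, norm_smul, h1, h1', mul_one, mul_one, Real.norm_of_nonneg (norm_nonneg _),
      Real.norm_of_nonneg (norm_nonneg _)] at this
  rw [hcc] at e3
  exact smul_right_injective _ (norm_ne_zero_iff.2 hne) e3

/-- Up to a smaller error, the segment from the nearest point to `y` is the normal component of the
segment from the linear retraction to `y`. -/
lemma isLittleO_nearestPoint (h : IsTube X P g δ) {u : RSpace k}
    (hu : u ∈ ball (0 : RSpace k) δ) :
    (fun y => (y - nearestPoint X y) - normalProj g u (y - g (P y))) =o[𝓝 (g u)]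
      fun y => y - g (P y) := by
  rw [isLittleO_iff]
  intro η hη
  have hη' : 0 < η / (2 * (‖P‖ + 1)) := by positivity
  have hB : {a | ‖fderiv ℝ g u - fderiv ℝ g a‖ < η / (2 * (‖P‖ + 1))} ∈ 𝓝 u := by
    have := Metric.continuousAt_iff'.1 (h.continuousAt_fderiv hu) _ hη'
    filter_upwards [this] with a ha
    rwa [dist_comm, dist_eq_norm] at ha
  filter_upwards [h.eventually_nearestPoint_section hu hB, h.eventually_secant hu (half_pos hη)]
    with y ⟨h1, h2, h3, h4, h5, h6, h7⟩ ⟨_, h8⟩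
  set d := y - nearestPoint X y with hd
  set w := y - g (P y) with hw
  set R := LinearMap.range (fderiv ℝ g u : RSpace k →ₗ[ℝ] RSpace n) with hR
  -- Two errors: the component of `d` tangent at `g u`, small because `d` is orthogonal to the
  -- tangent space at a nearby point; and the normal component of `d - w`, a secant of `X` that is
  -- almost tangent.
  have e1 : d - normalProj g u w = R.starProjection d + normalProj g u (d - w) := by
    have e2 : normalProj g u d = d - R.starProjection d := by
      rw [normalProj, Submodule.starProjection_orthogonal']
      simp [hR]
    rw [map_sub (normalProj g u) d w, e2]; abel
  have e3 : ‖R.starProjection d‖ ≤ η / 2 * ‖w‖ := by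
    obtain ⟨v, hv⟩ : R.starProjection d ∈ R := Submodule.starProjection_apply_mem _ _
    set t := R.starProjection d with ht
    have hv' : fderiv ℝ g u v = t := hv
    -- The squared norm of the tangential component is a pairing with `d`. Replacing Dg at `u` by Dg
    -- at the nearest point makes this pairing 0, so only the small variation of Dg contributes.
    have e4 : inner ℝ t d = ‖t‖ ^ 2 := by
      have : inner ℝ t (d - t) = 0 := by
        exact (Submodule.mem_orthogonal R _).1 (Submodule.sub_starProjection_mem_orthogonal d) _
          ⟨v, hv⟩
      rw [inner_sub_right, real_inner_self_eq_norm_sq] at this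
      linarith
    have e5 : ‖v‖ ≤ ‖P‖ * ‖t‖ := by
      rw [← h.proj_fderiv hu v, hv']; exact P.le_opNorm _
    have e6 : ‖t‖ ^ 2 ≤ η / (2 * (‖P‖ + 1)) * (‖P‖ * ‖t‖) * ‖w‖ := by
      rw [← e4, ← hv', ← sub_zero (inner ℝ _ d), ← h7 v, ← inner_sub_left,
        ← sub_apply]
      refine (real_inner_le_norm _ _).trans ?_
      refine mul_le_mul (((fderiv ℝ g u - fderiv ℝ g _).le_opNorm v).trans ?_) h6
        (norm_nonneg _) (by positivity)
      rw [← hv'] at e5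
      exact mul_le_mul h4.le e5 (norm_nonneg _) hη'.le
    by_contra hcon
    rw [not_le] at hcon
    have htpos : 0 < ‖t‖ := lt_of_le_of_lt (by positivity) hcon
    have e7 : η / (2 * (‖P‖ + 1)) * (‖P‖ * ‖t‖) * ‖w‖ ≤ η / 2 * ‖w‖ * ‖t‖ := by
      have : η / (2 * (‖P‖ + 1)) * ‖P‖ ≤ η / 2 := by
        rw [div_mul_eq_mul_div, div_le_div_iff₀ (by positivity) (by positivity)]
        nlinarith
      calc _ = η / (2 * (‖P‖ + 1)) * ‖P‖ * (‖w‖ * ‖t‖) := by ring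
        _ ≤ η / 2 * (‖w‖ * ‖t‖) := by gcongr
        _ = _ := by ring
    nlinarith
  have e8 : ‖normalProj g u (d - w)‖ ≤ η / 2 * ‖w‖ := by
    have e9 : d - w = g (P y) - nearestPoint X y := by rw [hd, hw]; abel
    have e10 : normalProj g u (d - w) =
        normalProj g u (d - w - fderiv ℝ g u (P y - P (nearestPoint X y))) := by
      rw [map_sub (normalProj g u) (d - w), normalProj_fderiv, sub_zero]
    rw [e10]
    refine (norm_normalProj_le _ _ _).trans ?_
    rw [e9]; exact h8
  rw [e1]
  calc _ ≤ ‖R.starProjection d‖ + ‖normalProj g u (d - w)‖ := norm_add_le _ _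
    _ ≤ η * ‖w‖ := by linarith

/-- The limits of the two secant directions determine each other. -/
lemma tendsto_nearestPoint_direction (h : IsTube X P g δ) {u : RSpace k}
    (hu : u ∈ ball (0 : RSpace k) δ) {l : Filter (RSpace n)} (hl : l ≤ 𝓝 (g u))
    (hne : ∀ᶠ y in l, y - g (P y) ≠ 0) {θ : RSpace n} (hθ : normalProj g u θ ≠ 0)
    (ht : Tendsto (fun y => unitVector (y - g (P y))) l (𝓝 θ)) :
    Tendsto (fun y => unitVector (nearestPoint X y - y)) l (𝓝 (-unitVector (normalProj g u θ))) := by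
  have h1 : Tendsto (fun y => ‖y - g (P y)‖⁻¹ •
      ((y - nearestPoint X y) - normalProj g u (y - g (P y)))) l (𝓝 0) := by
    rw [tendsto_zero_iff_norm_tendsto_zero]
    have := ((h.isLittleO_nearestPoint hu).mono hl).norm_norm.tendsto_div_nhds_zero
    refine this.congr fun y => ?_
    rw [norm_smul, norm_inv, norm_norm, div_eq_inv_mul]
  have h2 : Tendsto (fun y => normalProj g u (unitVector (y - g (P y)))) l
      (𝓝 (normalProj g u θ)) := ((normalProj g u).continuous.tendsto θ).comp ht
  have h3 : Tendsto (fun y => ‖y - g (P y)‖⁻¹ • (y - nearestPoint X y)) l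
      (𝓝 (normalProj g u θ)) := by
    have := h1.add h2
    rw [zero_add] at this
    refine this.congr fun y => ?_
    rw [unitVector, map_smul, ← smul_add, sub_add_cancel]
  have h4 := ((continuousAt_unitVector hθ).tendsto.comp h3).neg
  refine h4.congr' ?_
  filter_upwards [hne] with y hy
  rw [Function.comp_apply, unitVector_smul (by positivity), ← unitVector_neg, neg_sub]

end IsTube

/-! ### The normal cone -/

/-- A point of the closure is a limit along an ultrafilter on pairs (y, direction of y). Its first
component tends to x inside S \ X, where the direction has only one possible limit. -/
lemma eq_of_mem_normalCone {S : Set (RSpace n)} {x q q₀ : RSpace n}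
    (hq : (x, q) ∈ normalCone X S)
    (ht : Tendsto (fun y => unitVector (nearestPoint X y - y)) (𝓝[S \ X] x) (𝓝 q₀)) : q = q₀ := by
  obtain ⟨-, hq⟩ := hq
  obtain ⟨l, hl, hlx⟩ := mem_closure_iff_ultrafilter.1 hq
  have h1 : Tendsto Prod.fst (l : Filter (RSpace n × RSpace n)) (𝓝 x) :=
    (continuous_fst.tendsto (x, q)).mono_left hlx
  have h2 : Tendsto Prod.snd (l : Filter (RSpace n × RSpace n)) (𝓝 q) :=
    (continuous_snd.tendsto (x, q)).mono_left hlx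
  have h3 : Tendsto Prod.fst (l : Filter (RSpace n × RSpace n)) (𝓝[S \ X] x) := by
    refine tendsto_nhdsWithin_iff.2 ⟨h1, ?_⟩
    filter_upwards [hl] with z hz
    obtain ⟨y, hy, rfl⟩ := hz
    exact hy
  refine tendsto_nhds_unique h2 ((ht.comp h3).congr' ?_)
  filter_upwards [hl] with z hz
  obtain ⟨y, hy, rfl⟩ := hz
  rfl

lemma mem_normalCone_of_tendsto {S : Set (RSpace n)} {x q : RSpace n} (hx : x ∈ X)
    {l : Filter (RSpace n)} [l.NeBot] (hl : l ≤ 𝓝[S \ X] x)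
    (ht : Tendsto (fun y => unitVector (nearestPoint X y - y)) l (𝓝 q)) :
    (x, q) ∈ normalCone X S := by
  refine ⟨hx, ?_⟩
  have h1 : Tendsto (fun y => (y, unitVector (nearestPoint X y - y))) l (𝓝 (x, q)) :=
    (tendsto_id.mono_left (hl.trans nhdsWithin_le_nhds)).prodMk_nhds ht
  refine mem_closure_of_tendsto h1 ?_
  filter_upwards [hl self_mem_nhdsWithin] with y hy
  exact mem_image_of_mem _ hy

end


noncomputable section

open Metric (ball closedBall)
open Asymptotics

variable {n k : ℕ} {X Y : Set (RSpace n)} {P : RSpace n →L[ℝ] RSpace k}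
  {g : RSpace k → RSpace n} {δ : ℝ}

/-! ### Linear maps almost inverse to each other on a subspace -/

section LinearAlgebra

variable {E H : Type*} [NormedAddCommGroup E] [InnerProductSpace ℝ E] [FiniteDimensional ℝ E]
  [NormedAddCommGroup H] [NormedSpace ℝ H] {S : Submodule ℝ E}
  {L : H →L[ℝ] E} {D : E →L[ℝ] H} {η : ℝ}

/-- Test the hypothesis on the orthogonal component of L z itself. Later `S` is the tangent space of
`Y`, `L` the model frame and `D` the differential of the collar coordinates. -/
lemma norm_sub_starProjection_le (h0 : 0 ≤ η)
    (hη : ∀ a ∈ Sᗮ, ∀ z, |inner ℝ a (L z)| ≤ η * ‖a‖ * ‖z‖) (z : H) :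
    ‖S.starProjection (L z) - L z‖ ≤ η * ‖z‖ := by
  set a := L z - S.starProjection (L z) with ha
  have haS : a ∈ Sᗮ := Submodule.sub_starProjection_mem_orthogonal _
  have h1 : inner ℝ a (L z) = ‖a‖ ^ 2 := by
    have h2 : inner ℝ (S.starProjection (L z)) a = 0 :=
      (Submodule.mem_orthogonal S _).1 haS _ (Submodule.starProjection_apply_mem _ _)
    rw [real_inner_comm] at h2
    rw [← real_inner_self_eq_norm_sq, ha, inner_sub_right, ← ha, h2, sub_zero]
  have h3 := hη a haS z
  rw [h1, abs_of_nonneg (by positivity)] at h3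
  rw [norm_sub_rev, ← ha]
  rcases (norm_nonneg a).eq_or_lt with h4 | h4
  · rw [← h4]; positivity
  · nlinarith

variable [FiniteDimensional ℝ H]

/-- Since D L = id and projecting L z to `S` moves it little, `D` almost inverts the projected map.
That map is therefore injective, and onto `S` by dimension. -/
lemma exists_eq_starProjection (hS : Module.finrank ℝ S = Module.finrank ℝ H)
    (hDL : ∀ z, D (L z) = z)
    (hη : ∀ z, ‖S.starProjection (L z) - L z‖ ≤ η * ‖z‖) (hDη : ‖D‖ * η ≤ 1 / 2) {v : E}
    (hv : v ∈ S) : ∃ z, S.starProjection (L z) = v ∧ ‖z - D v‖ ≤ ‖D‖ * η * ‖z‖ := by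
  have h1 : ∀ z, ‖z - D (S.starProjection (L z))‖ ≤ ‖D‖ * η * ‖z‖ := by
    intro z
    have : z - D (S.starProjection (L z)) = -D (S.starProjection (L z) - L z) := by
      rw [map_sub, hDL]; abel
    rw [this, norm_neg, mul_assoc]
    exact (D.le_opNorm _).trans (by gcongr; exact hη z)
  let T : H →ₗ[ℝ] S := (S.orthogonalProjectionOnto ∘L L : H →L[ℝ] S)
  have hT : ∀ z, (T z : E) = S.starProjection (L z) := fun z => rfl
  have hinj : Function.Injective T := by
    rw [injective_iff_map_eq_zero]
    intro z hz
    have h2 := h1 z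
    rw [← hT, hz] at h2
    simp only [ZeroMemClass.coe_zero, map_zero, sub_zero] at h2
    have : ‖D‖ * η * ‖z‖ ≤ 1 / 2 * ‖z‖ := by gcongr
    have : ‖z‖ = 0 := le_antisymm (by linarith) (norm_nonneg z)
    exact norm_eq_zero.1 this
  obtain ⟨z, hz⟩ := (LinearMap.injective_iff_surjective_of_finrank_eq_finrank hS.symm).1 hinj ⟨v, hv⟩
  have hzv : S.starProjection (L z) = v := by rw [← hT, hz]
  exact ⟨z, hzv, by rw [← hzv]; exact h1 z⟩

lemma eq_zero_of_almost_inverse (hS : Module.finrank ℝ S = Module.finrank ℝ H)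
    (hDL : ∀ z, D (L z) = z)
    (hη : ∀ z, ‖S.starProjection (L z) - L z‖ ≤ η * ‖z‖) (hDη : ‖D‖ * η ≤ 1 / 2) {v : E}
    (hv : v ∈ S) (h0 : D v = 0) : v = 0 := by
  obtain ⟨z, rfl, hz⟩ := exists_eq_starProjection hS hDL hη hDη hv
  rw [h0, sub_zero] at hz
  have : ‖D‖ * η * ‖z‖ ≤ 1 / 2 * ‖z‖ := by gcongr
  have : ‖z‖ = 0 := le_antisymm (by linarith) (norm_nonneg z)
  simp [norm_eq_zero.1 this]

/-- Write R w as the projection of L z. Applying `D` shows that z is close to w, so R w is close to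
L w. -/
lemma norm_section_sub_le (hS : Module.finrank ℝ S = Module.finrank ℝ H)
    (hDL : ∀ z, D (L z) = z) (h0 : 0 ≤ η)
    (hη : ∀ z, ‖S.starProjection (L z) - L z‖ ≤ η * ‖z‖) (hDη : ‖D‖ * η ≤ 1 / 2) {R : H →L[ℝ] E}
    (hR : ∀ z, R z ∈ S) (hDR : ∀ z, D (R z) = z) :
    ‖R - L‖ ≤ 2 * η * (1 + ‖L‖ * ‖D‖) := by
  refine ContinuousLinearMap.opNorm_le_bound _ (by positivity) fun w => ?_
  obtain ⟨z, hz, hzw⟩ := exists_eq_starProjection hS hDL hη hDη (hR w)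
  rw [hDR] at hzw
  have h1 : ‖D‖ * η * ‖z‖ ≤ 1 / 2 * ‖z‖ := by gcongr
  have h2 : ‖z‖ ≤ ‖z - w‖ + ‖w‖ := by
    calc ‖z‖ = ‖(z - w) + w‖ := by rw [sub_add_cancel]
      _ ≤ _ := norm_add_le _ _
  have h3 : ‖z‖ ≤ 2 * ‖w‖ := by linarith
  have h4 : (R - L) w = (S.starProjection (L z) - L z) + L (z - w) := by
    rw [sub_apply, ← hz, map_sub]; abel
  rw [h4]
  calc _ ≤ ‖S.starProjection (L z) - L z‖ + ‖L (z - w)‖ := norm_add_le _ _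
    _ ≤ η * ‖z‖ + ‖L‖ * (‖D‖ * η * ‖z‖) := by
      gcongr
      · exact hη z
      · exact (L.le_opNorm _).trans (by gcongr)
    _ = ‖z‖ * (η * (1 + ‖L‖ * ‖D‖)) := by ring
    _ ≤ (2 * ‖w‖) * (η * (1 + ‖L‖ * ‖D‖)) := by gcongr
    _ = _ := by ring

end LinearAlgebra

/-! ### Collar coordinates -/

/-- The coordinates of `y` relative to the graph of `g`: the projection of `y`, and the distance to
the point of the graph above it. -/
def collarMap (P : RSpace n →L[ℝ] RSpace k) (g : RSpace k → RSpace n) (y : RSpace n) :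
    RSpace k × ℝ := (P y, ‖y - g (P y)‖)

/-- The direction from the graph of `g` to `y` in the fibre of `P`. -/
def collarDir (P : RSpace n →L[ℝ] RSpace k) (g : RSpace k → RSpace n) (y : RSpace n) : RSpace n :=
  unitVector (y - g (P y))

/-- The linear map `(v, t) ↦ Dg v + t θ`. -/
def frameMap (g : RSpace k → RSpace n) (u : RSpace k) (θ : RSpace n) :
    RSpace k × ℝ →L[ℝ] RSpace n :=
  (fderiv ℝ g u).coprod (ContinuousLinearMap.toSpanSingleton ℝ θ)

@[simp] lemma frameMap_apply (g : RSpace k → RSpace n) (u : RSpace k) (θ : RSpace n)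
    (z : RSpace k × ℝ) : frameMap g u θ z = fderiv ℝ g u z.1 + z.2 • θ := by
  simp [frameMap]

lemma norm_frameMap_le (g : RSpace k → RSpace n) (u : RSpace k) (θ : RSpace n) :
    ‖frameMap g u θ‖ ≤ ‖fderiv ℝ g u‖ + ‖θ‖ := by
  refine ContinuousLinearMap.opNorm_le_bound _ (by positivity) fun z => ?_
  rw [frameMap_apply, add_mul]
  refine (norm_add_le _ _).trans (add_le_add ?_ ?_)
  · exact ((fderiv ℝ g u).le_opNorm _).trans (by gcongr; exact norm_fst_le z)
  · rw [norm_smul, mul_comm]; gcongr; exact norm_snd_le z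

lemma norm_collarDir_le (y : RSpace n) : ‖collarDir P g y‖ ≤ 1 := by
  by_cases h : y - g (P y) = 0
  · simp [collarDir, h, unitVector]
  · rw [collarDir, norm_unitVector h]

namespace IsTube

lemma sub_ne_zero (h : IsTube X P g δ) {y : RSpace n} (hy : y ∈ tubeSet P g δ) (hyX : y ∉ X) :
    y - g (P y) ≠ 0 := fun h0 => hyX ((h.mem_iff y hy).2 (_root_.sub_eq_zero.1 h0))

lemma proj_collarDir (h : IsTube X P g δ) {y : RSpace n} (hy : y ∈ tubeSet P g δ) :
    P (collarDir P g y) = 0 := by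
  rw [collarDir, unitVector, map_smul, map_sub, h.proj _ (by simpa using hy.1), sub_self, smul_zero]

lemma contDiffAt_sub (h : IsTube X P g δ) {y : RSpace n} (hy : y ∈ tubeSet P g δ) :
    ContDiffAt ℝ 1 (fun y => y - g (P y)) y :=
  contDiffAt_id.sub ((h.contDiffAt (by simpa using hy.1)).comp y P.contDiff.contDiffAt)

lemma contDiffAt_collarMap (h : IsTube X P g δ) {y : RSpace n} (hy : y ∈ tubeSet P g δ)
    (hyX : y ∉ X) : ContDiffAt ℝ 1 (collarMap P g) y :=
  P.contDiff.contDiffAt.prodMk ((h.contDiffAt_sub hy).norm ℝ (h.sub_ne_zero hy hyX))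

lemma continuousOn_collarMap (h : IsTube X P g δ) :
    ContinuousOn (collarMap P g) (P ⁻¹' ball 0 δ) :=
  P.continuous.continuousOn.prodMk (continuousOn_id.sub
    (h.smooth.continuousOn.comp P.continuous.continuousOn fun _ hy => hy)).norm

lemma fderiv_collarMap (h : IsTube X P g δ) {y : RSpace n} (hy : y ∈ tubeSet P g δ)
    (hyX : y ∉ X) (v : RSpace n) : fderiv ℝ (collarMap P g) y v =
      (P v, inner ℝ (collarDir P g y) (v - fderiv ℝ g (P y) (P v))) := by
  have hne := h.sub_ne_zero hy hyX
  have hu : P y ∈ ball (0 : RSpace k) δ := by simpa using hy.1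
  have h1 : HasFDerivAt (fun y => y - g (P y))
      (ContinuousLinearMap.id ℝ (RSpace n) - (fderiv ℝ g (P y)).comp P) y :=
    (hasFDerivAt_id y).sub ((h.hasStrictFDerivAt hu).hasFDerivAt.comp y P.hasFDerivAt)
  have h2 : DifferentiableAt ℝ (fun y => ‖y - g (P y)‖) y :=
    ((h.contDiffAt_sub hy).norm ℝ hne).differentiableAt one_ne_zero
  have h3 := (P.hasFDerivAt (x := y)).prodMk h2.hasFDerivAt
  rw [show fderiv ℝ (collarMap P g) y = _ from h3.fderiv]
  refine Prod.ext rfl ?_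
  change fderiv ℝ (fun y => ‖y - g (P y)‖) y v = _
  have h4 := h1.norm_sq
  have h5 := h2.hasFDerivAt.pow 2
  -- The derivative of the norm is read off from two expressions for the derivative of its square,
  -- after division by twice the norm.
  have h6 := congrArg (fun L => L v) (h4.unique h5)
  have hpos : ‖y - g (P y)‖ ≠ 0 := norm_ne_zero_iff.2 hne
  simp only [map_sub] at h6
  simp at h6
  rw [collarDir, unitVector, inner_smul_left]
  simp only [inner_sub_left, inner_sub_right, map_inv₀, conj_trivial]
  field_simp
  linarith

/-- The frame is an exact right inverse: `P` inverts Dg and kills the direction, and the distance to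
the graph grows at unit rate along the direction. -/
lemma fderiv_collarMap_frameMap (h : IsTube X P g δ) {y : RSpace n} (hy : y ∈ tubeSet P g δ)
    (hyX : y ∉ X) (z : RSpace k × ℝ) :
    fderiv ℝ (collarMap P g) y (frameMap g (P y) (collarDir P g y) z) = z := by
  have hu : P y ∈ ball (0 : RSpace k) δ := by simpa using hy.1
  have h1 : P (frameMap g (P y) (collarDir P g y) z) = z.1 := by
    rw [frameMap_apply, map_add, map_smul, h.proj_fderiv hu, h.proj_collarDir hy]; simp
  rw [h.fderiv_collarMap hy hyX, h1]
  refine Prod.ext rfl ?_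
  change inner ℝ _ _ = _
  rw [frameMap_apply, add_sub_cancel_left, inner_smul_right, real_inner_self_eq_norm_sq, collarDir,
    norm_unitVector (h.sub_ne_zero hy hyX)]
  simp

lemma norm_fderiv_collarMap_le (h : IsTube X P g δ) {y : RSpace n} (hy : y ∈ tubeSet P g δ)
    (hyX : y ∉ X) :
    ‖fderiv ℝ (collarMap P g) y‖ ≤ ‖P‖ + (1 + ‖fderiv ℝ g (P y)‖ * ‖P‖) := by
  refine ContinuousLinearMap.opNorm_le_bound _ (by positivity) fun v => ?_
  rw [h.fderiv_collarMap hy hyX, Prod.norm_mk]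
  have h1 : ‖P v‖ ≤ ‖P‖ * ‖v‖ := P.le_opNorm v
  have h2 : ‖fderiv ℝ g (P y) (P v)‖ ≤ ‖fderiv ℝ g (P y)‖ * (‖P‖ * ‖v‖) :=
    ((fderiv ℝ g (P y)).le_opNorm _).trans (by gcongr)
  have h3 : ‖inner ℝ (collarDir P g y) (v - fderiv ℝ g (P y) (P v))‖ ≤
      1 * ‖v - fderiv ℝ g (P y) (P v)‖ :=
    (norm_inner_le_norm _ _).trans (by gcongr; exact norm_collarDir_le y)
  have h4 : ‖v - fderiv ℝ g (P y) (P v)‖ ≤ ‖v‖ + ‖fderiv ℝ g (P y) (P v)‖ := norm_sub_le _ _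
  have h5 : 0 ≤ ‖fderiv ℝ g (P y)‖ * (‖P‖ * ‖v‖) := by positivity
  have h6 : 0 ≤ ‖P‖ * ‖v‖ := by positivity
  have h7 : 0 ≤ ‖v‖ := by positivity
  apply max_le <;> nlinarith

end IsTube

/-! ### Whitney's condition in collar coordinates -/

lemma neg_mem_normalVectors {y a : RSpace n} (ha : a ∈ normalVectors Y y) :
    -a ∈ normalVectors Y y := fun z hz => by rw [inner_neg_right, ha z hz, neg_zero]

lemma inner_unitVector_le_one (a b : RSpace n) : inner ℝ (unitVector a) (unitVector b) ≤ 1 := by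
  have h : ∀ w : RSpace n, ‖unitVector w‖ ≤ 1 := fun w => by
    by_cases hw : w = 0
    · simp [hw, unitVector]
    · rw [norm_unitVector hw]
  exact (real_inner_le_norm _ _).trans (mul_le_one₀ (h a) (norm_nonneg _) (h b))

lemma inner_eq_unitVector (a b : RSpace n) :
    inner ℝ a b = ‖a‖ * ‖b‖ * inner ℝ (unitVector a) (unitVector b) := by
  conv_lhs => rw [← norm_smul_unitVector a, ← norm_smul_unitVector b]
  rw [inner_smul_left, inner_smul_right]
  simp [mul_assoc]

/-- The supremum bounds inner products from one side only; the absolute value comes from the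
symmetry a ↦ -a of the normal space. The set is bounded by 1, so `sSup` is a genuine supremum. -/
lemma abs_inner_le_whitneyAlpha {y a b : RSpace n} (ha : a ∈ normalVectors Y y)
    (hb : b ∈ tangentVectors X (nearestPoint X y)) :
    |inner ℝ a b| ≤ whitneyAlpha X Y y * ‖a‖ * ‖b‖ := by
  by_cases ha0 : a = 0
  · simp [ha0]
  by_cases hb0 : b = 0
  · simp [hb0]
  have key : ∀ a' ∈ normalVectors Y y, a' ≠ 0 → ‖a'‖ = ‖a‖ →
      inner ℝ a' b ≤ whitneyAlpha X Y y * ‖a‖ * ‖b‖ := by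
    intro a' ha' ha0' hn
    rw [inner_eq_unitVector, hn, mul_comm, mul_assoc]
    gcongr
    refine le_csSup ⟨1, ?_⟩ ⟨a', ha', b, hb, ha0', hb0, rfl⟩
    rintro s ⟨_, _, _, _, _, _, rfl⟩
    exact inner_unitVector_le_one _ _
  refine abs_le'.2 ⟨key a ha ha0 rfl, ?_⟩
  rw [← inner_neg_left]
  exact key (-a) (neg_mem_normalVectors ha) (neg_ne_zero.2 ha0) (norm_neg a)

lemma abs_inner_le_whitneyBeta {y a : RSpace n} (ha : a ∈ normalVectors Y y) :
    |inner ℝ a (nearestPoint X y - y)| ≤ whitneyBeta X Y y * ‖a‖ * ‖nearestPoint X y - y‖ := by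
  by_cases ha0 : a = 0
  · simp [ha0]
  have key : ∀ a' ∈ normalVectors Y y, a' ≠ 0 → ‖a'‖ = ‖a‖ →
      inner ℝ a' (nearestPoint X y - y) ≤
        whitneyBeta X Y y * ‖a‖ * ‖nearestPoint X y - y‖ := by
    intro a' ha' ha0' hn
    rw [inner_eq_unitVector, hn, mul_comm, mul_assoc]
    gcongr
    refine le_csSup ⟨1, ?_⟩ ⟨a', ha', ha0', rfl⟩
    rintro s ⟨_, _, _, rfl⟩
    exact inner_unitVector_le_one _ _
  refine abs_le'.2 ⟨key a ha ha0 rfl, ?_⟩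
  rw [← inner_neg_left]
  exact key (-a) (neg_mem_normalVectors ha) (neg_ne_zero.2 ha0) (norm_neg a)

namespace IsTube

/-- Near `g u`, Whitney's condition says that the frame is almost tangent to `Y`. -/
lemma eventually_inner_frameMap (h : IsTube X P g δ) {u : RSpace k}
    (hu : u ∈ ball (0 : RSpace k) δ)
    (hα : Tendsto (whitneyAlpha X Y) (𝓝[Y] (g u)) (𝓝 0))
    (hβ : Tendsto (whitneyBeta X Y) (𝓝[Y] (g u)) (𝓝 0)) {η : ℝ} (hη : 0 < η) :
    ∀ᶠ y in 𝓝[Y] (g u), ∀ a ∈ normalVectors Y y, ∀ z,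
      |inner ℝ a (frameMap g (P y) (collarDir P g y) z)| ≤ η * ‖a‖ * ‖z‖ := by
  -- `C` bounds Dg near `u`. `K` adds the factor `C + 2` for the tangent part of the frame to the
  -- factor for the direction, so that all errors sum to ε K ≤ η.
  set C := ‖fderiv ℝ g u‖ + 1 with hC
  have hCpos : 0 < C := by positivity
  set K := C + 2 + (2 + (C + 1) * (2 * ‖P‖)) with hK
  have hKpos : 0 < K := by positivity
  set ε := min 1 (η / K) with hε
  have hεpos : 0 < ε := by positivity
  have hεK : ε * K ≤ η := by
    calc ε * K ≤ η / K * K := by gcongr; exact min_le_right _ _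
      _ = η := by field_simp
  have hB : {a | ‖fderiv ℝ g a - fderiv ℝ g u‖ < ε} ∈ 𝓝 u := by
    filter_upwards [Metric.continuousAt_iff'.1 (h.continuousAt_fderiv hu) _ hεpos] with a ha
    rwa [dist_eq_norm] at ha
  filter_upwards [hα.eventually (gt_mem_nhds hεpos), hβ.eventually (gt_mem_nhds hεpos),
    nhdsWithin_le_nhds (h.eventually_nearestPoint_section hu hB),
    nhdsWithin_le_nhds (h.eventually_secant hu hεpos)]
    with y hαy hβy ⟨h1, h2, h3, h4, h5, h6, _⟩ ⟨h7, h8⟩ a ha z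
  set u₁ := P (nearestPoint X y) with hu₁
  have ht : ∀ v, |inner ℝ a (fderiv ℝ g u₁ v)| ≤ ε * C * ‖a‖ * ‖v‖ := by
    intro v
    have hb : fderiv ℝ g u₁ v ∈ tangentVectors X (nearestPoint X y) := by
      rw [h5, h.tangentVectors_eq h3]; exact mem_range_self v
    refine (abs_inner_le_whitneyAlpha ha hb).trans ?_
    have h9 : ‖fderiv ℝ g u₁‖ ≤ C := by
      have : ‖fderiv ℝ g u₁‖ ≤ ‖fderiv ℝ g u₁ - fderiv ℝ g u‖ + ‖fderiv ℝ g u‖ := by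
        simpa using norm_add_le (fderiv ℝ g u₁ - fderiv ℝ g u) (fderiv ℝ g u)
      have h10 : ‖fderiv ℝ g u₁ - fderiv ℝ g u‖ < ε := h4
      have : ε ≤ 1 := min_le_left _ _
      linarith
    have h10 : ‖fderiv ℝ g u₁ v‖ ≤ C * ‖v‖ := ((fderiv ℝ g u₁).le_opNorm v).trans (by gcongr)
    calc _ ≤ ε * ‖a‖ * ‖fderiv ℝ g u₁ v‖ := by gcongr
      _ ≤ ε * ‖a‖ * (C * ‖v‖) := by gcongr
      _ = _ := by ring
  have hd : ∀ u' v, ‖fderiv ℝ g u' - fderiv ℝ g u‖ < ε →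
      |inner ℝ a (fderiv ℝ g u' v - fderiv ℝ g u v)| ≤ ε * ‖a‖ * ‖v‖ := by
    intro u' v hu'
    refine (abs_real_inner_le_norm _ _).trans ?_
    rw [← sub_apply]
    calc _ ≤ ‖a‖ * (ε * ‖v‖) := by
          gcongr
          exact ((fderiv ℝ g u' - fderiv ℝ g u).le_opNorm v).trans (by gcongr)
      _ = _ := by ring
  have hv : ∀ v, |inner ℝ a (fderiv ℝ g u v)| ≤ ε * (C + 1) * ‖a‖ * ‖v‖ := by
    intro v
    have e1 := ht v
    have e2 := hd u₁ v h4
    have e3 : inner ℝ a (fderiv ℝ g u v) = inner ℝ a (fderiv ℝ g u₁ v) -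
        inner ℝ a (fderiv ℝ g u₁ v - fderiv ℝ g u v) := by rw [inner_sub_right]; ring
    calc _ ≤ ε * C * ‖a‖ * ‖v‖ + ε * ‖a‖ * ‖v‖ := by
          rw [e3]; exact (abs_sub _ _).trans (add_le_add e1 e2)
      _ = _ := by ring
  have hv2 : |inner ℝ a (fderiv ℝ g (P y) z.1)| ≤ ε * (C + 2) * ‖a‖ * ‖z‖ := by
    have e1 := hv z.1
    have e2 := hd (P y) z.1 h2
    have e3 : inner ℝ a (fderiv ℝ g (P y) z.1) = inner ℝ a (fderiv ℝ g u z.1) +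
        inner ℝ a (fderiv ℝ g (P y) z.1 - fderiv ℝ g u z.1) := by rw [inner_sub_right]; ring
    calc _ ≤ ε * (C + 1) * ‖a‖ * ‖z.1‖ + ε * ‖a‖ * ‖z.1‖ := by
          rw [e3]; exact (abs_add_le _ _).trans (add_le_add e1 e2)
      _ = ε * (C + 2) * ‖a‖ * ‖z.1‖ := by ring
      _ ≤ _ := by gcongr; exact norm_fst_le z
  set ρ := ‖y - g (P y)‖ with hρ
  have hw : |inner ℝ a (y - g (P y))| ≤ ε * (2 + (C + 1) * (2 * ‖P‖)) * ‖a‖ * ρ := by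
    have e1 : |inner ℝ a (nearestPoint X y - y)| ≤ ε * ‖a‖ * ρ := by
      refine (abs_inner_le_whitneyBeta ha).trans ?_
      rw [norm_sub_rev]
      gcongr
    have e2 := hv (P y - u₁)
    have e3 : |inner ℝ a (g (P y) - nearestPoint X y - fderiv ℝ g u (P y - u₁))| ≤
        ‖a‖ * (ε * ρ) := (abs_real_inner_le_norm _ _).trans (by gcongr)
    have e4 : ε * (C + 1) * ‖a‖ * ‖P y - u₁‖ ≤ ε * (C + 1) * ‖a‖ * (2 * ‖P‖ * ρ) := by gcongr
    -- The secant to the linear retraction splits into the secant to the nearest point, controlled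
    -- by β; a second-order error along `X`; and a tangent vector of `X`, controlled by α.
    have e5 : inner ℝ a (y - g (P y)) = -inner ℝ a (nearestPoint X y - y) -
        inner ℝ a (g (P y) - nearestPoint X y - fderiv ℝ g u (P y - u₁)) -
        inner ℝ a (fderiv ℝ g u (P y - u₁)) := by
      simp only [inner_sub_right]; ring
    rw [e5]
    calc _ ≤ |inner ℝ a (nearestPoint X y - y)| +
          |inner ℝ a (g (P y) - nearestPoint X y - fderiv ℝ g u (P y - u₁))| +
          |inner ℝ a (fderiv ℝ g u (P y - u₁))| := by
          refine (abs_sub _ _).trans (add_le_add_left ((abs_sub _ _).trans ?_) _)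
          rw [abs_neg]
      _ ≤ ε * ‖a‖ * ρ + ‖a‖ * (ε * ρ) + ε * (C + 1) * ‖a‖ * (2 * ‖P‖ * ρ) :=
          add_le_add (add_le_add e1 e3) (e2.trans e4)
      _ = _ := by ring
  have hθ : |inner ℝ a (collarDir P g y)| ≤ ε * (2 + (C + 1) * (2 * ‖P‖)) * ‖a‖ := by
    rw [collarDir, unitVector, inner_smul_right, abs_mul, abs_of_nonneg (by positivity), ← hρ]
    calc ρ⁻¹ * |inner ℝ a (y - g (P y))| ≤
          ρ⁻¹ * (ε * (2 + (C + 1) * (2 * ‖P‖)) * ‖a‖ * ρ) := by gcongr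
      _ = ε * (2 + (C + 1) * (2 * ‖P‖)) * ‖a‖ * (ρ⁻¹ * ρ) := by ring
      _ ≤ ε * (2 + (C + 1) * (2 * ‖P‖)) * ‖a‖ * 1 := by
        gcongr; exact inv_mul_le_one
      _ = _ := mul_one _
  rw [frameMap_apply, inner_add_right, inner_smul_right]
  calc _ ≤ |inner ℝ a (fderiv ℝ g (P y) z.1)| + |z.2 * inner ℝ a (collarDir P g y)| :=
        abs_add_le _ _
    _ ≤ ε * (C + 2) * ‖a‖ * ‖z‖ + ‖z‖ * (ε * (2 + (C + 1) * (2 * ‖P‖)) * ‖a‖) := by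
        rw [abs_mul]
        gcongr
        exact norm_snd_le z
    _ = ε * K * ‖a‖ * ‖z‖ := by rw [hK]; ring
    _ ≤ η * ‖a‖ * ‖z‖ := by gcongr

/-- Near `g u`, Whitney's condition makes the collar coordinates independent on the tangent spaces
of `Y`, and the coordinate frame on `Y` close to the model frame. -/
lemma eventually_frame (h : IsTube X P g δ) (hY : IsSubmanifold 1 (k + 1) Y) (hXY : Disjoint X Y)
    {u : RSpace k} (hu : u ∈ ball (0 : RSpace k) δ)
    (hα : Tendsto (whitneyAlpha X Y) (𝓝[Y] (g u)) (𝓝 0))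
    (hβ : Tendsto (whitneyBeta X Y) (𝓝[Y] (g u)) (𝓝 0)) {η : ℝ} (hη : 0 < η) :
    ∀ᶠ y in 𝓝[Y] (g u),
      (∀ v ∈ tangentVectors Y y, fderiv ℝ (collarMap P g) y v = 0 → v = 0) ∧
      ∀ R : RSpace k × ℝ →L[ℝ] RSpace n, (∀ z, R z ∈ tangentVectors Y y) →
        (∀ z, fderiv ℝ (collarMap P g) y (R z) = z) →
        ‖R - frameMap g (P y) (collarDir P g y)‖ ≤ η := by
  set C := ‖fderiv ℝ g u‖ + 1 with hC
  have hCpos : 0 < C := by positivity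
  set D := ‖P‖ + (1 + C * ‖P‖) with hD
  have hDpos : 0 < D := by positivity
  set L := C + 1 with hL
  -- The first bound provides the 1/2 under which `D` is almost an inverse; the second makes the
  -- final error 2η'(1 + LD) at most η.
  set η' := min (1 / 2 / D) (η / (2 * (1 + L * D))) with hη'
  have hη'pos : 0 < η' := by positivity
  have hB : ∀ᶠ a in 𝓝 u, ‖fderiv ℝ g a‖ < C :=
    (h.continuousAt_fderiv hu).norm.eventually (gt_mem_nhds (by linarith))
  filter_upwards [h.eventually_inner_frameMap hu hα hβ hη'pos, self_mem_nhdsWithin,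
    nhdsWithin_le_nhds (h.tubeSet_mem_nhds hu),
    nhdsWithin_le_nhds ((h.tendsto_proj hu).eventually hB)] with y h1 hyY hyt h2
  obtain ⟨Φ, hΦ⟩ := hY.2 y hyY
  obtain ⟨S, hS, hSd⟩ := hΦ.exists_submodule hyY hY.1
  have hyX : y ∉ X := fun hyX => hXY.le_bot ⟨hyX, hyY⟩
  have hnorm : ∀ a ∈ Sᗮ, a ∈ normalVectors Y y := by
    intro a ha z hz
    rw [← hS] at hz
    exact (Submodule.mem_orthogonal S a).1 ha z hz
  have hpr := norm_sub_starProjection_le (S := S) hη'pos.le fun a ha z => h1 a (hnorm a ha) z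
  have hdim : Module.finrank ℝ S = Module.finrank ℝ (RSpace k × ℝ) := by rw [hSd]; simp
  have hDL := h.fderiv_collarMap_frameMap hyt hyX
  have hDn : ‖fderiv ℝ (collarMap P g) y‖ ≤ D :=
    (h.norm_fderiv_collarMap_le hyt hyX).trans (by rw [hD]; gcongr)
  have hDη : ‖fderiv ℝ (collarMap P g) y‖ * η' ≤ 1 / 2 := by
    calc _ ≤ D * (1 / 2 / D) := by gcongr; exact min_le_left _ _
      _ = 1 / 2 := by field_simp
  have hLn : ‖frameMap g (P y) (collarDir P g y)‖ ≤ L :=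
    (norm_frameMap_le _ _ _).trans (add_le_add h2.le (norm_collarDir_le y))
  refine ⟨fun v hv h0 => ?_, fun R hR hDR => ?_⟩
  · rw [← hS] at hv
    exact eq_zero_of_almost_inverse hdim hDL hpr hDη hv h0
  · rw [← hS] at hR
    refine (norm_section_sub_le hdim hDL hη'pos.le hpr hDη hR hDR).trans ?_
    calc _ ≤ 2 * (η / (2 * (1 + L * D))) * (1 + L * D) := by
          gcongr; exact min_le_right _ _
      _ = η := by
          have : 1 + L * D ≠ 0 := by positivity
          field_simp

end IsTube

end


noncomputable section

open Metric (ball closedBall)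

/-! ### Proper local homeomorphisms -/

/-- Fibres are compact, and discrete by local injectivity, hence finite; a closed local
homeomorphism with finite fibres evenly covers its base. -/
lemma IsLocalHomeomorph.isCoveringMap_of_isCompact_preimage {E B : Type*} [TopologicalSpace E]
    [TopologicalSpace B] [T2Space E] [T2Space B] [LocallyCompactSpace B] {f : E → B}
    (hf : IsLocalHomeomorph f) (hK : ∀ K, IsCompact K → IsCompact (f ⁻¹' K)) :
    IsCoveringMap f := by
  have hp : IsProperMap f := isProperMap_iff_isCompact_preimage.2 ⟨hf.continuous, hK⟩
  rw [isCoveringMap_iff_isCoveringMapOn_univ]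
  refine hp.isClosedMap.isCoveringMapOn_of_isLocalHomeomorphOn (fun x _ => ?_)
    (by simpa [← isLocalHomeomorph_iff_isLocalHomeomorphOn_univ])
  refine (hK _ isCompact_singleton).finite ?_
  refine IsDiscrete.of_openPartialHomeomorph f subset_rfl fun e _ => ?_
  obtain ⟨φ, hφ, rfl⟩ := hf e
  exact ⟨φ, hφ, rfl⟩

/-- A covering of a simply connected space with a fibre that does not meet two components is
injective. -/
lemma IsCoveringMap.injective_of_isPreconnected {E B : Type*} [TopologicalSpace E]
    [TopologicalSpace B] [T2Space E] [SimplyConnectedSpace B] [LocallyPathConnectedSpace B]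
    {f : E → B} (hf : IsCoveringMap f) {Z : Set E} (hZ : IsPreconnected Z) {b : B}
    (hb : f ⁻¹' {b} ⊆ Z) : Function.Injective f := by
  -- Simple connectedness lifts the identity, so a global section passes through every point.
  have hs : ∀ e, ∃ s : C(B, E), s (f e) = e ∧ f ∘ s = id := fun e =>
    (hf.existsUnique_continuousMap_lifts (ContinuousMap.id B) (f e) e rfl).exists
  intro e₁ e₂ he
  obtain ⟨s₁, h1, h1'⟩ := hs e₁
  obtain ⟨s₂, h2, h2'⟩ := hs e₂
  have hfs₁ : ∀ a, f (s₁ a) = a := fun a => congrFun h1' a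
  have hfs₂ : ∀ a, f (s₂ a) = a := fun a => congrFun h2' a
  have hopen : IsOpen (range s₁) :=
    (hf.isLocalHomeomorph.isOpenEmbedding_of_comp (by rw [h1']; exact Topology.IsOpenEmbedding.id)
      s₁.continuous).isOpen_range
  have hclosed : IsClosed (range s₁) := by
    have : range s₁ = {e | s₁ (f e) = e} := by
      ext e
      constructor
      · rintro ⟨a, rfl⟩; exact congrArg s₁ (hfs₁ a)
      · intro h; exact ⟨f e, h⟩
    rw [this]
    exact isClosed_eq (s₁.continuous.comp hf.continuous) continuous_id
  -- The range of a section is clopen, so it contains all of `Z` and in particular the whole fibre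
  -- over `b`. Hence the two sections agree at `b`, and so everywhere.
  have hsub := hZ.subset_isClopen ⟨hclosed, hopen⟩ ⟨s₁ b, hb (hfs₁ b), mem_range_self b⟩
  obtain ⟨a, ha⟩ := hsub (hb (hfs₂ b))
  have hab : a = b := by rw [← hfs₁ a, ha, hfs₂ b]
  rw [hab] at ha
  have : (s₁ : B → E) = s₂ :=
    hf.eq_of_comp_eq s₁.continuous s₂.continuous (h1'.trans h2'.symm) b ha
  rw [← h1, ← h2, he, this]

variable {n k : ℕ} {X Y : Set (RSpace n)} {P : RSpace n →L[ℝ] RSpace k}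
  {g : RSpace k → RSpace n} {δ : ℝ}

/-- The domain of the collar coordinates. -/
def collarBase (k : ℕ) (δ : ℝ) : Set (RSpace k × ℝ) := ball 0 δ ×ˢ Ioo 0 δ

lemma isOpen_collarBase (k : ℕ) (δ : ℝ) : IsOpen (collarBase k δ) :=
  Metric.isOpen_ball.prod isOpen_Ioo

namespace IsTube

lemma collarMap_mem (h : IsTube X P g δ) {y : RSpace n} (hy : y ∈ tubeSet P g δ) (hyX : y ∉ X) :
    collarMap P g y ∈ collarBase k δ :=
  ⟨by simpa [collarMap] using hy.1, norm_pos_iff.2 (h.sub_ne_zero hy hyX), hy.2⟩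

lemma mem_tubeSet_of_collarMap {y : RSpace n} (hy : collarMap P g y ∈ collarBase k δ) :
    y ∈ tubeSet P g δ := ⟨by simpa [collarMap] using hy.1, hy.2.2⟩

/-- Properness: a limit of points of `Y` inside the tube lies in `X ∪ Y`, and it is not in `X`
because the distance coordinate stays positive on `K`. Boundedness comes from that of `g` on a
compact set. -/
lemma isCompact_collarMap_preimage (h : IsTube X P g δ)
    {C : Set (RSpace n)} (hC : IsClosed C) (hCS : ∀ y ∈ tubeSet P g δ, y ∈ C ↔ y ∈ X ∪ Y)
    {K : Set (RSpace k × ℝ)} (hK : IsCompact K) (hKB : K ⊆ collarBase k δ) :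
    IsCompact {y | y ∈ Y ∧ collarMap P g y ∈ K} := by
  have hK1 : IsCompact (Prod.fst '' K) := hK.image continuous_fst
  have hK1δ : Prod.fst '' K ⊆ ball 0 δ := by
    rintro _ ⟨b, hb, rfl⟩; exact (hKB hb).1
  have hcl : IsClosed ((P ⁻¹' (Prod.fst '' K)) ∩ collarMap P g ⁻¹' K) :=
    (h.continuousOn_collarMap.mono (preimage_mono hK1δ)).preimage_isClosed_of_isClosed
      (hK1.isClosed.preimage P.continuous) hK.isClosed
  have hset : {y | y ∈ Y ∧ collarMap P g y ∈ K} =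
      (P ⁻¹' (Prod.fst '' K)) ∩ collarMap P g ⁻¹' K ∩ C := by
    ext y
    constructor
    · rintro ⟨h1, h2⟩
      have ht := mem_tubeSet_of_collarMap (hKB h2)
      exact ⟨⟨⟨_, h2, rfl⟩, h2⟩, (hCS y ht).2 (Or.inr h1)⟩
    · rintro ⟨⟨-, h2⟩, h3⟩
      have ht := mem_tubeSet_of_collarMap (hKB h2)
      refine ⟨((hCS y ht).1 h3).resolve_left fun hyX => ?_, h2⟩
      have h4 : 0 < ‖y - g (P y)‖ := (hKB h2).2.1
      rw [(h.mem_iff y ht).1 hyX, h.proj _ (by simpa using ht.1), sub_self, norm_zero] at h4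
      exact lt_irrefl _ h4
  rw [hset]
  refine Metric.isCompact_of_isClosed_isBounded (hcl.inter hC) ?_
  obtain ⟨R, hR⟩ := (hK1.image_of_continuousOn
    (h.smooth.continuousOn.mono hK1δ)).isBounded.exists_norm_le
  rw [isBounded_iff_forall_norm_le]
  refine ⟨δ + R, ?_⟩
  rintro y ⟨⟨h1, h2⟩, -⟩
  have h3 := hR _ (mem_image_of_mem g h1)
  have h4 : ‖y - g (P y)‖ < δ := (hKB h2).2.2
  calc ‖y‖ = ‖(y - g (P y)) + g (P y)‖ := by rw [sub_add_cancel]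
    _ ≤ ‖y - g (P y)‖ + ‖g (P y)‖ := norm_add_le _ _
    _ ≤ δ + R := by linarith

/-- Local inverses of the collar coordinates on `Y`. -/
lemma exists_collar_local_inverse (h : IsTube X P g δ) (hY : IsSubmanifold 1 (k + 1) Y)
    (hXY : Disjoint X Y)
    (hinj : ∀ y ∈ Y, y ∈ tubeSet P g δ →
      ∀ v ∈ tangentVectors Y y, fderiv ℝ (collarMap P g) y v = 0 → v = 0)
    {y : RSpace n} (hyY : y ∈ Y) (hyt : y ∈ tubeSet P g δ) :
    ∃ (O : Set (RSpace n)) (O' : Set (RSpace k × ℝ)) (s : RSpace k × ℝ → RSpace n),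
      IsOpen O ∧ y ∈ O ∧ IsOpen O' ∧ collarMap P g y ∈ O' ∧ ContDiffOn ℝ 1 s O' ∧
      (∀ b ∈ O', s b ∈ Y ∧ s b ∈ tubeSet P g δ ∧ s b ∈ O ∧ collarMap P g (s b) = b) ∧
      ∀ m ∈ Y, m ∈ O → m ∈ tubeSet P g δ → collarMap P g m ∈ O' ∧ s (collarMap P g m) = m := by
  obtain ⟨Φ, hΦ⟩ := hY.2 y hyY
  have hyX : y ∉ X := fun hyX => hXY.le_bot ⟨hyX, hyY⟩
  obtain ⟨O, O', s, hO, hyO, hO', hyO', hs, h1, h2⟩ := hΦ.exists_local_param hyY hY.1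
    (G := RSpace k × ℝ) (by simp) (h.contDiffAt_collarMap hyt hyX) (hinj y hyY hyt)
  refine ⟨O, O' ∩ s ⁻¹' tubeSet P g δ, s, hO, hyO,
    hs.continuousOn.isOpen_inter_preimage hO' h.isOpen_tubeSet,
    ⟨hyO', ?_⟩, hs.mono inter_subset_left, ?_, ?_⟩
  · rw [mem_preimage, (h2 y hyY hyO).2]; exact hyt
  · rintro b ⟨hb, hbt⟩
    exact ⟨(h1 b hb).1, hbt, (h1 b hb).2.1, (h1 b hb).2.2⟩
  · intro m hm hmO hmt
    refine ⟨⟨(h2 m hm hmO).1, ?_⟩, (h2 m hm hmO).2⟩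
    rw [mem_preimage, (h2 m hm hmO).2]; exact hmt

lemma isLocalHomeomorph_collarMap (h : IsTube X P g δ) (hY : IsSubmanifold 1 (k + 1) Y)
    (hXY : Disjoint X Y)
    (hinj : ∀ y ∈ Y, y ∈ tubeSet P g δ →
      ∀ v ∈ tangentVectors Y y, fderiv ℝ (collarMap P g) y v = 0 → v = 0)
    {f : ↥(Y ∩ tubeSet P g δ) → ↥(collarBase k δ)}
    (hf : ∀ y, (f y : RSpace k × ℝ) = collarMap P g y) : IsLocalHomeomorph f := by
  have hfc : Continuous f := by
    refine continuous_induced_rng.2 ?_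
    have h1 := h.continuousOn_collarMap.mono (s := P ⁻¹' ball 0 δ) (t := Y ∩ tubeSet P g δ)
      (fun y hy => by simpa using hy.2.1)
    exact (continuousOn_iff_continuous_domRestrict.1 h1).congr fun y => (hf y).symm
  refine IsLocalHomeomorph.mk f fun y => ?_
  obtain ⟨O, O', s, hO, hyO, hO', hyO', hs, h1, h2⟩ :=
    h.exists_collar_local_inverse hY hXY hinj y.2.1 y.2.2
  classical
  let s' : ↥(collarBase k δ) → ↥(Y ∩ tubeSet P g δ) := fun b =>
    if hb : (b : RSpace k × ℝ) ∈ O' then ⟨s b, (h1 b hb).1, (h1 b hb).2.1⟩ else y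
  have hs' : ∀ b : ↥(collarBase k δ), (b : RSpace k × ℝ) ∈ O' → (s' b : RSpace n) = s b := by
    intro b hb
    simp only [s', dif_pos hb]
  refine ⟨⟨⟨⟨f, s', Subtype.val ⁻¹' O, Subtype.val ⁻¹' O', ?_, ?_, ?_, ?_⟩,
    hfc.continuousOn, ?_⟩, hO.preimage continuous_subtype_val,
    hO'.preimage continuous_subtype_val⟩, hyO, fun _ _ => rfl⟩
  · intro m hm
    rw [mem_preimage, hf]
    exact (h2 m m.2.1 hm m.2.2).1
  · intro b hb
    rw [mem_preimage, hs' b hb]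
    exact (h1 b hb).2.2.1
  · intro m hm
    have h3 := h2 m m.2.1 hm m.2.2
    apply Subtype.ext
    rw [hs' _ (by rw [hf]; exact h3.1), hf, h3.2]
  · intro b hb
    apply Subtype.ext
    rw [hf, hs' b hb, (h1 b hb).2.2.2]
  · rw [Topology.IsInducing.subtypeVal.continuousOn_iff]
    refine ContinuousOn.congr (f := fun b : ↥(collarBase k δ) => s b) ?_ fun b hb => hs' b hb
    exact hs.continuousOn.comp continuous_subtype_val.continuousOn fun b hb => hb

/-- If the collar coordinates are independent on the tangent spaces of `Y`, and `Y` is connected near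
the origin, then `Y` is a graph in the collar coordinates. -/
theorem existsUnique_collar (h : IsTube X P g δ) (hY : IsSubmanifold 1 (k + 1) Y)
    (hXY : Disjoint X Y)
    {C : Set (RSpace n)} (hC : IsClosed C) (hCS : ∀ y ∈ tubeSet P g δ, y ∈ C ↔ y ∈ X ∪ Y)
    (hinj : ∀ y ∈ Y, y ∈ tubeSet P g δ →
      ∀ v ∈ tangentVectors Y y, fderiv ℝ (collarMap P g) y v = 0 → v = 0)
    (hcl : (0 : RSpace n) ∈ closure Y) {ε : ℝ} (hε : 0 < ε) (hεt : ball 0 ε ⊆ tubeSet P g δ)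
    (hconn : IsPreconnected (Y ∩ ball 0 ε)) {b : RSpace k × ℝ} (hb : b ∈ collarBase k δ) :
    ∃! y, y ∈ Y ∧ collarMap P g y = b := by
  have hδ := h.pos
  have hmem : ∀ y ∈ Y ∩ tubeSet P g δ, collarMap P g y ∈ collarBase k δ := fun y hy =>
    h.collarMap_mem hy.2 fun hyX => hXY.le_bot ⟨hyX, hy.1⟩
  let f : ↥(Y ∩ tubeSet P g δ) → ↥(collarBase k δ) := fun y => ⟨collarMap P g y, hmem y y.2⟩
  have hloc : IsLocalHomeomorph f := h.isLocalHomeomorph_collarMap hY hXY hinj fun _ => rfl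
  have hconv : Convex ℝ (collarBase k δ) := (convex_ball 0 δ).prod (convex_Ioo 0 δ)
  have := hconv.contractibleSpace ⟨b, hb⟩
  have := (isOpen_collarBase k δ).locallyCompactSpace
  have := (isOpen_collarBase k δ).locallyPathConnectedSpace
  have hcov : IsCoveringMap f := by
    refine hloc.isCoveringMap_of_isCompact_preimage fun K hK => ?_
    rw [Topology.IsEmbedding.subtypeVal.isCompact_iff]
    have h1 := h.isCompact_collarMap_preimage hC hCS (hK.image continuous_subtype_val)
      (by rintro _ ⟨b, -, rfl⟩; exact b.2)
    convert h1 using 1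
    ext y
    constructor
    · rintro ⟨y, hy, rfl⟩
      exact ⟨y.2.1, ⟨_, hy, rfl⟩⟩
    · rintro ⟨hy, ⟨b', hb', hbe⟩⟩
      have hyt : y ∈ tubeSet P g δ := mem_tubeSet_of_collarMap (by rw [← hbe]; exact b'.2)
      refine ⟨⟨y, hy, hyt⟩, ?_, rfl⟩
      have : f ⟨y, hy, hyt⟩ = b' := Subtype.ext hbe.symm
      rw [mem_preimage, this]
      exact hb'
  have hZ : IsPreconnected
      ((Subtype.val : ↥(Y ∩ tubeSet P g δ) → RSpace n) ⁻¹' (Y ∩ ball 0 ε)) := by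
    rw [← Topology.IsInducing.subtypeVal.isPreconnected_image, Subtype.image_preimage_coe,
      inter_eq_right.2]
    · exact hconn
    · exact fun y hy => ⟨hy.1, hεt hy.2⟩
  -- As `g 0 = 0`, a point with collar coordinates `(0, r)` has norm `r`. With r < ε this whole
  -- fibre lies in the connected set `Y ∩ ball 0 ε`.
  obtain ⟨r, hr0, hr⟩ := exists_between (lt_min hε hδ)
  have hr' : ((0, r) : RSpace k × ℝ) ∈ collarBase k δ :=
    ⟨by simpa, hr0, hr.trans_le (min_le_right _ _)⟩
  have hinjf : Function.Injective f := by
    refine hcov.injective_of_isPreconnected hZ (b := ⟨(0, r), hr'⟩) fun y hy => ?_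
    have h1 : collarMap P g y = (0, r) := congrArg Subtype.val hy
    have h2 : P y = 0 := congrArg Prod.fst h1
    have h3 : ‖(y : RSpace n) - g (P y)‖ = r := congrArg Prod.snd h1
    rw [h2, h.zero, sub_zero] at h3
    refine ⟨y.2.1, ?_⟩
    rw [mem_ball_zero_iff, h3]
    exact hr.trans_le (min_le_left _ _)
  -- Surjectivity: one point of `Y` near 0 suffices, since the section lifted through it is defined
  -- over the whole base.
  obtain ⟨y₀, hy₀b, hy₀⟩ := mem_closure_iff_nhds.1 hcl _ (Metric.ball_mem_nhds 0 hε)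
  let e₀ : ↥(Y ∩ tubeSet P g δ) := ⟨y₀, hy₀, hεt hy₀b⟩
  obtain ⟨s, ⟨-, hs⟩, -⟩ :=
    hcov.existsUnique_continuousMap_lifts (ContinuousMap.id _) (f e₀) e₀ rfl
  have hsb : f (s ⟨b, hb⟩) = ⟨b, hb⟩ := congrFun hs ⟨b, hb⟩
  refine ⟨s ⟨b, hb⟩, ⟨(s ⟨b, hb⟩).2.1, congrArg Subtype.val hsb⟩, ?_⟩
  rintro y ⟨hy, hyb⟩
  have hyt : y ∈ tubeSet P g δ := mem_tubeSet_of_collarMap (by rw [hyb]; exact hb)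
  have : f ⟨y, hy, hyt⟩ = f (s ⟨b, hb⟩) := by
    rw [hsb]; exact Subtype.ext hyb
  exact congrArg Subtype.val (hinjf this)

/-- The graph in collar coordinates is of class `C^1`. -/
lemma exists_collar_section (h : IsTube X P g δ) (hY : IsSubmanifold 1 (k + 1) Y)
    (hXY : Disjoint X Y)
    (hinj : ∀ y ∈ Y, y ∈ tubeSet P g δ →
      ∀ v ∈ tangentVectors Y y, fderiv ℝ (collarMap P g) y v = 0 → v = 0)
    (huniq : ∀ b ∈ collarBase k δ, ∃! y, y ∈ Y ∧ collarMap P g y = b) :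
    ∃ s : RSpace k × ℝ → RSpace n, ContDiffOn ℝ 1 s (collarBase k δ) ∧
      (∀ b ∈ collarBase k δ, s b ∈ Y ∧ s b ∈ tubeSet P g δ ∧ collarMap P g (s b) = b) ∧
      (∀ y ∈ Y, y ∈ tubeSet P g δ → s (collarMap P g y) = y) ∧
      ∀ b ∈ collarBase k δ, ∀ z, fderiv ℝ s b z ∈ tangentVectors Y (s b) ∧
        fderiv ℝ (collarMap P g) (s b) (fderiv ℝ s b z) = z := by
  classical
  choose! s hs hsu using fun b (hb : b ∈ collarBase k δ) => huniq b hb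
  have hst : ∀ b ∈ collarBase k δ, s b ∈ tubeSet P g δ := fun b hb =>
    mem_tubeSet_of_collarMap (by rw [(hs b hb).2]; exact hb)
  have hsm : ContDiffOn ℝ 1 s (collarBase k δ) := by
    intro b hb
    obtain ⟨O, O', s', hO, hyO, hO', hyO', hs', h1, h2⟩ :=
      h.exists_collar_local_inverse hY hXY hinj (hs b hb).1 (hst b hb)
    rw [(hs b hb).2] at hyO'
    refine (ContDiffAt.congr_of_eventuallyEq (hs'.contDiffAt (hO'.mem_nhds hyO'))
      ?_).contDiffWithinAt
    filter_upwards [hO'.mem_nhds hyO', (isOpen_collarBase k δ).mem_nhds hb] with b' hb' hb'B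
    exact (hsu b' hb'B (s' b') ⟨(h1 b' hb').1, (h1 b' hb').2.2.2⟩).symm
  refine ⟨s, hsm, fun b hb => ⟨(hs b hb).1, hst b hb, (hs b hb).2⟩, ?_, ?_⟩
  · intro y hy hyt
    have hyX : y ∉ X := fun hyX => hXY.le_bot ⟨hyX, hy⟩
    exact (hsu _ (h.collarMap_mem hyt hyX) y ⟨hy, rfl⟩).symm
  · intro b hb z
    have hB := (isOpen_collarBase k δ).mem_nhds hb
    have hd : HasFDerivAt s (fderiv ℝ s b) b :=
      ((hsm.contDiffAt hB).differentiableAt one_ne_zero).hasFDerivAt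
    constructor
    · have hl : HasDerivAt (fun t : ℝ => b + t • z) z 0 := by
        simpa using ((hasDerivAt_id (0 : ℝ)).smul_const z).const_add b
      have h0 : (fun t : ℝ => b + t • z) 0 = b := by simp
      refine ⟨fun t => s (b + t • z), by simp, ?_, ?_⟩
      · have hc : Tendsto (fun t : ℝ => b + t • z) (𝓝 0) (𝓝 b) := by
          simpa [h0] using hl.continuousAt.tendsto
        filter_upwards [hc.eventually hB] with t ht using (hs _ ht).1
      · rw [← h0] at hd
        have := hd.comp_hasDerivAt 0 hl
        rw [h0] at this
        exact this
    · have hsX : s b ∉ X := fun hX => hXY.le_bot ⟨hX, (hs b hb).1⟩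
      have h1 := ((h.contDiffAt_collarMap (hst b hb) hsX).differentiableAt
        one_ne_zero).hasFDerivAt.comp b hd
      have h2 : HasFDerivAt (collarMap P g ∘ s) (ContinuousLinearMap.id ℝ (RSpace k × ℝ)) b := by
        refine (hasFDerivAt_id b).congr_of_eventuallyEq ?_
        filter_upwards [hB] with b' hb' using (hs b' hb').2
      exact congrArg (fun L => L z) (h1.unique h2)

end IsTube

end


noncomputable section

open Metric (ball closedBall)

/-! ### One-variable o-minimality -/

/-- An interval that meets every (0, ρ) contains everything between two of its points, hence a whole
right neighbourhood of 0 minus 0 itself. -/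
lemma Set.OrdConnected.eventually_mem_or {I : Set ℝ} (hI : I.OrdConnected) :
    (∀ᶠ r in 𝓝[>] (0 : ℝ), r ∈ I) ∨ ∀ᶠ r in 𝓝[>] (0 : ℝ), r ∉ I := by
  by_cases h : ∀ᶠ r in 𝓝[>] (0 : ℝ), r ∉ I
  · exact Or.inr h
  left
  have hf : ∃ᶠ r in 𝓝[>] (0 : ℝ), r ∈ I := h
  obtain ⟨r₀, hr₀, hr₀pos⟩ := (hf.and_eventually self_mem_nhdsWithin).exists
  filter_upwards [Ioo_mem_nhdsGT (show (0 : ℝ) < r₀ from hr₀pos)] with r hr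
  obtain ⟨r₁, hr₁, hr₁r⟩ := (hf.and_eventually (Ioo_mem_nhdsGT hr.1)).exists
  exact hI.out hr₁ hr₀ ⟨hr₁r.2.le, hr.2.le⟩

lemma eventually_mem_or_of_finite_union {s : Set ℝ} {F : Set (Set ℝ)} (hF : F.Finite)
    (hI : ∀ I ∈ F, I.OrdConnected) (hs : s = ⋃₀ F) :
    (∀ᶠ r in 𝓝[>] (0 : ℝ), r ∈ s) ∨ ∀ᶠ r in 𝓝[>] (0 : ℝ), r ∉ s := by
  by_cases! h : ∃ I ∈ F, ∀ᶠ r in 𝓝[>] (0 : ℝ), r ∈ I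
  · obtain ⟨I, hIF, h⟩ := h
    left
    filter_upwards [h] with r hr
    rw [hs]
    exact ⟨I, hIF, hr⟩
  · right
    have h1 : ∀ I ∈ F, ∀ᶠ r in 𝓝[>] (0 : ℝ), r ∉ I := fun I hIF =>
      (hI I hIF).eventually_mem_or.resolve_left (not_eventually.2 (h I hIF))
    filter_upwards [(hF.eventually_all).2 h1] with r hr
    rw [hs]
    rintro ⟨I, hIF, hrI⟩
    exact hr I hIF hrI

/-! ### Definable functions -/

section Definable

variable {L : FirstOrder.Language.{u, v}} [L.Structure ℝ] {α ι : Type*} {f f' : (α → ℝ) → ℝ}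

lemma definableFun_of_graph {op : ℝ → ℝ → ℝ}
    (hop : (univ : Set ℝ).Definable L {w : Fin 3 → ℝ | op (w 0) (w 1) = w 2})
    (hf : (univ : Set ℝ).DefinableFun L f) (hf' : (univ : Set ℝ).DefinableFun L f') :
    (univ : Set ℝ).DefinableFun L fun v => op (f v) (f' v) := by
  have h2 : (univ : Set ℝ).DefinableFun L fun v : Fin 2 → ℝ => op (v 0) (v 1) :=
    -- The index `none` stands for the value of the function, so the third graph coordinate is sent
    -- there.
    hop.preimage_comp (![some 0, some 1, none] : Fin 3 → Option (Fin 2))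
  have hm : (univ : Set ℝ).DefinableMap L fun v : α → ℝ => (![f v, f' v] : Fin 2 → ℝ) := by
    simp [DefinableMap, *]
  exact DefinableFun.comp hm h2

namespace IsOMinimalExpansionOfRealField

lemma add (hL : IsOMinimalExpansionOfRealField L) (hf : (univ : Set ℝ).DefinableFun L f)
    (hf' : (univ : Set ℝ).DefinableFun L f') :
    (univ : Set ℝ).DefinableFun L fun v => f v + f' v :=
  definableFun_of_graph hL.definable_add hf hf'

lemma mul (hL : IsOMinimalExpansionOfRealField L) (hf : (univ : Set ℝ).DefinableFun L f)
    (hf' : (univ : Set ℝ).DefinableFun L f') :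
    (univ : Set ℝ).DefinableFun L fun v => f v * f' v :=
  definableFun_of_graph hL.definable_mul hf hf'

lemma const (c : ℝ) : (univ : Set ℝ).DefinableFun L fun _ : α → ℝ => c :=
  L.definableFun_const α (mem_univ c)

lemma sum (hL : IsOMinimalExpansionOfRealField L) (t : Finset ι) {F : ι → (α → ℝ) → ℝ}
    (hF : ∀ i ∈ t, (univ : Set ℝ).DefinableFun L (F i)) :
    (univ : Set ℝ).DefinableFun L fun v => ∑ i ∈ t, F i v := by
  classical
  induction t using Finset.induction_on with
  | empty => simpa using const 0
  | insert a t ha ih =>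
    simp only [Finset.sum_insert ha]
    exact hL.add (hF a (Finset.mem_insert_self a t))
      (ih fun i hi => hF i (Finset.mem_insert_of_mem hi))

/-- A curve cut out of a definable set by spheres around `x` in an affine slice has a limiting
direction at `x`. -/
theorem exists_tendsto_slice (hL : IsOMinimalExpansionOfRealField L) {n k : ℕ}
    {Y : Set (RSpace n)} (hY : IsDefinableSet L Y) (P : RSpace n →L[ℝ] RSpace k) (x : RSpace n)
    (u : RSpace k) {s : ℝ → RSpace n} {δ : ℝ} (hδ : 0 < δ)
    (hs : ∀ r, 0 < r → r < δ → ∀ y, (y ∈ Y ∧ P y = u ∧ ‖y - x‖ = r) ↔ y = s r) :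
    ∃ θ, Tendsto (fun r => r⁻¹ • (s r - x)) (𝓝[>] 0) (𝓝 θ) := by
  have hIoo : ∀ᶠ r in 𝓝[>] (0 : ℝ), r ∈ Ioo 0 δ := Ioo_mem_nhdsGT hδ
  -- Coordinatewise, the quotient is bounded by 1 and, by o-minimality, eventually on one side of
  -- each constant c; such a function cannot oscillate.
  have key : ∀ i : Fin n, ∃ c, Tendsto (fun r => r⁻¹ * (s r i - x i)) (𝓝[>] 0) (𝓝 c) := by
    intro i
    have hev : ∀ c : ℝ, (∀ᶠ r in 𝓝[>] (0 : ℝ), r⁻¹ * (s r i - x i) ≤ c) ∨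
        ∀ᶠ r in 𝓝[>] (0 : ℝ), ¬ r⁻¹ * (s r i - x i) ≤ c := by
      intro c
      -- The inequality is written as an equation with a square slack `w none`, and without
      -- division, so that definability of addition and multiplication is enough. Only the part of
      -- `S` in (0, δ) matters.
      let S : Set ℝ := {r | ∃ w : Option (Fin n) → ℝ, WithLp.toLp 2 (fun j => w (some j)) ∈ Y ∧
        (∀ j, P (WithLp.toLp 2 fun j => w (some j)) j = u j) ∧
        ∑ j, (w (some j) - x j) * (w (some j) - x j) = r * r ∧
        w (some i) + w none * w none = x i + c * r}
      have hSdef : (univ : Set ℝ).Definable₁ L S := by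
        have hw : ∀ j, (univ : Set ℝ).DefinableFun L
            fun v : Fin 1 ⊕ Option (Fin n) → ℝ => v (Sum.inr j) := fun j => DefinableFun.proj L
        have hr : (univ : Set ℝ).DefinableFun L
            fun v : Fin 1 ⊕ Option (Fin n) → ℝ => v (Sum.inl 0) := DefinableFun.proj L
        have h1 : (univ : Set ℝ).Definable L {v : Fin 1 ⊕ Option (Fin n) → ℝ |
            WithLp.toLp 2 (fun j => v (Sum.inr (some j))) ∈ Y} :=
          hY.preimage_comp fun j => Sum.inr (some j)
        have h2 : (univ : Set ℝ).Definable L {v : Fin 1 ⊕ Option (Fin n) → ℝ |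
            ∀ j, P (WithLp.toLp 2 fun j => v (Sum.inr (some j))) j = u j} := by
          simp only [ofPred_forall]
          refine definable_iInter_of_finite fun j => ?_
          have hPj : ∀ v : Fin n → ℝ, P (WithLp.toLp 2 v) j =
              ∑ l, v l * P (EuclideanSpace.single l 1) j := by
            intro v
            have : (WithLp.toLp 2 v : RSpace n) = ∑ l, v l • EuclideanSpace.single l (1 : ℝ) := by
              ext m
              simp [Finset.sum_apply, Pi.single_apply]
            change ((EuclideanSpace.proj j : RSpace k →L[ℝ] ℝ) ∘L P) _ = _
            rw [this, map_sum]
            refine Finset.sum_congr rfl fun l _ => ?_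
            rw [map_smul]
            rfl
          have h2' : (univ : Set ℝ).DefinableFun L fun v : Fin 1 ⊕ Option (Fin n) → ℝ =>
              P (WithLp.toLp 2 fun j => v (Sum.inr (some j))) j := by
            refine (funext fun v : Fin 1 ⊕ Option (Fin n) → ℝ =>
              hPj fun j => v (Sum.inr (some j))) ▸ ?_
            exact hL.sum _ fun l _ => hL.mul (hw _) (const _)
          exact h2'.ofPred_eq (const _)
        have h3 : (univ : Set ℝ).Definable L {v : Fin 1 ⊕ Option (Fin n) → ℝ |
            ∑ j, (v (Sum.inr (some j)) - x j) * (v (Sum.inr (some j)) - x j) =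
              v (Sum.inl 0) * v (Sum.inl 0)} := by
          simp only [sub_eq_add_neg]
          exact (hL.sum _ fun l _ => hL.mul (hL.add (hw _) (const _))
            (hL.add (hw _) (const _))).ofPred_eq (hL.mul hr hr)
        have h4 : (univ : Set ℝ).Definable L {v : Fin 1 ⊕ Option (Fin n) → ℝ |
            v (Sum.inr (some i)) + v (Sum.inr none) * v (Sum.inr none) =
              x i + c * v (Sum.inl 0)} :=
          (hL.add (hw _) (hL.mul (hw _) (hw _))).ofPred_eq
            (hL.add (const _) (hL.mul (const _) hr))
        exact (h1.inter (h2.inter (h3.inter h4))).exists_of_finite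
      have hSmem : ∀ r ∈ Ioo 0 δ, r ∈ S ↔ r⁻¹ * (s r i - x i) ≤ c := by
        intro r hr
        have hle : r⁻¹ * (s r i - x i) ≤ c ↔ s r i - x i ≤ c * r := by
          rw [inv_mul_le_iff₀ hr.1, mul_comm]
        have hnorm : ∀ y : RSpace n, ‖y - x‖ = r ↔
            ∑ j, (y j - x j) * (y j - x j) = r * r := by
          intro y
          rw [← sq_eq_sq₀ (norm_nonneg _) hr.1.le, EuclideanSpace.norm_sq_eq]
          simp [sq]
        rw [hle]
        constructor
        · rintro ⟨w, h1, h2, h3, h4⟩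
          have h5 := (hs r hr.1 hr.2 _).1 ⟨h1, PiLp.ext h2, (hnorm _).2 h3⟩
          have h6 : s r i = w (some i) := by rw [← h5]
          rw [h6]
          nlinarith [mul_self_nonneg (w none)]
        · intro h
          obtain ⟨h1, h2, h3⟩ := (hs r hr.1 hr.2 (s r)).2 rfl
          refine ⟨fun o => o.elim (√(c * r - (s r i - x i))) fun j => s r j, h1,
            fun j => by rw [← h2]; rfl, (hnorm _).1 h3, ?_⟩
          simp only [Option.elim]
          rw [Real.mul_self_sqrt (by linarith)]
          ring
      obtain ⟨F, hF, hFI, hSF⟩ := hL.finite_union_intervals S hSdef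
      rcases eventually_mem_or_of_finite_union hF hFI hSF with h | h
      · left
        filter_upwards [h, hIoo] with r h1 h2 using (hSmem r h2).1 h1
      · right
        filter_upwards [h, hIoo] with r h1 h2 using fun h3 => h1 ((hSmem r h2).2 h3)
    have hbound : ∀ᶠ r in 𝓝[>] (0 : ℝ), |r⁻¹ * (s r i - x i)| ≤ 1 := by
      filter_upwards [hIoo] with r hr
      have h3 := ((hs r hr.1 hr.2 (s r)).2 rfl).2.2
      have h4 : |s r i - x i| ≤ ‖s r - x‖ := by
        simpa using PiLp.norm_apply_le (s r - x) i
      rw [abs_mul, abs_of_pos (inv_pos.2 hr.1), inv_mul_le_iff₀ hr.1]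
      linarith
    refine tendsto_of_no_upcrossings dense_univ (fun a _ b _ hab => ?_)
      ⟨1, ?_⟩ ⟨-1, ?_⟩
    · rintro ⟨h1, h2⟩
      rcases hev a with h | h
      · exact h2 (h.mono fun r hr => by linarith)
      · exact h1 (h.mono fun r hr => by linarith)
    · exact eventually_map.2 (hbound.mono fun r hr => (abs_le.1 hr).2)
    · exact eventually_map.2 (hbound.mono fun r hr => (abs_le.1 hr).1)
  choose c hc using key
  refine ⟨WithLp.toLp 2 c, ?_⟩
  have h1 : Tendsto (fun r i => r⁻¹ * (s r i - x i)) (𝓝[>] 0) (𝓝 c) := tendsto_pi_nhds.2 hc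
  have h2 := ((PiLp.continuous_toLp 2 fun _ : Fin n => ℝ).tendsto c).comp h1
  exact h2

end IsOMinimalExpansionOfRealField

end Definable

end


noncomputable section

open Metric (ball closedBall)

/-! ### Joint limits by the Baire category theorem -/

/-- If `h (u, ·)` has a limit at `0+` for every `u`, then `h` has a joint limit at some `(u, 0+)`. -/
lemma exists_tendsto_prod_of_tendsto {T Z : Type*} [TopologicalSpace T] [BaireSpace T] [Nonempty T]
    [MetricSpace Z] [CompleteSpace Z] {h : T × ℝ → Z} {δ : ℝ} (hδ : 0 < δ)
    (hc : ContinuousOn h (univ ×ˢ Ioo 0 δ))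
    (hlim : ∀ u, ∃ z, Tendsto (fun r => h (u, r)) (𝓝[>] 0) (𝓝 z)) :
    ∃ u z, Tendsto h (𝓝 u ×ˢ 𝓝[>] 0) (𝓝 z) := by
  have hcr : ∀ r ∈ Ioo 0 δ, Continuous fun u => h (u, r) := fun r hr =>
    continuousOn_univ.1 (hc.comp (by fun_prop) fun u _ => ⟨mem_univ u, hr⟩)
  let ρ : ℕ → ℝ := fun m => δ / (m + 1)
  have hρ : ∀ m, 0 < ρ m := fun m => by positivity
  have hρδ : ∀ m, ρ m ≤ δ := fun m => div_le_self hδ.le (by simp)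
  -- The points over which the oscillation in r on (0, ρ m) is at most ε/3. These sets are closed
  -- because h is continuous in u for fixed r, and they exhaust `T` because the limits exist.
  let A : ℝ → ℕ → Set T := fun ε m =>
    {u | ∀ r ∈ Ioo 0 (ρ m), ∀ t ∈ Ioo 0 (ρ m), dist (h (u, r)) (h (u, t)) ≤ ε / 3}
  have hAc : ∀ ε m, IsClosed (A ε m) := by
    intro ε m
    simp only [A, ofPred_forall]
    refine isClosed_iInter fun r => isClosed_iInter fun hr => isClosed_iInter fun t =>
      isClosed_iInter fun ht => ?_
    exact isClosed_le ((hcr r ⟨hr.1, hr.2.trans_le (hρδ m)⟩).dist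
      (hcr t ⟨ht.1, ht.2.trans_le (hρδ m)⟩)) continuous_const
  have hAu : ∀ ε, 0 < ε → ⋃ m, A ε m = univ := by
    intro ε hε
    refine eq_univ_of_forall fun u => ?_
    obtain ⟨z, hz⟩ := hlim u
    obtain ⟨a, ha, hz'⟩ := (nhdsGT_basis (0 : ℝ)).mem_iff.1
      (hz (Metric.ball_mem_nhds z (show 0 < ε / 6 by positivity)))
    obtain ⟨m, hm⟩ := exists_nat_gt (δ / a)
    have hma : ρ m ≤ a := by
      rw [div_lt_iff₀ ha] at hm
      rw [div_le_iff₀ (by positivity)]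
      nlinarith
    refine mem_iUnion.2 ⟨m, fun r hr t ht => ?_⟩
    have h1 : dist (h (u, r)) z < ε / 6 := hz' ⟨hr.1, hr.2.trans_le hma⟩
    have h2 : dist (h (u, t)) z < ε / 6 := hz' ⟨ht.1, ht.2.trans_le hma⟩
    linarith [dist_triangle_right (h (u, r)) (h (u, t)) z]
  -- A generic point lies, for every j, in the interior of some member of the exhaustion for ε =
  -- 1/(j + 1): there the oscillation bound is uniform in nearby u.
  have hdense : Dense (⋂ j : ℕ, ⋃ m, interior (A (1 / (j + 1)) m)) :=
    dense_iInter_of_isOpen_nat (fun j => isOpen_iUnion fun m => isOpen_interior)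
      fun j => dense_iUnion_interior_of_closed (fun m => hAc _ m) (hAu _ (by positivity))
  obtain ⟨u, hu⟩ := hdense.nonempty
  have hcauchy : Cauchy (map h (𝓝 u ×ˢ 𝓝[>] 0)) := by
    refine Metric.cauchy_iff.2 ⟨inferInstance, fun ε hε => ?_⟩
    obtain ⟨j, hj⟩ := exists_nat_one_div_lt hε
    obtain ⟨m, hm⟩ := mem_iUnion.1 (mem_iInter.1 hu j)
    set ε' : ℝ := 1 / (j + 1) with hε'
    have hε'pos : 0 < ε' := by positivity
    have hr₀ : ρ m / 2 ∈ Ioo 0 (ρ m) := ⟨by have := hρ m; positivity, by linarith [hρ m]⟩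
    have hcont : ∀ᶠ a in 𝓝 u, dist (h (a, ρ m / 2)) (h (u, ρ m / 2)) < ε' / 6 :=
      Metric.continuousAt_iff'.1
        (hcr _ ⟨hr₀.1, hr₀.2.trans_le (hρδ m)⟩).continuousAt _ (by positivity)
    obtain ⟨W, hW, hWs⟩ : ∃ W ∈ 𝓝 u, ∀ a ∈ W, a ∈ A ε' m ∧
        dist (h (a, ρ m / 2)) (h (u, ρ m / 2)) < ε' / 6 :=
      ⟨_, inter_mem (mem_interior_iff_mem_nhds.1 hm) hcont, fun a ha => ha⟩
    refine ⟨h '' (W ×ˢ Ioo 0 (ρ m)), image_mem_map (prod_mem_prod hW (Ioo_mem_nhdsGT (hρ m))), ?_⟩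
    rintro _ ⟨⟨a, r⟩, ⟨ha, hr⟩, rfl⟩ _ ⟨⟨b, t⟩, ⟨hb, ht⟩, rfl⟩
    have h1 := (hWs a ha).1 r hr _ hr₀
    have h2 := (hWs b hb).1 _ hr₀ t ht
    have h3 := (hWs a ha).2
    have h4 := (hWs b hb).2
    -- Compare both values at the common height ρ m / 2: two oscillations of ε'/3 and two variations
    -- in u of ε'/6 add up to ε'.
    have h5 := dist_triangle4 (h (a, r)) (h (a, ρ m / 2)) (h (b, ρ m / 2)) (h (b, t))
    have h6 := dist_triangle_right (h (a, ρ m / 2)) (h (b, ρ m / 2)) (h (u, ρ m / 2))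
    linarith
  obtain ⟨z, hz⟩ := CompleteSpace.complete hcauchy
  exact ⟨u, z, hz⟩

variable {n k : ℕ} {X Y : Set (RSpace n)} {P : RSpace n →L[ℝ] RSpace k}
  {g : RSpace k → RSpace n} {δ : ℝ}

namespace IsTube

lemma tendsto_collarMap (h : IsTube X P g δ) (hXY : Disjoint X Y) {u : RSpace k}
    (hu : u ∈ ball (0 : RSpace k) δ) :
    Tendsto (collarMap P g) (𝓝[Y] (g u)) (𝓝 u ×ˢ 𝓝[>] 0) := by
  refine ((h.tendsto_proj hu).mono_left nhdsWithin_le_nhds).prodMk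
    (tendsto_nhdsWithin_iff.2 ⟨?_, ?_⟩)
  · have h1 : ContinuousAt (fun y => ‖y - g (P y)‖) (g u) :=
      (h.contDiffAt_sub (h.section_mem_tubeSet hu)).continuousAt.norm
    have h2 := h1.tendsto
    simp only [h.proj u hu, sub_self, norm_zero] at h2
    exact h2.mono_left nhdsWithin_le_nhds
  · filter_upwards [self_mem_nhdsWithin, nhdsWithin_le_nhds (h.tubeSet_mem_nhds hu)] with y hy hyt
    exact norm_pos_iff.2 (h.sub_ne_zero hyt fun hyX => hXY.le_bot ⟨hyX, hy⟩)

/-- The direction from `X` to `Y` converges at a dense set of points of `X`. -/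
lemma exists_tendsto_collarDir (h : IsTube X P g δ) (hXY : Disjoint X Y)
    {s : RSpace k × ℝ → RSpace n} (hs : ContinuousOn s (collarBase k δ))
    (hsY : ∀ y ∈ Y, y ∈ tubeSet P g δ → s (collarMap P g y) = y)
    (hlim : ∀ u ∈ ball (0 : RSpace k) δ,
      ∃ θ, Tendsto (fun r => r⁻¹ • (s (u, r) - g u)) (𝓝[>] 0) (𝓝 θ))
    {O : Set (RSpace k)} (hO : IsOpen O) (hOδ : O ⊆ ball 0 δ) (hne : O.Nonempty) :
    ∃ u ∈ O, ∃ θ, Tendsto (collarDir P g) (𝓝[Y] (g u)) (𝓝 θ) := by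
  -- The open set `O` is itself a Baire space; since it is arbitrary, the good points are dense.
  have := hO.baireSpace
  have := hne.to_subtype
  let H : ↥O × ℝ → RSpace n := fun b => b.2⁻¹ • (s (b.1, b.2) - g b.1)
  have hH : ContinuousOn H (univ ×ˢ Ioo 0 δ) := by
    have h1 : ContinuousOn (fun b : ↥O × ℝ => b.2⁻¹) (univ ×ˢ Ioo 0 δ) :=
      continuous_snd.continuousOn.inv₀ fun b hb => hb.2.1.ne'
    have h2 : ContinuousOn (fun b : ↥O × ℝ => s (b.1, b.2)) (univ ×ˢ Ioo 0 δ) :=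
      hs.comp (by fun_prop) fun b hb => ⟨hOδ b.1.2, hb.2⟩
    have h3 : ContinuousOn (fun b : ↥O × ℝ => g b.1) (univ ×ˢ Ioo 0 δ) :=
      h.smooth.continuousOn.comp (by fun_prop) fun b _ => hOδ b.1.2
    exact h1.smul (h2.sub h3)
  obtain ⟨u, θ, hθ⟩ := exists_tendsto_prod_of_tendsto h.pos hH fun u => hlim u (hOδ u.2)
  refine ⟨u, u.2, θ, ?_⟩
  have h1 := h.tendsto_collarMap hXY (hOδ u.2)
  have h2 : Tendsto (fun b : RSpace k × ℝ => b.2⁻¹ • (s (b.1, b.2) - g b.1))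
      (𝓝 (u : RSpace k) ×ˢ 𝓝[>] 0) (𝓝 θ) := by
    rw [← hO.isOpenEmbedding_subtypeVal.map_nhds_eq u, ← map_id (f := 𝓝[>] (0 : ℝ)),
      prod_map_map_eq, tendsto_map'_iff]
    exact hθ
  refine (h2.comp h1).congr' ?_
  filter_upwards [self_mem_nhdsWithin, nhdsWithin_le_nhds (h.tubeSet_mem_nhds (hOδ u.2))]
    with y hy hyt
  have h3 : s ((collarMap P g y).1, (collarMap P g y).2) = y := hsY y hy hyt
  rw [Function.comp_apply, h3]
  rfl

lemma collarDir_limit (h : IsTube X P g δ) (hXY : Disjoint X Y) {u : RSpace k}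
    (hu : u ∈ ball (0 : RSpace k) δ) {l : Filter (RSpace n)} [l.NeBot] (hl : l ≤ 𝓝[Y] (g u))
    {θ : RSpace n} (hθ : Tendsto (collarDir P g) l (𝓝 θ)) : P θ = 0 ∧ ‖θ‖ = 1 := by
  have h1 : ∀ᶠ y in l, y ∈ tubeSet P g δ ∧ y ∉ X := by
    filter_upwards [hl self_mem_nhdsWithin, (hl.trans nhdsWithin_le_nhds) (h.tubeSet_mem_nhds hu)]
      with y hy hyt using ⟨hyt, fun hyX => hXY.le_bot ⟨hyX, hy⟩⟩
  constructor
  · refine tendsto_nhds_unique ((P.continuous.tendsto θ).comp hθ) (tendsto_const_nhds.congr' ?_)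
    filter_upwards [h1] with y hy using (h.proj_collarDir hy.1).symm
  · refine tendsto_nhds_unique hθ.norm (tendsto_const_nhds.congr' ?_)
    filter_upwards [h1] with y hy using (norm_unitVector (h.sub_ne_zero hy.1 hy.2)).symm

lemma tendsto_direction_of_collarDir (h : IsTube X P g δ) (hXY : Disjoint X Y) {u : RSpace k}
    (hu : u ∈ ball (0 : RSpace k) δ) {l : Filter (RSpace n)} [l.NeBot] (hl : l ≤ 𝓝[Y] (g u))
    {θ : RSpace n} (hθ : Tendsto (collarDir P g) l (𝓝 θ)) :
    Tendsto (fun y => unitVector (nearestPoint X y - y)) l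
      (𝓝 (-unitVector (normalProj g u θ))) := by
  obtain ⟨h1, h2⟩ := h.collarDir_limit hXY hu hl hθ
  refine h.tendsto_nearestPoint_direction hu (hl.trans nhdsWithin_le_nhds) ?_ (fun h0 => ?_) hθ
  · filter_upwards [hl self_mem_nhdsWithin, (hl.trans nhdsWithin_le_nhds) (h.tubeSet_mem_nhds hu)]
      with y hy hyt using h.sub_ne_zero hyt fun hyX => hXY.le_bot ⟨hyX, hy⟩
  · simp [h.eq_zero_of_normalProj hu h1 h0] at h2

/-- Normal pseudo-flatness propagates convergence of the direction from a dense set of points. -/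
theorem tendsto_collarDir_of_normallyPseudoFlat (h : IsTube X P g δ) (hXY : Disjoint X Y)
    (hcl : X ⊆ closure Y) (hnpf : NormallyPseudoFlat X (Y ∪ X))
    (hd : ∀ O : Set (RSpace k), IsOpen O → O ⊆ ball 0 δ → O.Nonempty →
      ∃ u ∈ O, ∃ θ, Tendsto (collarDir P g) (𝓝[Y] (g u)) (𝓝 θ))
    {u : RSpace k} (hu : u ∈ ball (0 : RSpace k) δ) :
    ∃ θ, Tendsto (collarDir P g) (𝓝[Y] (g u)) (𝓝 θ) := by
  have hS : (Y ∪ X) \ X = Y := by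
    rw [union_sdiff_right]; exact hXY.symm.sdiff_eq_left
  have hnb : ∀ u ∈ ball (0 : RSpace k) δ, (𝓝[Y] (g u)).NeBot := fun u hu =>
    mem_closure_iff_nhdsWithin_neBot.1 (hcl (h.section_mem hu))
  -- Each cluster value of the direction, realized along an ultrafilter, yields a point of the
  -- normal cone over `g u`.
  have hcone : ∀ θ, MapClusterPt θ (𝓝[Y] (g u)) (collarDir P g) →
      P θ = 0 ∧ ‖θ‖ = 1 ∧ (g u, -unitVector (normalProj g u θ)) ∈ normalCone X (Y ∪ X) := by
    intro θ hθ
    obtain ⟨l, hl, hlθ⟩ := mapClusterPt_iff_ultrafilter.1 hθ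
    obtain ⟨h1, h2⟩ := h.collarDir_limit hXY hu hl hlθ
    refine ⟨h1, h2, mem_normalCone_of_tendsto (h.section_mem hu) (l := l) (by rwa [hS]) ?_⟩
    exact h.tendsto_direction_of_collarDir hXY hu hl hlθ
  have hcpt : IsCompact (closedBall (0 : RSpace n) 1) := isCompact_closedBall _ _
  have hball : closedBall (0 : RSpace n) 1 ∈ map (collarDir P g) (𝓝[Y] (g u)) :=
    mem_map.2 (univ_mem' fun y => mem_closedBall_zero_iff.2 (norm_collarDir_le y))
  have := hnb u hu
  obtain ⟨θ₀, -, hθ₀⟩ := hcpt.exists_clusterPt (f := map (collarDir P g) (𝓝[Y] (g u)))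
    (le_principal_iff.2 hball)
  refine ⟨θ₀, hcpt.le_nhds_of_unique_clusterPt hball fun θ _ hθ => ?_⟩
  by_contra hne
  obtain ⟨a1, a2, a3⟩ := hcone θ hθ
  obtain ⟨b1, b2, b3⟩ := hcone θ₀ hθ₀
  have hq : -unitVector (normalProj g u θ) ≠ -unitVector (normalProj g u θ₀) := fun he =>
    hne (h.unitVector_normalProj_injective hu a1 b1 a2 b2 (neg_injective he))
  obtain ⟨N, N₀, hN, hN₀, hqN, hqN₀, hNN⟩ := t2_separation hq
  -- Openness of the projection: if the fibre of the cone over `g u` meets `N`, so do all nearby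
  -- fibres.
  have hopen : ∀ N : Set (RSpace n), IsOpen N → ∀ q, q ∈ N → (g u, q) ∈ normalCone X (Y ∪ X) →
      ∀ᶠ u' in 𝓝 u, ∃ q' ∈ N, (g u', q') ∈ normalCone X (Y ∪ X) := by
    intro N hN q hqN hq
    have h1 := hnpf {q : normalCone X (Y ∪ X) | (q : RSpace n × RSpace n).2 ∈ N}
      (hN.preimage (continuous_snd.comp continuous_subtype_val))
    obtain ⟨W, hW, hWe⟩ := isOpen_induced_iff.1 h1
    have huW : g u ∈ W := by
      have : (⟨g u, h.section_mem hu⟩ : X) ∈ Subtype.val ⁻¹' W := by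
        rw [hWe]; exact ⟨⟨(g u, q), hq⟩, hqN, rfl⟩
      exact this
    have hgc : ContinuousAt g u := (h.contDiffAt hu).continuousAt
    filter_upwards [hgc (hW.mem_nhds huW), Metric.isOpen_ball.mem_nhds hu] with u' hu' hu'δ
    have h2 : (⟨g u', h.section_mem hu'δ⟩ : X) ∈ Subtype.val ⁻¹' W := hu'
    rw [hWe] at h2
    obtain ⟨⟨⟨x, q'⟩, hq'⟩, hq'N, he⟩ := h2
    have he' : x = g u' := congrArg Subtype.val he
    subst he'
    exact ⟨q', hq'N, hq'⟩
  obtain ⟨O, hOs, hO, huO⟩ := eventually_nhds_iff.1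
    (((hopen N hN _ hqN a3).and (hopen N₀ hN₀ _ hqN₀ b3)).and (Metric.isOpen_ball.mem_nhds hu))
  -- At a nearby good point the fibre is a single point, yet it must meet the disjoint sets `N` and
  -- `N₀`.
  obtain ⟨u', hu'O, θ', hθ'⟩ := hd O hO (fun x hx => (hOs x hx).2) ⟨u, huO⟩
  obtain ⟨⟨⟨q, hqN', hq'⟩, ⟨q₀, hq₀N, hq₀⟩⟩, hu'⟩ := hOs u' hu'O
  have := hnb u' hu'
  have ht := h.tendsto_direction_of_collarDir hXY hu' le_rfl hθ'
  rw [← hS] at ht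
  have e1 := eq_of_mem_normalCone hq' ht
  have e2 := eq_of_mem_normalCone hq₀ ht
  rw [e1] at hqN'
  rw [e2] at hq₀N
  exact hNN.le_bot ⟨hqN', hq₀N⟩

end IsTube

end


noncomputable section

open Metric (ball closedBall)
open Asymptotics

/-! ### Odd extension across the boundary -/

section OddExtension

lemma exists_of_eventually_prod_nhdsGT {G : Type*} [NormedAddCommGroup G] {u : G} {p : G × ℝ → Prop}
    (hp : ∀ᶠ b in 𝓝 u ×ˢ 𝓝[>] (0 : ℝ), p b) :
    ∃ W ∈ 𝓝 u, ∃ ρ > 0, ∀ a ∈ W, ∀ r, 0 < r → r < ρ → p (a, r) := by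
  obtain ⟨W, hW, R, hR, hWR⟩ := mem_prod_iff.1 hp
  obtain ⟨ρ, hρ, hρR⟩ := (nhdsGT_basis (0 : ℝ)).mem_iff.1 hR
  exact ⟨W, hW, ρ, hρ, fun a ha r hr hrρ => hWR ⟨ha, hρR ⟨hr, hrρ⟩⟩⟩

lemma eventually_abs_snd_lt {G : Type*} [NormedAddCommGroup G] {u : G} {W : Set G} (hW : W ∈ 𝓝 u) {ρ : ℝ} (hρ : 0 < ρ) :
    ∀ᶠ b in 𝓝 (u, (0 : ℝ)), b.1 ∈ W ∧ |b.2| < ρ := by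
  refine ((continuous_fst.tendsto (u, (0 : ℝ))).eventually hW).and ?_
  have := ((continuous_abs.comp continuous_snd).tendsto (u, (0 : ℝ)))
  simp only [Function.comp_apply, abs_zero] at this
  exact this.eventually (gt_mem_nhds hρ)

variable {G E : Type*} [NormedAddCommGroup G] [NormedSpace ℝ G] [NormedAddCommGroup E]
  [NormedSpace ℝ E]

/-- The reflection in the last coordinate. -/
def flipLast (G : Type*) [NormedAddCommGroup G] [NormedSpace ℝ G] : G × ℝ →L[ℝ] G × ℝ :=
  (ContinuousLinearMap.id ℝ G).prodMap (-ContinuousLinearMap.id ℝ ℝ)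

@[simp] lemma flipLast_apply (b : G × ℝ) : flipLast G b = (b.1, -b.2) := rfl

/-- The odd extension in the last coordinate. -/
def oddExtension (κ : G × ℝ → E) (b : G × ℝ) : E :=
  if 0 < b.2 then κ b else if b.2 < 0 then -κ (flipLast G b) else 0

/-- The derivative of the odd extension. -/
def oddExtensionDeriv (κ : G × ℝ → E) (κ' : G → (G × ℝ →L[ℝ] E)) (b : G × ℝ) : G × ℝ →L[ℝ] E :=
  if 0 < b.2 then fderiv ℝ κ b else
    if b.2 < 0 then -(fderiv ℝ κ (flipLast G b)).comp (flipLast G) else κ' b.1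

/-- The linear map `(v, t) ↦ t θ`. -/
def lastMap (G : Type*) [NormedAddCommGroup G] [NormedSpace ℝ G] (θ : E) : G × ℝ →L[ℝ] E :=
  (ContinuousLinearMap.toSpanSingleton ℝ θ).comp (ContinuousLinearMap.snd ℝ G ℝ)

@[simp] lemma lastMap_apply (θ : E) (b : G × ℝ) : lastMap G θ b = b.2 • θ := rfl

variable {κ : G × ℝ → E} {θ : G → E} {δ : ℝ}

lemma norm_comp_flipLast_le (A : G × ℝ →L[ℝ] E) : ‖A.comp (flipLast G)‖ ≤ ‖A‖ := by
  refine ContinuousLinearMap.opNorm_le_bound _ (norm_nonneg _) fun z => ?_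
  refine (A.le_opNorm _).trans_eq ?_
  simp [Prod.norm_def]

/-- The joint limit makes κ(a, r) - rθ small relative to r, uniformly for a near u. Since rθ is odd
in r, the estimate carries over to the reflected side. -/
lemma hasFDerivAt_oddExtension_zero {u : G}
    (h1 : Tendsto (fun b : G × ℝ => b.2⁻¹ • κ b) (𝓝 u ×ˢ 𝓝[>] 0) (𝓝 (θ u))) :
    HasFDerivAt (oddExtension κ) (lastMap G (θ u)) (u, 0) := by
  rw [hasFDerivAt_iff_isLittleO, isLittleO_iff]
  intro ε hε
  obtain ⟨W, hW, ρ, hρ, hWρ⟩ :=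
    exists_of_eventually_prod_nhdsGT (h1.eventually (Metric.ball_mem_nhds _ hε))
  have key : ∀ a ∈ W, ∀ r, 0 < r → r < ρ → ‖κ (a, r) - r • θ u‖ ≤ ε * r := by
    intro a ha r hr hrρ
    have h2 : ‖r⁻¹ • κ (a, r) - θ u‖ < ε := by
      have := hWρ a ha r hr hrρ
      rwa [dist_eq_norm] at this
    have h3 : κ (a, r) - r • θ u = r • (r⁻¹ • κ (a, r) - θ u) := by
      rw [smul_sub, smul_smul, mul_inv_cancel₀ hr.ne', one_smul]
    rw [h3, norm_smul, Real.norm_of_nonneg hr.le, mul_comm]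
    gcongr
  filter_upwards [eventually_abs_snd_lt hW hρ] with b ⟨hbW, hbρ⟩
  have h4 : ε * |b.2| ≤ ε * ‖b - (u, 0)‖ := by
    gcongr
    have := norm_snd_le (b - (u, 0))
    simpa using this
  refine le_trans ?_ h4
  have h5 : oddExtension κ (u, 0) = 0 := by simp [oddExtension]
  rw [h5, sub_zero, lastMap_apply]
  simp only [Prod.snd_sub, sub_zero]
  rcases lt_trichotomy b.2 0 with hb | hb | hb
  · have h6 : oddExtension κ b = -κ (b.1, -b.2) := by simp [oddExtension, hb, hb.le]
    have h7 := key b.1 hbW (-b.2) (by linarith) (by rwa [← abs_of_neg hb])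
    rw [h6, abs_of_neg hb, ← norm_neg]
    have h8 : -(-κ (b.1, -b.2) - b.2 • θ u) = κ (b.1, -b.2) - -b.2 • θ u := by
      rw [neg_smul]; abel
    rwa [h8]
  · simp [oddExtension, hb]
  · have h6 : oddExtension κ b = κ (b.1, b.2) := by simp [oddExtension, hb]
    rw [h6, abs_of_pos hb]
    exact key b.1 hbW b.2 hb (by rwa [← abs_of_pos hb])

lemma hasFDerivAt_oddExtension (hκ : ContDiffOn ℝ 1 κ (ball 0 δ ×ˢ Ioo 0 δ))
    (h1 : ∀ u ∈ ball (0 : G) δ,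
      Tendsto (fun b : G × ℝ => b.2⁻¹ • κ b) (𝓝 u ×ˢ 𝓝[>] 0) (𝓝 (θ u)))
    {b : G × ℝ} (hb : b ∈ ball (0 : G) δ ×ˢ Ioo (-δ) δ) :
    HasFDerivAt (oddExtension κ) (oddExtensionDeriv κ (fun u => lastMap G (θ u)) b) b := by
  have hop : IsOpen (ball (0 : G) δ ×ˢ Ioo (0 : ℝ) δ) := Metric.isOpen_ball.prod isOpen_Ioo
  have hd : ∀ b ∈ ball (0 : G) δ ×ˢ Ioo (0 : ℝ) δ, HasFDerivAt κ (fderiv ℝ κ b) b := fun b hb =>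
    ((hκ.contDiffAt (hop.mem_nhds hb)).differentiableAt one_ne_zero).hasFDerivAt
  rcases lt_trichotomy b.2 0 with hb2 | hb2 | hb2
  · have h2 : flipLast G b ∈ ball (0 : G) δ ×ˢ Ioo (0 : ℝ) δ :=
      ⟨hb.1, by simpa using hb2, by have := hb.2.1; simp; linarith⟩
    have h3 := ((hd _ h2).comp b (flipLast G).hasFDerivAt).neg
    have h4 : oddExtensionDeriv κ (fun u => lastMap G (θ u)) b =
        -(fderiv ℝ κ (flipLast G b)).comp (flipLast G) := by
      simp only [oddExtensionDeriv, not_lt.2 hb2.le, hb2, if_true, if_false]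
    rw [h4]
    refine h3.congr_of_eventuallyEq ?_
    filter_upwards [continuous_snd.continuousAt.eventually (gt_mem_nhds hb2)] with c hc
    simp only [oddExtension, not_lt.2 (le_of_lt hc), hc, if_true, if_false]
    rfl
  · have h4 : b = (b.1, 0) := Prod.ext rfl hb2
    rw [h4]
    have h5 : oddExtensionDeriv κ (fun u => lastMap G (θ u)) (b.1, 0) = lastMap G (θ b.1) := by
      simp [oddExtensionDeriv]
    rw [h5]
    exact hasFDerivAt_oddExtension_zero (h1 b.1 hb.1)
  · have h2 : b ∈ ball (0 : G) δ ×ˢ Ioo (0 : ℝ) δ := ⟨hb.1, hb2, hb.2.2⟩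
    have h4 : oddExtensionDeriv κ (fun u => lastMap G (θ u)) b = fderiv ℝ κ b := by
      simp only [oddExtensionDeriv, hb2, if_true]
    rw [h4]
    refine (hd b h2).congr_of_eventuallyEq ?_
    filter_upwards [continuous_snd.continuousAt.eventually (lt_mem_nhds hb2)] with c hc
    simp only [oddExtension, hc, if_true]

/-- The limiting derivative (v, t) ↦ tθ is unchanged by composing with the reflection and negating,
so the derivatives from the two sides match at the hyperplane. -/
lemma continuousAt_oddExtensionDeriv (hκ : ContDiffOn ℝ 1 κ (ball 0 δ ×ˢ Ioo 0 δ))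
    (h2 : ∀ u ∈ ball (0 : G) δ,
      Tendsto (fderiv ℝ κ) (𝓝 u ×ˢ 𝓝[>] 0) (𝓝 (lastMap G (θ u))))
    {b : G × ℝ} (hb : b ∈ ball (0 : G) δ ×ˢ Ioo (-δ) δ) :
    ContinuousAt (oddExtensionDeriv κ fun u => lastMap G (θ u)) b := by
  have hop : IsOpen (ball (0 : G) δ ×ˢ Ioo (0 : ℝ) δ) := Metric.isOpen_ball.prod isOpen_Ioo
  have hd : ∀ b ∈ ball (0 : G) δ ×ˢ Ioo (0 : ℝ) δ, ContinuousAt (fderiv ℝ κ) b := fun b hb =>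
    (hκ.contDiffAt (hop.mem_nhds hb)).continuousAt_fderiv one_ne_zero
  rcases lt_trichotomy b.2 0 with hb2 | hb2 | hb2
  · have h3 : flipLast G b ∈ ball (0 : G) δ ×ˢ Ioo (0 : ℝ) δ :=
      ⟨hb.1, by simpa using hb2, by have := hb.2.1; simp; linarith⟩
    have h4 : ContinuousAt (fun c => -(fderiv ℝ κ (flipLast G c)).comp (flipLast G)) b :=
      ((ContinuousAt.comp (f := flipLast G) (hd _ h3)
        (flipLast G).continuous.continuousAt).clm_comp continuousAt_const).neg
    refine h4.congr ?_
    filter_upwards [continuous_snd.continuousAt.eventually (gt_mem_nhds hb2)] with c hc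
    simp only [oddExtensionDeriv, not_lt.2 (le_of_lt hc), hc, if_true, if_false]
  · have h4 : b = (b.1, 0) := Prod.ext rfl hb2
    rw [h4, Metric.continuousAt_iff']
    intro ε hε
    have hε2 : 0 < ε / 2 := by positivity
    obtain ⟨W, hW, ρ, hρ, hWρ⟩ := exists_of_eventually_prod_nhdsGT
      ((h2 b.1 hb.1).eventually (Metric.ball_mem_nhds _ hε2))
    have h5 : oddExtensionDeriv κ (fun u => lastMap G (θ u)) (b.1, 0) = lastMap G (θ b.1) := by
      simp [oddExtensionDeriv]
    filter_upwards [eventually_abs_snd_lt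
      (inter_mem hW (Metric.isOpen_ball.mem_nhds hb.1)) hρ] with c ⟨⟨hcW, hcδ⟩, hcρ⟩
    rw [h5]
    refine lt_of_le_of_lt ?_ (half_lt_self hε)
    rcases lt_trichotomy c.2 0 with hc | hc | hc
    · have h6 := hWρ c.1 hcW (-c.2) (by linarith) (by rwa [← abs_of_neg hc])
      rw [dist_eq_norm] at h6
      have h7 : oddExtensionDeriv κ (fun u => lastMap G (θ u)) c =
          -(fderiv ℝ κ (c.1, -c.2)).comp (flipLast G) := by
        simp only [oddExtensionDeriv, not_lt.2 hc.le, hc, if_true, if_false]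
        rfl
      have h8 : -(fderiv ℝ κ (c.1, -c.2)).comp (flipLast G) - lastMap G (θ b.1) =
          -(fderiv ℝ κ (c.1, -c.2) - lastMap G (θ b.1)).comp (flipLast G) := by
        refine ContinuousLinearMap.ext fun z => ?_
        simp
        abel
      rw [h7, dist_eq_norm, h8, norm_neg]
      exact (norm_comp_flipLast_le _).trans h6.le
    · have h7 : oddExtensionDeriv κ (fun u => lastMap G (θ u)) c = lastMap G (θ c.1) := by
        simp [oddExtensionDeriv, hc]
      rw [h7]
      -- Continuity of θ is not assumed: on the hyperplane the derivative is itself a limit of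
      -- nearby derivatives from above, so it inherits their bound.
      have h8 : Tendsto (fun r : ℝ => fderiv ℝ κ (c.1, r)) (𝓝[>] 0) (𝓝 (lastMap G (θ c.1))) :=
        (h2 c.1 hcδ).comp (tendsto_const_nhds.prodMk tendsto_id)
      refine le_of_tendsto (h8.dist tendsto_const_nhds) ?_
      filter_upwards [Ioo_mem_nhdsGT hρ] with r hr
      exact le_of_lt (hWρ c.1 hcW r hr.1 hr.2)
    · have h6 := hWρ c.1 hcW c.2 hc (by rwa [← abs_of_pos hc])
      have h7 : oddExtensionDeriv κ (fun u => lastMap G (θ u)) c = fderiv ℝ κ c := by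
        simp only [oddExtensionDeriv, hc, if_true]
      rw [h7]
      exact le_of_lt h6
  · have h3 : b ∈ ball (0 : G) δ ×ˢ Ioo (0 : ℝ) δ := ⟨hb.1, hb2, hb.2.2⟩
    refine (hd b h3).congr ?_
    filter_upwards [continuous_snd.continuousAt.eventually (lt_mem_nhds hb2)] with c hc
    simp only [oddExtensionDeriv, hc, if_true]

lemma contDiffAt_oddExtension (hδ : 0 < δ) (hκ : ContDiffOn ℝ 1 κ (ball 0 δ ×ˢ Ioo 0 δ))
    (h1 : ∀ u ∈ ball (0 : G) δ,
      Tendsto (fun b : G × ℝ => b.2⁻¹ • κ b) (𝓝 u ×ˢ 𝓝[>] 0) (𝓝 (θ u)))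
    (h2 : ∀ u ∈ ball (0 : G) δ,
      Tendsto (fderiv ℝ κ) (𝓝 u ×ˢ 𝓝[>] 0) (𝓝 (lastMap G (θ u)))) :
    ContDiffAt ℝ 1 (oddExtension κ) (0, 0) := by
  rw [contDiffAt_one_iff]
  refine ⟨_, ball (0 : G) δ ×ˢ Ioo (-δ) δ, ?_,
    fun b hb => (continuousAt_oddExtensionDeriv hκ h2 hb).continuousWithinAt,
    fun b hb => hasFDerivAt_oddExtension hκ h1 hb⟩
  exact (Metric.isOpen_ball.prod isOpen_Ioo).mem_nhds ⟨by simpa, by simpa, hδ⟩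

end OddExtension

/-! ### Straightening a graph with boundary -/

/-- Let `C` project to the kernel of `q` along the image of `j` and then map this kernel
isomorphically onto a complement of the image of Λ. This completes an immersion with derivative Λ to
a local diffeomorphism without changing it on the image of `j`. -/
lemma exists_complement_map {E H : Type*} [NormedAddCommGroup E] [NormedSpace ℝ E]
    [FiniteDimensional ℝ E] [NormedAddCommGroup H] [NormedSpace ℝ H] [FiniteDimensional ℝ H]
    {Λ j : H →L[ℝ] E} {q : E →L[ℝ] H} (hΛ : ∀ z, Λ z = 0 → z = 0) (hqj : ∀ z, q (j z) = z) :
    ∃ C : E →L[ℝ] E, (∀ z, C (j z) = 0) ∧ ∀ w, Λ (q w) + C w = 0 → w = 0 := by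
  obtain ⟨R', hR'⟩ := Submodule.exists_isCompl (LinearMap.range (Λ : H →ₗ[ℝ] E))
  have hq : Function.Surjective (q : E →ₗ[ℝ] H) := fun z => ⟨j z, hqj z⟩
  have hinj : Function.Injective (Λ : H →ₗ[ℝ] E) :=
    (injective_iff_map_eq_zero (Λ : H →ₗ[ℝ] E)).2 hΛ
  have hdim : Module.finrank ℝ (LinearMap.ker (q : E →ₗ[ℝ] H)) = Module.finrank ℝ R' := by
    have h1 := Submodule.finrank_add_eq_of_isCompl hR'
    have h2 := LinearMap.finrank_range_add_finrank_ker (q : E →ₗ[ℝ] H)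
    rw [LinearMap.range_eq_top.2 hq, finrank_top] at h2
    rw [LinearMap.finrank_range_of_inj hinj] at h1
    omega
  let e := LinearEquiv.ofFinrankEq _ _ hdim
  let pr : E →ₗ[ℝ] LinearMap.ker (q : E →ₗ[ℝ] H) :=
    LinearMap.codRestrict _ (LinearMap.id - (j : H →ₗ[ℝ] E) ∘ₗ (q : E →ₗ[ℝ] H)) fun w => by
      simp [hqj]
  have hpr : ∀ w, (pr w : E) = w - j (q w) := fun w => rfl
  let C : E →ₗ[ℝ] E := R'.subtype ∘ₗ (e : _ →ₗ[ℝ] R') ∘ₗ pr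
  refine ⟨LinearMap.toContinuousLinearMap C, fun z => ?_, fun w hw => ?_⟩
  · have : pr (j z) = 0 := Subtype.ext (by rw [hpr, hqj]; simp)
    change ((e (pr (j z)) : R') : E) = 0
    rw [this, map_zero]; rfl
  · have h1 : Λ (q w) + ((e (pr w) : R') : E) = 0 := hw
    have h2 : Λ (q w) = 0 := by
      have h3 : Λ (q w) ∈ LinearMap.range (Λ : H →ₗ[ℝ] E) := ⟨q w, rfl⟩
      have h4 : Λ (q w) ∈ R' := by
        rw [eq_neg_of_add_eq_zero_left h1]; exact R'.neg_mem (e (pr w)).2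
      exact (Submodule.disjoint_def.1 hR'.disjoint) _ h3 h4
    rw [h2, zero_add] at h1
    have h3 : pr w = 0 := e.map_eq_zero_iff.1 (Subtype.ext h1)
    have h4 := hpr w
    rw [h3, hΛ _ h2, map_zero, sub_zero] at h4
    exact h4.symm

variable {n k : ℕ} {X Y M : Set (RSpace n)} {P : RSpace n →L[ℝ] RSpace k}
  {g : RSpace k → RSpace n} {δ : ℝ}

/-- The first `k` coordinates and the coordinate of index `k`. -/
def splitCoords (n k : ℕ) (h : k + 1 ≤ n) : RSpace n →L[ℝ] RSpace k × ℝ :=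
  (firstCoords n k (by omega)).prod (EuclideanSpace.proj (⟨k, h⟩ : Fin n))

/-- The inclusion of `ℝ^k × ℝ` as the first `k + 1` coordinates. -/
def joinCoords (n k : ℕ) (h : k + 1 ≤ n) : RSpace k × ℝ →L[ℝ] RSpace n :=
  (inclCoords n k).coprod
    (ContinuousLinearMap.toSpanSingleton ℝ (EuclideanSpace.single (⟨k, h⟩ : Fin n) 1))

lemma joinCoords_apply {h : k + 1 ≤ n} (z : RSpace k × ℝ) (i : Fin n) :
    joinCoords n k h z i = inclCoords n k z.1 i + z.2 * (if i = ⟨k, h⟩ then 1 else 0) := by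
  simp [joinCoords]

lemma joinCoords_apply_last {h : k + 1 ≤ n} (z : RSpace k × ℝ) :
    joinCoords n k h z ⟨k, h⟩ = z.2 := by
  rw [joinCoords_apply, inclCoords_apply_of_le z.1 ⟨k, h⟩ le_rfl]; simp

lemma splitCoords_joinCoords {h : k + 1 ≤ n} (z : RSpace k × ℝ) :
    splitCoords n k h (joinCoords n k h z) = z := by
  refine Prod.ext ?_ (joinCoords_apply_last z)
  ext i
  change joinCoords n k h z (Fin.castLE (by omega) i) = z.1 i
  have h1 : (Fin.castLE (by omega) i : Fin n) ≠ ⟨k, h⟩ := fun he => by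
    have := congrArg Fin.val he
    have := i.2
    simp at *
    omega
  rw [joinCoords_apply, if_neg h1, mul_zero, add_zero]
  exact inclCoords_apply_of_lt (n := n) z.1 (Fin.castLE (by omega) i) i.2

lemma joinCoords_splitCoords {h : k + 1 ≤ n} {w : RSpace n} (hw : w ∈ linearModel n (k + 1)) :
    joinCoords n k h (splitCoords n k h w) = w := by
  ext i
  rw [joinCoords_apply]
  change inclCoords n k (firstCoords n k _ w) i + w ⟨k, h⟩ * _ = _
  rcases lt_trichotomy (i : ℕ) k with hi | hi | hi
  · rw [inclCoords_apply_of_lt _ _ hi, if_neg (fun he => hi.ne (congrArg Fin.val he)), mul_zero,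
      add_zero]
    rfl
  · have hi' : i = ⟨k, h⟩ := Fin.ext hi
    rw [inclCoords_apply_of_le _ _ hi.ge, if_pos hi', hi', mul_one, zero_add]
  · rw [inclCoords_apply_of_le _ _ hi.le, if_neg (fun he => hi.ne' (congrArg Fin.val he)),
      hw i hi, mul_zero, add_zero]

lemma joinCoords_mem_linearModel {h : k + 1 ≤ n} (z : RSpace k × ℝ) :
    joinCoords n k h z ∈ linearModel n (k + 1) := by
  intro i hi
  rw [joinCoords_apply, inclCoords_apply_of_le _ _ (by omega),
    if_neg (fun he => by have := congrArg Fin.val he; simp at this; omega), mul_zero, add_zero]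

lemma joinCoords_mem_halfModel {h : k + 1 ≤ n} {z : RSpace k × ℝ} (hz : 0 ≤ z.2) :
    joinCoords n k h z ∈ halfModel n (k + 1) := by
  refine ⟨joinCoords_mem_linearModel z, fun i hi => ?_⟩
  have : i = ⟨k, h⟩ := Fin.ext (by simp; omega)
  rw [this, joinCoords_apply_last]; exact hz

lemma splitCoords_snd_nonneg {h : k + 1 ≤ n} {w : RSpace n} (hw : w ∈ halfModel n (k + 1)) :
    0 ≤ (splitCoords n k h w).2 := hw.2 ⟨k, h⟩ rfl

/-- A set parametrised near the origin by the half `0 ≤ r` of a `C^1` immersion, with continuous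
inverse, can be straightened. -/
theorem exists_isStraightening_halfModel (hkn : k + 1 ≤ n) {σ : RSpace k × ℝ → RSpace n}
    (hσ : ContDiffAt ℝ 1 σ 0) (hσ0 : σ 0 = 0) (himm : ∀ z, fderiv ℝ σ 0 z = 0 → z = 0)
    {B : Set (RSpace k × ℝ)} (hB : B ∈ 𝓝 0) (hσM : ∀ b ∈ B, 0 ≤ b.2 → σ b ∈ M)
    {F : RSpace n → RSpace k × ℝ} {N : Set (RSpace n)} (hN : IsOpen N) (h0N : 0 ∈ N)
    (hF : ContinuousOn F N) (hF0 : F 0 = 0)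
    (hFM : ∀ y ∈ N, y ∈ M → 0 ≤ (F y).2 ∧ σ (F y) = y) :
    ∃ Φ : OpenPartialHomeomorph (RSpace n) (RSpace n), (0 : RSpace n) ∈ Φ.source ∧
      Φ.source ⊆ N ∧ ∀ y ∈ Φ.source, IsStraightening 1 M (halfModel n (k + 1)) y Φ := by
  set q := splitCoords n k hkn
  set j := joinCoords n k hkn
  have hqj : ∀ z, q (j z) = z := splitCoords_joinCoords
  obtain ⟨C, hCj, hC⟩ := exists_complement_map himm hqj
  -- H restricts to σ on the linear model and is a local diffeomorphism; the straightening is its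
  -- inverse.
  let H : RSpace n → RSpace n := fun w => σ (q w) + C w
  have hq0 : q 0 = 0 := map_zero q
  have hσq : ContDiffAt ℝ 1 σ (q 0) := by rwa [hq0]
  have hH : ContDiffAt ℝ 1 H 0 := (hσq.comp 0 q.contDiff.contDiffAt).add C.contDiff.contDiffAt
  have hdσ : HasFDerivAt σ (fderiv ℝ σ 0) (q 0) := by
    rw [hq0]; exact (hσ.differentiableAt one_ne_zero).hasFDerivAt
  have hdH : HasFDerivAt H ((fderiv ℝ σ 0).comp q + C) 0 :=
    (hdσ.comp 0 q.hasFDerivAt).add C.hasFDerivAt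
  obtain ⟨e, h0e, heH, he1, he2⟩ := exists_local_diffeo rfl hH (fun v hv => by
    rw [hdH.fderiv] at hv
    exact hC v hv)
  obtain ⟨B', hB'B, hB', h0B'⟩ := mem_nhds_iff.1 hB
  let e' := e.restrOpen (q ⁻¹' B') (hB'.preimage q.continuous)
  have he's : ∀ w, w ∈ e'.source ↔ w ∈ e.source ∧ q w ∈ B' := fun w => Iff.rfl
  have he'H : ∀ w, e' w = H w := fun w => congrFun heH w
  have h0e' : (0 : RSpace n) ∈ e'.source := ⟨h0e, by rw [mem_preimage, hq0]; exact h0B'⟩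
  have hH0 : H 0 = 0 := by simp only [H]; rw [hq0, hσ0, map_zero, add_zero]
  -- The image of σ could return near 0 from other parameters. Restricting to points whose parameter
  -- `F y` lies in the source of the local inverse ensures that the straightening of a point y of
  -- `M` is j(F y).
  have hV : IsOpen (N ∩ F ⁻¹' (j ⁻¹' e'.source)) :=
    hF.isOpen_inter_preimage hN (e'.open_source.preimage j.continuous)
  let Φ := e'.symm.restrOpen _ hV
  have hΦs : ∀ y, y ∈ Φ.source ↔ y ∈ e'.target ∧ y ∈ N ∧ j (F y) ∈ e'.source := fun y => Iff.rfl
  have hΦe : ∀ y, Φ y = e'.symm y := fun y => rfl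
  have h0t : (0 : RSpace n) ∈ e'.target := by
    have := e'.map_source h0e'
    rwa [he'H, hH0] at this
  refine ⟨Φ, ?_, fun y hy => hy.2.1, fun y hy => ⟨hy, ?_, ?_, ?_⟩⟩
  · rw [hΦs]
    refine ⟨h0t, h0N, ?_⟩
    rw [hF0, map_zero]; exact h0e'
  · exact he2.mono fun y hy => hy.1.1
  · exact he1.mono fun w hw => hw.1.1
  · intro y hy
    obtain ⟨hyt, hyN, hyF⟩ := (hΦs y).1 hy
    constructor
    · intro hyM
      obtain ⟨h1, h2⟩ := hFM y hyN hyM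
      have h3 : e' (j (F y)) = y := by
        rw [he'H]
        simp only [H]
        rw [hqj, hCj, add_zero, h2]
      rw [hΦe, ← h3, e'.left_inv hyF]
      exact joinCoords_mem_halfModel h1
    · intro hyH
      rw [hΦe] at hyH
      have h1 := e'.map_target hyt
      have h2 : H (e'.symm y) = y := by rw [← he'H]; exact e'.right_inv hyt
      have h3 : j (q (e'.symm y)) = e'.symm y := joinCoords_splitCoords hyH.1
      have h4 : σ (q (e'.symm y)) = y := by
        have hC0 : C (e'.symm y) = 0 := by rw [← h3, hCj]
        have h5 : σ (q (e'.symm y)) + C (e'.symm y) = y := h2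
        rwa [hC0, add_zero] at h5
      rw [← h4]
      exact hσM _ (hB'B h1.2) (splitCoords_snd_nonneg hyH)

end


/-! ### Forward direction: (b) and (npf) give a manifold with boundary -/

noncomputable section

open Metric (ball closedBall)
open Asymptotics

variable {n k : ℕ} {X Y M : Set (RSpace n)} {P : RSpace n →L[ℝ] RSpace k}
  {g : RSpace k → RSpace n} {δ : ℝ}

lemma IsStraightening.restrOpen {r : WithTop ℕ∞} {A : Set (RSpace n)} {p : RSpace n}
    {Φ : OpenPartialHomeomorph (RSpace n) (RSpace n)} (h : IsStraightening r M A p Φ)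
    {U : Set (RSpace n)} (hU : IsOpen U) (hp : p ∈ U) {M' : Set (RSpace n)}
    (hM : ∀ q ∈ U, q ∈ M' ↔ q ∈ M) : IsStraightening r M' A p (Φ.restrOpen U hU) := by
  refine ⟨⟨h.1, hp⟩, h.2.1.mono fun q hq => hq.1, h.2.2.1.mono fun q hq => hq.1, fun q hq => ?_⟩
  exact (hM q hq.2).trans (h.2.2.2 q hq.1)

lemma IsSubmanifold.inter_isOpen {r : WithTop ℕ∞} {d : ℕ} (h : IsSubmanifold r d M)
    {U : Set (RSpace n)} (hU : IsOpen U) : IsSubmanifold r d (M ∩ U) := by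
  refine ⟨h.1, fun p hp => ?_⟩
  obtain ⟨Φ, hΦ⟩ := h.2 p hp.1
  exact ⟨_, hΦ.restrOpen hU hp.2 fun q hq => ⟨fun h => h.1, fun h => ⟨h, hq⟩⟩⟩

lemma IsSubmanifold.of_le {r r' : WithTop ℕ∞} {d : ℕ} (h : IsSubmanifold r d M) (hr : r' ≤ r) :
    IsSubmanifold r' d M :=
  ⟨h.1, fun p hp => let ⟨Φ, hΦ⟩ := h.2 p hp; ⟨Φ, hΦ.of_le hr⟩⟩

lemma continuous_lastMap {G E : Type*} [NormedAddCommGroup G] [NormedSpace ℝ G]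
    [NormedAddCommGroup E] [NormedSpace ℝ E] :
    Continuous fun θ : E => lastMap G θ := by
  refine (LipschitzWith.of_dist_le_mul (K := 1) fun θ θ' => ?_).continuous
  rw [dist_eq_norm, dist_eq_norm, NNReal.coe_one, one_mul]
  refine ContinuousLinearMap.opNorm_le_bound _ (norm_nonneg _) fun z => ?_
  rw [sub_apply, lastMap_apply, lastMap_apply, ← smul_sub, norm_smul, mul_comm]
  gcongr
  exact norm_snd_le z

namespace IsTube

lemma tendsto_section (h : IsTube X P g δ) {s : RSpace k × ℝ → RSpace n}
    (hs : ∀ b ∈ collarBase k δ, s b ∈ Y ∧ s b ∈ tubeSet P g δ ∧ collarMap P g (s b) = b)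
    {u : RSpace k} (hu : u ∈ ball (0 : RSpace k) δ) :
    Tendsto s (𝓝 u ×ˢ 𝓝[>] 0) (𝓝[Y] (g u)) := by
  have hB : ∀ᶠ b in 𝓝 u ×ˢ 𝓝[>] (0 : ℝ), b ∈ collarBase k δ :=
    prod_mem_prod (Metric.isOpen_ball.mem_nhds hu) (Ioo_mem_nhdsGT h.pos)
  refine tendsto_nhdsWithin_iff.2 ⟨?_, hB.mono fun b hb => (hs b hb).1⟩
  have h1 : Tendsto (fun b : RSpace k × ℝ => g b.1) (𝓝 u ×ˢ 𝓝[>] 0) (𝓝 (g u)) :=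
    ((h.contDiffAt hu).continuousAt.tendsto).comp tendsto_fst
  have h2 : Tendsto (fun b : RSpace k × ℝ => s b - g b.1) (𝓝 u ×ˢ 𝓝[>] 0) (𝓝 0) := by
    rw [tendsto_zero_iff_norm_tendsto_zero]
    have h3 : Tendsto (fun b : RSpace k × ℝ => b.2) (𝓝 u ×ˢ 𝓝[>] 0) (𝓝 0) :=
      (tendsto_id.mono_left nhdsWithin_le_nhds).comp tendsto_snd
    refine h3.congr' ?_
    filter_upwards [hB] with b hb
    have h4 := (hs b hb).2.2
    rw [← congrArg Prod.fst h4]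
    exact (congrArg Prod.snd h4).symm
  have := h2.add h1
  simpa using this

/-- A graph in collar coordinates over `X`, the frame and the direction of which converge at `X`, is
a manifold with boundary. -/
theorem exists_isStraightening (h : IsTube X P g δ) (hkn : k + 1 ≤ n) (hXY : Disjoint X Y)
    (hcl : X ⊆ closure Y) {s : RSpace k × ℝ → RSpace n}
    (hsm : ContDiffOn ℝ 1 s (collarBase k δ))
    (hs : ∀ b ∈ collarBase k δ, s b ∈ Y ∧ s b ∈ tubeSet P g δ ∧ collarMap P g (s b) = b)
    (hsY : ∀ y ∈ Y, y ∈ tubeSet P g δ → s (collarMap P g y) = y)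
    (hframe : ∀ u ∈ ball (0 : RSpace k) δ, ∀ η > 0, ∀ᶠ y in 𝓝[Y] (g u),
      ‖fderiv ℝ s (collarMap P g y) - frameMap g (P y) (collarDir P g y)‖ ≤ η)
    (hlim : ∀ u ∈ ball (0 : RSpace k) δ, ∃ θ, Tendsto (collarDir P g) (𝓝[Y] (g u)) (𝓝 θ)) :
    ∃ Φ : OpenPartialHomeomorph (RSpace n) (RSpace n), (0 : RSpace n) ∈ Φ.source ∧
      Φ.source ⊆ tubeSet P g δ ∧
      ∀ y ∈ Φ.source, IsStraightening 1 (Y ∪ X) (halfModel n (k + 1)) y Φ := by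
  have hδ := h.pos
  choose! θ hθ using hlim
  let κ : RSpace k × ℝ → RSpace n := fun b => s b - g b.1
  have hgd : ContDiffOn ℝ 1 (fun b : RSpace k × ℝ => g b.1) (collarBase k δ) :=
    h.smooth.comp contDiff_fst.contDiffOn fun b hb => hb.1
  have hκ : ContDiffOn ℝ 1 κ (ball 0 δ ×ˢ Ioo 0 δ) := hsm.sub hgd
  have hB : ∀ u ∈ ball (0 : RSpace k) δ, ∀ᶠ b in 𝓝 u ×ˢ 𝓝[>] (0 : ℝ), b ∈ collarBase k δ :=
    fun u hu => prod_mem_prod (Metric.isOpen_ball.mem_nhds hu) (Ioo_mem_nhdsGT h.pos)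
  have hdir : ∀ b ∈ collarBase k δ, collarDir P g (s b) = b.2⁻¹ • κ b := by
    intro b hb
    have h4 := (hs b hb).2.2
    have h5 : P (s b) = b.1 := congrArg Prod.fst h4
    have h6 : ‖s b - g (P (s b))‖ = b.2 := congrArg Prod.snd h4
    rw [collarDir, unitVector, h6, h5]
  have h0 : ∀ u ∈ ball (0 : RSpace k) δ,
      Tendsto (fun b => collarDir P g (s b)) (𝓝 u ×ˢ 𝓝[>] 0) (𝓝 (θ u)) := fun u hu =>
    (hθ u hu).comp (h.tendsto_section hs hu)
  have h1 : ∀ u ∈ ball (0 : RSpace k) δ,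
      Tendsto (fun b : RSpace k × ℝ => b.2⁻¹ • κ b) (𝓝 u ×ˢ 𝓝[>] 0) (𝓝 (θ u)) := by
    intro u hu
    refine (h0 u hu).congr' ?_
    filter_upwards [hB u hu] with b hb using hdir b hb
  have h2 : ∀ u ∈ ball (0 : RSpace k) δ,
      Tendsto (fderiv ℝ κ) (𝓝 u ×ˢ 𝓝[>] 0) (𝓝 (lastMap (RSpace k) (θ u))) := by
    intro u hu
    have h3 : Tendsto (fun b => fderiv ℝ s b - frameMap g b.1 (collarDir P g (s b)))
        (𝓝 u ×ˢ 𝓝[>] 0) (𝓝 0) := by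
      rw [Metric.tendsto_nhds]
      intro ε hε
      filter_upwards [(h.tendsto_section hs hu).eventually (hframe u hu (ε / 2) (by positivity)),
        hB u hu] with b hb hbB
      have h4 := (hs b hbB).2.2
      have h5 : P (s b) = b.1 := congrArg Prod.fst h4
      rw [h4, h5] at hb
      rw [dist_zero_right]
      linarith
    -- The model frame minus the derivative of g ∘ fst is (v, t) ↦ tθ, so the closeness of Ds to the
    -- frame becomes convergence of Dκ.
    have h4 := h3.add ((continuous_lastMap (G := RSpace k)).continuousAt.tendsto.comp (h0 u hu))
    rw [zero_add] at h4
    refine h4.congr' ?_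
    filter_upwards [hB u hu] with b hb
    have hd1 : HasFDerivAt s (fderiv ℝ s b) b :=
      ((hsm.contDiffAt ((isOpen_collarBase k δ).mem_nhds hb)).differentiableAt
        one_ne_zero).hasFDerivAt
    have hd2 : HasFDerivAt (fun b : RSpace k × ℝ => g b.1)
        ((fderiv ℝ g b.1).comp (ContinuousLinearMap.fst ℝ (RSpace k) ℝ)) b :=
      (h.hasStrictFDerivAt hb.1).hasFDerivAt.comp b hasFDerivAt_fst
    have hd3 : fderiv ℝ κ b = _ := (hd1.sub hd2).fderiv
    rw [hd3]
    refine ContinuousLinearMap.ext fun z => ?_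
    simp
    abel
  set τ := oddExtension κ
  have hτ : ContDiffAt ℝ 1 τ 0 := contDiffAt_oddExtension hδ hκ h1 h2
  have hu0 := h.zero_mem_ball
  have hdτ : HasFDerivAt τ (lastMap (RSpace k) (θ 0)) 0 := hasFDerivAt_oddExtension_zero (h1 0 hu0)
  let σ : RSpace k × ℝ → RSpace n := fun b => g b.1 + τ b
  have hg0 : ContDiffAt ℝ 1 (fun b : RSpace k × ℝ => g b.1) 0 :=
    ContDiffAt.comp (g := g) (f := Prod.fst) (0 : RSpace k × ℝ) (h.contDiffAt hu0) contDiffAt_fst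
  have hdg0 : HasFDerivAt (fun b : RSpace k × ℝ => g b.1)
      ((fderiv ℝ g 0).comp (ContinuousLinearMap.fst ℝ (RSpace k) ℝ)) 0 :=
    HasFDerivAt.comp (g := g) (f := Prod.fst) (0 : RSpace k × ℝ)
      (h.hasStrictFDerivAt hu0).hasFDerivAt hasFDerivAt_fst
  have hτ0 : ∀ b : RSpace k × ℝ, b.2 = 0 → τ b = 0 := fun b hb => by
    simp [τ, oddExtension, hb]
  have hτp : ∀ b : RSpace k × ℝ, 0 < b.2 → σ b = s b := fun b hb => by
    simp [σ, τ, oddExtension, hb, κ]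
  have hnb : (𝓝[Y] (g 0)).NeBot :=
    mem_closure_iff_nhdsWithin_neBot.1 (hcl (h.section_mem hu0))
  obtain ⟨hPθ, hnθ⟩ := h.collarDir_limit hXY hu0 le_rfl (hθ 0 hu0)
  refine exists_isStraightening_halfModel hkn (σ := σ) (hg0.add hτ) ?_ ?_
    (B := ball (0 : RSpace k) δ ×ˢ Ioo (-δ) δ) ?_ ?_ (F := collarMap P g) h.isOpen_tubeSet ?_
    (h.continuousOn_collarMap.mono fun y hy => by simpa using hy.1) ?_ ?_
  · simp only [σ]
    rw [hτ0 0 rfl, Prod.fst_zero, h.zero, add_zero]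
  · intro z hz
    rw [show fderiv ℝ σ 0 = _ from (hdg0.add hdτ).fderiv] at hz
    have hz' : fderiv ℝ g 0 z.1 + z.2 • θ 0 = 0 := hz
    -- Immersion: `P` inverts Dg and kills θ, which gives z.1 = 0; then z.2 = 0 because θ is a unit
    -- vector.
    have h3 := congrArg P hz'
    rw [map_add, map_smul, h.proj_fderiv hu0, hPθ, smul_zero, add_zero, map_zero] at h3
    rw [h3, map_zero, zero_add, smul_eq_zero] at hz'
    have h4 : z.2 = 0 := hz'.resolve_right fun h5 => by simp [h5] at hnθ
    exact Prod.ext h3 h4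
  · exact (Metric.isOpen_ball.prod isOpen_Ioo).mem_nhds ⟨hu0, by simpa, hδ⟩
  · intro b hb hb2
    rcases hb2.eq_or_lt with h3 | h3
    · right
      simp only [σ]
      rw [hτ0 b h3.symm, add_zero]
      exact h.section_mem hb.1
    · left
      rw [hτp b h3]
      exact (hs b ⟨hb.1, h3, hb.2.2⟩).1
  · have := h.section_mem_tubeSet hu0
    rwa [h.zero] at this
  · simp [collarMap, h.zero]
  · intro y hyt hy
    refine ⟨norm_nonneg _, ?_⟩
    rcases hy with hy | hy
    · have hyX : y ∉ X := fun hX => hXY.le_bot ⟨hX, hy⟩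
      rw [hτp _ (h.collarMap_mem hyt hyX).2.1]
      exact hsY y hy hyt
    · have h3 := (h.mem_iff y hyt).1 hy
      have h4 : (collarMap P g y).2 = 0 := by
        change ‖y - g (P y)‖ = 0
        rw [← h3, sub_self, norm_zero]
      simp only [σ]
      rw [hτ0 _ h4, add_zero]
      exact h3.symm

end IsTube

/-- Whitney's condition and normal pseudo-flatness imply that the union of the strata is a manifold
with boundary. -/
theorem exists_isSubmanifoldWithBoundary
    {L : FirstOrder.Language.{u, v}} [L.Structure ℝ] (hL : IsOMinimalExpansionOfRealField L)
    (hYdef : IsDefinableSet L Y) (hX : IsSubmanifold 1 k X) (hY : IsSubmanifold 1 (k + 1) Y)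
    (hXY : Disjoint X Y) (hcl : X ⊆ closure Y) (hlc : IsLocallyClosed (X ∪ Y))
    (h0 : (0 : RSpace n) ∈ X)
    (hconn : ∃ ε₀ > 0, ∀ ε, 0 < ε → ε < ε₀ → IsConnected (Y ∩ ball 0 ε))
    {U : Set (RSpace n)} (hU : IsOpen U) (h0U : 0 ∈ U) (hb : WhitneyB (X ∩ U) (Y ∩ U))
    (hnpf : NormallyPseudoFlat (X ∩ U) ((Y ∪ X) ∩ U)) :
    ∃ U' : Set (RSpace n), IsOpen U' ∧ 0 ∈ U' ∧
      IsSubmanifoldWithBoundary 1 (k + 1) ((Y ∪ X) ∩ U') := by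
  have hY' := hY.inter_isOpen hU
  have hXY' : Disjoint (X ∩ U) (Y ∩ U) := hXY.mono inter_subset_left inter_subset_left
  have hcl' : X ∩ U ⊆ closure (Y ∩ U) := fun x hx => by
    have := hU.inter_closure ⟨hx.2, hcl hx.1⟩
    rwa [inter_comm] at this
  rw [union_inter_distrib_right] at hnpf
  obtain ⟨P, g, δ₀, hT₀⟩ := exists_isTube (hX.inter_isOpen hU) ⟨h0, h0U⟩
  obtain ⟨V, Z, hV, hZ, hVZ⟩ := hlc
  have h0V : (0 : RSpace n) ∈ V := by
    have : (0 : RSpace n) ∈ V ∩ Z := hVZ ▸ Or.inl h0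
    exact this.1
  have hu0 := hT₀.zero_mem_ball
  have hfr := hT₀.eventually_frame hY' hXY' hu0 (hb _ (hT₀.section_mem hu0)).1
    (hb _ (hT₀.section_mem hu0)).2 one_pos
  rw [hT₀.zero, eventually_nhdsWithin_iff] at hfr
  -- The tube is shrunk so that collar coordinates are independent on the tangent spaces of `Y`, and
  -- so that it lies in `U` and in the open set `V` where X ∪ Y agrees with the closed set `Z`.
  obtain ⟨δ, hδ, hδ₀, hδN⟩ := hT₀.exists_tubeSet_subset
    (inter_mem hfr (inter_mem (hU.mem_nhds h0U) (hV.mem_nhds h0V)))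
  have hT := hT₀.mono hδ hδ₀
  have hinj : ∀ y ∈ Y ∩ U, y ∈ tubeSet P g δ →
      ∀ v ∈ tangentVectors (Y ∩ U) y, fderiv ℝ (collarMap P g) y v = 0 → v = 0 :=
    fun y hy hyt => ((hδN hyt).1 hy).1
  have hZs : ∀ y ∈ tubeSet P g δ, y ∈ Z ↔ y ∈ X ∩ U ∪ Y ∩ U := by
    intro y hy
    have h1 := (hδN hy).2
    rw [← union_inter_distrib_right, hVZ]
    exact ⟨fun h => ⟨⟨h1.2, h⟩, h1.1⟩, fun h => h.1.2⟩
  have h0t : tubeSet P g δ ∈ 𝓝 (0 : RSpace n) := by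
    have := hT.tubeSet_mem_nhds hT.zero_mem_ball
    rwa [hT.zero] at this
  obtain ⟨ε₁, hε₁, hε₁t⟩ := Metric.mem_nhds_iff.1 h0t
  obtain ⟨ε₀, hε₀, hconn⟩ := hconn
  obtain ⟨ε, hε, hεlt⟩ := exists_between (lt_min hε₁ hε₀)
  have hεt : ball (0 : RSpace n) ε ⊆ tubeSet P g δ :=
    (Metric.ball_subset_ball (hεlt.le.trans (min_le_left _ _))).trans hε₁t
  have hpre : IsPreconnected (Y ∩ U ∩ ball 0 ε) := by
    have h1 : Y ∩ U ∩ ball 0 ε = Y ∩ ball 0 ε := by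
      ext y
      exact ⟨fun h => ⟨h.1.1, h.2⟩, fun h => ⟨⟨h.1, (hδN (hεt h.2)).2.1⟩, h.2⟩⟩
    rw [h1]
    exact (hconn ε hε (hεlt.trans_le (min_le_right _ _))).isPreconnected
  have huniq : ∀ b ∈ collarBase k δ, ∃! y, y ∈ Y ∩ U ∧ collarMap P g y = b := fun b hb =>
    hT.existsUnique_collar hY' hXY' hZ hZs hinj (hcl' ⟨h0, h0U⟩) hε hεt hpre hb
  obtain ⟨s, hsm, hs, hsY, hsd⟩ := hT.exists_collar_section hY' hXY' hinj huniq
  have hslice : ∀ u ∈ ball (0 : RSpace k) δ,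
      ∃ θ, Tendsto (fun r => r⁻¹ • (s (u, r) - g u)) (𝓝[>] 0) (𝓝 θ) := by
    intro u hu
    -- The slice is taken in `Y` itself, since `U` need not be definable; inside the tube `Y` and `Y
    -- ∩ U` coincide.
    refine hL.exists_tendsto_slice hYdef P (g u) u (s := fun r => s (u, r)) hδ fun r hr hrδ y => ?_
    have hb : (u, r) ∈ collarBase k δ := ⟨hu, hr, hrδ⟩
    constructor
    · rintro ⟨h1, h2, h3⟩
      have h4 : collarMap P g y = (u, r) := Prod.ext h2 (by rw [← h3, ← h2]; rfl)
      have hyt : y ∈ tubeSet P g δ := IsTube.mem_tubeSet_of_collarMap (by rw [h4]; exact hb)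
      have h5 := hsY y ⟨h1, (hδN hyt).2.1⟩ hyt
      rw [h4] at h5
      exact h5.symm
    · rintro rfl
      obtain ⟨h1, -, h3⟩ := hs _ hb
      have h4 : P (s (u, r)) = u := congrArg Prod.fst h3
      have h5 : ‖s (u, r) - g (P (s (u, r)))‖ = r := congrArg Prod.snd h3
      rw [h4] at h5
      exact ⟨h1.1, h4, h5⟩
  have hlim : ∀ u ∈ ball (0 : RSpace k) δ,
      ∃ θ, Tendsto (collarDir P g) (𝓝[Y ∩ U] (g u)) (𝓝 θ) := fun u hu =>
    hT.tendsto_collarDir_of_normallyPseudoFlat hXY' hcl' hnpf (fun O hO hOδ hne =>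
      hT.exists_tendsto_collarDir hXY' hsm.continuousOn hsY hslice hO hOδ hne) hu
  have hframe : ∀ u ∈ ball (0 : RSpace k) δ, ∀ η > 0, ∀ᶠ y in 𝓝[Y ∩ U] (g u),
      ‖fderiv ℝ s (collarMap P g y) - frameMap g (P y) (collarDir P g y)‖ ≤ η := by
    intro u hu η hη
    filter_upwards [hT.eventually_frame hY' hXY' hu (hb _ (hT.section_mem hu)).1
      (hb _ (hT.section_mem hu)).2 hη, self_mem_nhdsWithin,
      nhdsWithin_le_nhds (hT.tubeSet_mem_nhds hu)] with y h1 hy hyt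
    have hyb := hT.collarMap_mem hyt fun hX => hXY'.le_bot ⟨hX, hy⟩
    have h2 := hsd _ hyb
    rw [hsY y hy hyt] at h2
    exact h1.2 _ (fun z => (h2 z).1) fun z => (h2 z).2
  obtain ⟨Φ, h0Φ, hΦt, hΦ⟩ :=
    hT.exists_isStraightening hY.1 hXY' hcl' hsm hs hsY hframe hlim
  refine ⟨Φ.source, Φ.open_source, h0Φ, hY.1, fun p hp => ⟨Φ, (hΦ p hp.2).1, (hΦ p hp.2).2.1,
    (hΦ p hp.2).2.2.1, fun q hq => ?_⟩⟩
  rw [← (hΦ p hp.2).2.2.2 q hq]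
  have hqU := (hδN (hΦt hq)).2.1
  constructor
  · rintro ⟨h1 | h1, -⟩
    · exact Or.inl ⟨h1, hqU⟩
    · exact Or.inr ⟨h1, hqU⟩
  · rintro (h1 | h1)
    · exact ⟨Or.inl h1.1, hq⟩
    · exact ⟨Or.inr h1.1, hq⟩

end


/-! ### Converse: height coordinates over X -/

noncomputable section

open Metric (ball closedBall)

variable {n k : ℕ} {X Y M : Set (RSpace n)} {P : RSpace n →L[ℝ] RSpace k}
  {g : RSpace k → RSpace n} {δ : ℝ}

/-- The coordinates given by a projection to `X` and a linear height over `X`. -/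
def heightMap (P : RSpace n →L[ℝ] RSpace k) (g : RSpace k → RSpace n) (φ : RSpace n →L[ℝ] ℝ)
    (y : RSpace n) : RSpace k × ℝ :=
  (P y, φ (y - g (P y)))

/-- `Y` is parametrized by `X` and the height `φ > 0` over `X`, by a map `s` which is `C^1` up to
`X`. -/
structure IsCollar (X Y : Set (RSpace n)) (P : RSpace n →L[ℝ] RSpace k) (g : RSpace k → RSpace n)
    (δ : ℝ) (φ : RSpace n →L[ℝ] ℝ) (s : RSpace k × ℝ → RSpace n) (B : Set (RSpace k × ℝ)) :
    Prop where
  tube : IsTube X P g δ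
  subset : X ⊆ tubeSet P g δ
  isOpen : IsOpen B
  smooth : ContDiffOn ℝ 1 s B
  section_zero : ∀ u ∈ ball (0 : RSpace k) δ, (u, 0) ∈ B ∧ s (u, 0) = g u
  mem : ∀ b ∈ B, 0 < b.2 → s b ∈ Y
  inv : ∀ y ∈ Y, 0 < (heightMap P g φ y).2 ∧ heightMap P g φ y ∈ B ∧ s (heightMap P g φ y) = y

/-- `P` maps `S` onto ℝ^k, so its kernel in `S` is a line; pairing with a generator of this line
detects it. -/
lemma exists_height_functional (S : Submodule ℝ (RSpace n)) (hS : Module.finrank ℝ S = k + 1)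
    {G : RSpace k →L[ℝ] RSpace n} (hG : ∀ v, G v ∈ S) (hPG : ∀ v, P (G v) = v) :
    ∃ φ : RSpace n →L[ℝ] ℝ, ∀ v ∈ S, P v = 0 → φ v = 0 → v = 0 := by
  let T : S →ₗ[ℝ] RSpace k := (P : RSpace n →ₗ[ℝ] RSpace k).domRestrict S
  have hT : Function.Surjective T := fun v => ⟨⟨G v, hG v⟩, hPG v⟩
  have h1 := LinearMap.finrank_range_add_finrank_ker T
  rw [LinearMap.range_eq_top.2 hT, finrank_top, finrank_euclideanSpace_fin, hS] at h1
  have h2 : Module.finrank ℝ (LinearMap.ker T) = 1 := by omega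
  obtain ⟨e, -, he⟩ := finrank_eq_one_iff'.1 h2
  refine ⟨innerSL ℝ (e : RSpace n), fun v hv hPv hφ => ?_⟩
  obtain ⟨c, hc⟩ := he ⟨⟨v, hv⟩, hPv⟩
  have h3 : c • ((e : S) : RSpace n) = v :=
    congrArg (fun z : LinearMap.ker T => ((z : S) : RSpace n)) hc
  rw [← h3, innerSL_apply_apply, inner_smul_right, real_inner_self_eq_norm_sq] at hφ
  rcases mul_eq_zero.1 hφ with h4 | h4
  · rw [← h3, h4, zero_smul]
  · rw [← h3, norm_eq_zero.1 (pow_eq_zero_iff two_ne_zero |>.1 h4), smul_zero]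

namespace IsTube

lemma contDiffAt_heightMap (h : IsTube X P g δ) (φ : RSpace n →L[ℝ] ℝ) {y : RSpace n}
    (hy : y ∈ tubeSet P g δ) : ContDiffAt ℝ 1 (heightMap P g φ) y :=
  P.contDiff.contDiffAt.prodMk (φ.contDiff.contDiffAt.comp y (h.contDiffAt_sub hy))

lemma heightMap_section (h : IsTube X P g δ) (φ : RSpace n →L[ℝ] ℝ) {u : RSpace k}
    (hu : u ∈ ball (0 : RSpace k) δ) : heightMap P g φ (g u) = (u, 0) := by
  simp [heightMap, h.proj u hu]

lemma fderiv_heightMap (h : IsTube X P g δ) (φ : RSpace n →L[ℝ] ℝ) {y : RSpace n}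
    (hy : y ∈ tubeSet P g δ) (v : RSpace n) :
    fderiv ℝ (heightMap P g φ) y v = (P v, φ (v - fderiv ℝ g (P y) (P v))) := by
  have hu : P y ∈ ball (0 : RSpace k) δ := by simpa using hy.1
  have h1 := (h.hasStrictFDerivAt hu).hasFDerivAt.comp y P.hasFDerivAt
  have h2 : HasFDerivAt (heightMap P g φ) _ y :=
    P.hasFDerivAt.prodMk (φ.hasFDerivAt.comp y ((hasFDerivAt_id y).sub h1))
  rw [h2.fderiv]
  simp

/-- Height coordinates on a submanifold that contains `X` as a hypersurface. -/
lemma exists_height_param (h : IsTube X P g δ) {Φ : OpenPartialHomeomorph (RSpace n) (RSpace n)}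
    (hΦ : IsStraightening 1 M (linearModel n (k + 1)) 0 Φ) (hkn : k + 1 ≤ n)
    (hXM : ∀ᶠ x in 𝓝 0, x ∈ X → x ∈ M) {φ : RSpace n →L[ℝ] ℝ}
    (hφ : ∀ v ∈ tangentVectors M 0, P v = 0 → φ v = 0 → v = 0) :
    ∃ (r : ℝ) (s : RSpace k × ℝ → RSpace n), 0 < r ∧ r ≤ δ ∧
      ContDiffOn ℝ 1 s (ball 0 r) ∧
      (∀ b ∈ ball (0 : RSpace k × ℝ) r, s b ∈ M ∧ heightMap P g φ (s b) = b) ∧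
      (∀ u ∈ ball (0 : RSpace k) r, s (u, 0) = g u) ∧
      ∀ᶠ m in 𝓝 0, m ∈ M → heightMap P g φ m ∈ ball (0 : RSpace k × ℝ) r ∧
        s (heightMap P g φ m) = m := by
  have hu0 := h.zero_mem_ball
  have h0t : (0 : RSpace n) ∈ tubeSet P g δ := by
    have := h.section_mem_tubeSet hu0
    rwa [h.zero] at this
  have h0X : (0 : RSpace n) ∈ X := by
    have := h.section_mem hu0
    rwa [h.zero] at this
  have h00 : heightMap P g φ 0 = 0 := by
    have := h.heightMap_section φ hu0
    rwa [h.zero] at this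
  obtain ⟨O, O', s, hO, h0O, hO', h0O', hs, hsM, hsinv⟩ := hΦ.exists_local_param
    (G := RSpace k × ℝ) (hXM.self_of_nhds h0X) hkn (by simp) (h.contDiffAt_heightMap φ h0t)
    (fun v hv hv0 => by
      rw [h.fderiv_heightMap φ h0t] at hv0
      have h1 : P v = 0 := congrArg Prod.fst hv0
      refine hφ v hv h1 ?_
      have h2 := congrArg Prod.snd hv0
      simpa [h1] using h2)
  rw [h00] at h0O'
  have hg0 : Tendsto g (𝓝 0) (𝓝 0) := by
    have := (h.contDiffAt hu0).continuousAt.tendsto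
    rwa [h.zero] at this
  obtain ⟨r₁, hr₁, hr₁g⟩ := Metric.eventually_nhds_iff_ball.1
    (hg0.eventually (hXM.and (hO.mem_nhds h0O)))
  obtain ⟨r₂, hr₂, hr₂O⟩ := Metric.isOpen_iff.1 hO' 0 h0O'
  have hδ := h.pos
  refine ⟨min δ (min r₁ r₂), s, by positivity, min_le_left _ _, hs.mono ?_, fun b hb => ?_,
    fun u hu => ?_, ?_⟩
  · exact (Metric.ball_subset_ball ((min_le_right _ _).trans (min_le_right _ _))).trans hr₂O
  · have := hsM b (hr₂O (Metric.ball_subset_ball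
      ((min_le_right _ _).trans (min_le_right _ _)) hb))
    exact ⟨this.1, this.2.2⟩
  · have huδ := Metric.ball_subset_ball (min_le_left _ _) hu
    have hg := hr₁g u (Metric.ball_subset_ball ((min_le_right _ _).trans (min_le_left _ _)) hu)
    have := (hsinv (g u) (hg.1 (h.section_mem huδ)) hg.2).2
    rwa [h.heightMap_section φ huδ] at this
  · have h1 : Tendsto (heightMap P g φ) (𝓝 0) (𝓝 0) := by
      have := (h.contDiffAt_heightMap φ h0t).continuousAt.tendsto
      rwa [h00] at this
    filter_upwards [hO.mem_nhds h0O, h1.eventually (Metric.ball_mem_nhds (0 : RSpace k × ℝ)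
      (show 0 < min δ (min r₁ r₂) by positivity))] with m hm hm' hmM
    exact ⟨hm', (hsinv m hmM hm).2⟩

/-- A height which does not vanish on the connected `Y` has a sign. -/
lemma exists_height_pos (h : IsTube X P g δ)
    (hconn : ∃ ε₀ > 0, ∀ ε, 0 < ε → ε < ε₀ → IsConnected (Y ∩ ball 0 ε)) {φ : RSpace n →L[ℝ] ℝ}
    (hφ : ∀ᶠ y in 𝓝 0, y ∈ Y → (heightMap P g φ y).2 ≠ 0) :
    ∃ φ', (φ' = φ ∨ φ' = -φ) ∧ ∀ᶠ y in 𝓝 0, y ∈ Y → 0 < (heightMap P g φ' y).2 := by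
  have h0t : tubeSet P g δ ∈ 𝓝 (0 : RSpace n) := by
    have := h.tubeSet_mem_nhds h.zero_mem_ball
    rwa [h.zero] at this
  obtain ⟨ε₁, hε₁, hε₁t⟩ := Metric.eventually_nhds_iff_ball.1 (hφ.and h0t)
  obtain ⟨ε₀, hε₀, hconn⟩ := hconn
  obtain ⟨ε, hε, hεlt⟩ := exists_between (lt_min hε₁ hε₀)
  have hεt := fun y hy => hε₁t y (Metric.ball_subset_ball (hεlt.le.trans (min_le_left _ _)) hy)
  have hpre := (hconn ε hε (hεlt.trans_le (min_le_right _ _))).isPreconnected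
  have hcont : ContinuousOn (fun y => (heightMap P g φ y).2) (Y ∩ ball 0 ε) := fun y hy =>
    (continuous_snd.continuousAt.comp
      (h.contDiffAt_heightMap φ (hεt y hy.2).2).continuousAt).continuousWithinAt
  by_cases hneg : ∃ y ∈ Y ∩ ball 0 ε, (heightMap P g φ y).2 < 0
  · obtain ⟨y₀, hy₀, hneg⟩ := hneg
    refine ⟨-φ, Or.inr rfl, ?_⟩
    filter_upwards [Metric.ball_mem_nhds (0 : RSpace n) hε] with y hyε hy
    by_contra hle
    have h1 : 0 ≤ (heightMap P g φ y).2 := by simpa [heightMap] using hle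
    -- A change of sign on the connected `Y ∩ ball 0 ε` would produce a point of height 0.
    obtain ⟨y', hy', h2⟩ := hpre.intermediate_value hy₀ ⟨hy, hyε⟩ hcont ⟨hneg.le, h1⟩
    exact (hεt y' hy'.2).1 hy'.1 h2
  · push Not at hneg
    refine ⟨φ, Or.inl rfl, ?_⟩
    filter_upwards [Metric.ball_mem_nhds (0 : RSpace n) hε] with y hyε hy
    exact (hneg y ⟨hy, hyε⟩).lt_of_ne' ((hεt y hyε).1 hy)

end IsTube

end


/-! ### Converse: X is the boundary and Y is one whole side -/

noncomputable section

open Metric (ball closedBall)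

variable {n k : ℕ} {X Y M : Set (RSpace n)} {P : RSpace n →L[ℝ] RSpace k}
  {g : RSpace k → RSpace n} {δ : ℝ}

/-- A `C^1` function on a half-space that vanishes on the bounding hyperplane, is negative below it
and is not critical at the origin, is positive above it. -/
lemma exists_pos_of_neg_of_pos {G : Type*} [NormedAddCommGroup G] [NormedSpace ℝ G]
    {Z : G × ℝ → ℝ} (hZ : ContDiffAt ℝ 1 Z 0) (hneg : ∀ᶠ b in 𝓝 (0 : G × ℝ), b.2 < 0 → Z b < 0)
    (hzero : ∀ᶠ b in 𝓝 (0 : G × ℝ), b.2 = 0 → Z b = 0) (hd : fderiv ℝ Z 0 ≠ 0) :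
    ∀ᶠ b in 𝓝 (0 : G × ℝ), 0 < b.2 → 0 < Z b := by
  have hZ' := (hZ.differentiableAt one_ne_zero).hasFDerivAt
  have h1 : ∀ v : G, fderiv ℝ Z 0 (v, 0) = 0 := by
    intro v
    have h2 : HasFDerivAt (fun v : G => Z (v, 0))
        ((fderiv ℝ Z 0).comp (ContinuousLinearMap.inl ℝ G ℝ)) 0 :=
      HasFDerivAt.comp (g := Z) (f := ContinuousLinearMap.inl ℝ G ℝ) (0 : G)
        (by rw [map_zero]; exact hZ') (ContinuousLinearMap.hasFDerivAt _)
    have h3 : Tendsto (fun v : G => (v, (0 : ℝ))) (𝓝 0) (𝓝 0) :=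
      (ContinuousLinearMap.inl ℝ G ℝ).continuous.tendsto' 0 0 (map_zero _)
    have h4 : HasFDerivAt (fun v : G => Z (v, 0)) (0 : G →L[ℝ] ℝ) 0 :=
      (hasFDerivAt_const (0 : ℝ) (0 : G)).congr_of_eventuallyEq
        ((h3.eventually hzero).mono fun v hv => hv rfl)
    exact congrArg (fun T => T v) (h2.unique h4)
  have h2 : HasDerivAt (fun t : ℝ => Z (0, t)) (fderiv ℝ Z 0 (0, 1)) 0 := by
    have h3 : HasDerivAt (fun t : ℝ => ((0 : G), t)) ((0 : G), (1 : ℝ)) 0 :=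
      (hasDerivAt_const 0 (0 : G)).prodMk (hasDerivAt_id 0)
    exact HasFDerivAt.comp_hasDerivAt (l := Z) (0 : ℝ) (by exact hZ') h3
  have h0 : Z (0, 0) = 0 := hzero.self_of_nhds rfl
  -- Difference quotients from below are nonnegative. Since the horizontal derivative vanishes and
  -- the whole derivative does not, the vertical one is positive.
  have h3 : 0 ≤ fderiv ℝ Z 0 (0, 1) := by
    have h4 := (hasDerivAt_iff_tendsto_slope.1 h2).mono_left
      (nhdsWithin_mono 0 fun t (ht : t < 0) => ne_of_lt ht : 𝓝[<] (0 : ℝ) ≤ 𝓝[≠] 0)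
    refine ge_of_tendsto h4 ?_
    have h5 : Tendsto (fun t : ℝ => ((0 : G), t)) (𝓝[<] 0) (𝓝 0) :=
      ((ContinuousLinearMap.inr ℝ G ℝ).continuous.tendsto' 0 0 (map_zero _)).mono_left
        nhdsWithin_le_nhds
    filter_upwards [h5.eventually hneg, self_mem_nhdsWithin] with t ht ht0
    rw [slope_def_field, h0, sub_zero, sub_zero]
    exact div_nonneg_of_nonpos (ht ht0).le (le_of_lt ht0)
  have h4 : 0 < fderiv ℝ Z 0 (0, 1) := by
    refine h3.lt_of_ne' fun h5 => hd (ContinuousLinearMap.ext fun b => ?_)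
    have h6 : b = (b.1, 0) + b.2 • ((0 : G), (1 : ℝ)) := by simp
    rw [h6, map_add, map_smul, h1, h5]
    simp
  have h5 : ∀ᶠ b in 𝓝 (0 : G × ℝ), 0 < fderiv ℝ Z b (0, 1) :=
    (((ContinuousLinearMap.apply ℝ ℝ ((0 : G), (1 : ℝ))).continuous.continuousAt.comp
      (hZ.continuousAt_fderiv one_ne_zero)).tendsto).eventually (lt_mem_nhds h4)
  have h6 : ∀ᶠ b in 𝓝 (0 : G × ℝ), DifferentiableAt ℝ Z b :=
    (hZ.eventually (by simp)).mono fun b hb => hb.differentiableAt one_ne_zero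
  obtain ⟨r, hr, hrb⟩ := Metric.eventually_nhds_iff_ball.1 (h5.and (h6.and hzero))
  filter_upwards [Metric.ball_mem_nhds (0 : G × ℝ) hr] with b hb hb2
  have hseg : ∀ t ∈ Icc 0 b.2, (b.1, t) ∈ ball (0 : G × ℝ) r := by
    intro t ht
    rw [mem_ball_zero_iff] at hb ⊢
    refine lt_of_le_of_lt ?_ hb
    rw [Prod.norm_def, Prod.norm_def]
    refine max_le_max le_rfl ?_
    rw [Real.norm_of_nonneg ht.1, Real.norm_of_nonneg hb2.le]
    exact ht.2
  have hder : ∀ t ∈ Icc 0 b.2, HasDerivAt (fun t => Z (b.1, t)) (fderiv ℝ Z (b.1, t) (0, 1)) t :=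
    fun t ht => (hrb _ (hseg t ht)).2.1.hasFDerivAt.comp_hasDerivAt t
      ((hasDerivAt_const t b.1).prodMk (hasDerivAt_id t))
  -- Mean value theorem along the vertical segment from the hyperplane, where Z vanishes.
  obtain ⟨t, ht, hslope⟩ := exists_hasDerivAt_eq_slope (fun t => Z (b.1, t)) _ hb2
    (fun t ht => (hder t ht).continuousAt.continuousWithinAt)
    fun t ht => hder t (Ioo_subset_Icc_self ht)
  have h7 := (hrb _ (hseg t (Ioo_subset_Icc_self ht))).1
  rw [hslope, (hrb _ (hseg 0 ⟨le_rfl, hb2.le⟩)).2.2 rfl, sub_zero, sub_zero] at h7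
  exact (div_pos_iff_of_pos_right hb2).1 h7

namespace IsTube

/-- If `X ∪ Y` is a manifold with boundary, then `Y` is a collar of `X`, which is the boundary. -/
theorem exists_isCollar (h : IsTube X P g δ) (hkn : k + 1 ≤ n) (hXY : Disjoint X Y)
    (hconn : ∃ ε₀ > 0, ∀ ε, 0 < ε → ε < ε₀ → IsConnected (Y ∩ ball 0 ε))
    {U : Set (RSpace n)} (hU : IsOpen U) {Φ : OpenPartialHomeomorph (RSpace n) (RSpace n)}
    (h0U : (0 : RSpace n) ∈ U)
    (hΦ : IsStraightening 1 ((Y ∪ X) ∩ U) (halfModel n (k + 1)) 0 Φ) :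
    ∃ δ' φ s B, tubeSet P g δ' ⊆ U ∩ Φ.source ∧
      IsCollar (X ∩ tubeSet P g δ') (Y ∩ tubeSet P g δ') P g δ' φ s B ∧
      ∀ x ∈ X, x ∈ tubeSet P g δ' → ∀ i : Fin n, (i : ℕ) = k → Φ x i = 0 := by
  have hu0 := h.zero_mem_ball
  have h0X : (0 : RSpace n) ∈ X := by
    have := h.section_mem hu0
    rwa [h.zero] at this
  have h0t : tubeSet P g δ ∈ 𝓝 (0 : RSpace n) := by
    have := h.tubeSet_mem_nhds hu0
    rwa [h.zero] at this
  have h0tube := mem_of_mem_nhds h0t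
  obtain ⟨h0Φ, hΦ1, hΦ2, hΦM⟩ := hΦ
  let i : Fin n := ⟨k, hkn⟩
  -- The extension across a possible boundary: a manifold of dimension k + 1 containing X ∪ Y near
  -- 0. It is not yet known that 0 is a boundary point.
  set M : Set (RSpace n) := {q | q ∈ Φ.source ∧ Φ q ∈ linearModel n (k + 1)} with hMdef
  have hM : IsStraightening 1 M (linearModel n (k + 1)) 0 Φ :=
    ⟨h0Φ, hΦ1, hΦ2, fun q hq => ⟨And.right, fun h => ⟨hq, h⟩⟩⟩
  have hN : U ∩ Φ.source ∈ 𝓝 (0 : RSpace n) :=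
    inter_mem (hU.mem_nhds h0U) (Φ.open_source.mem_nhds h0Φ)
  have hmem : ∀ q ∈ U ∩ Φ.source, q ∈ Y ∪ X ↔ q ∈ M ∧ 0 ≤ Φ q i := by
    intro q hq
    rw [← and_iff_left (a := q ∈ Y ∪ X) hq.1]
    refine (hΦM q hq.2).trans ⟨fun h1 => ⟨⟨hq.2, h1.1⟩, h1.2 i rfl⟩, fun h1 => ⟨h1.1.2, ?_⟩⟩
    intro j hj
    have : j = i := Fin.ext (by simpa [i] using hj)
    rw [this]; exact h1.2
  have hXM : ∀ᶠ x in 𝓝 0, x ∈ X → x ∈ M := by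
    filter_upwards [hN] with x hx hxX using ((hmem x hx).1 (Or.inr hxX)).1
  have h0M : (0 : RSpace n) ∈ M := hXM.self_of_nhds h0X
  obtain ⟨S, hS, hSd⟩ := hM.exists_submodule h0M hkn
  have hTX : ∀ v, fderiv ℝ g 0 v ∈ S := by
    intro v
    have h1 : fderiv ℝ g 0 v ∈ tangentVectors X (g 0) := by
      rw [h.tangentVectors_eq hu0]; exact mem_range_self v
    rw [h.zero] at h1
    obtain ⟨γ, hγ0, hγ, hγd⟩ := h1
    rw [← SetLike.mem_coe, hS]
    refine ⟨γ, hγ0, ?_, hγd⟩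
    have h2 : Tendsto γ (𝓝 0) (𝓝 0) := by
      have := hγd.continuousAt.tendsto
      rwa [hγ0] at this
    filter_upwards [hγ, h2.eventually hXM] with t h3 h4 using h4 h3
  obtain ⟨φ₀, hφ₀⟩ := exists_height_functional (P := P) S hSd hTX (h.proj_fderiv hu0)
  have hXφ : ∀ {φ : RSpace n →L[ℝ] ℝ}, (∀ v ∈ tangentVectors M 0, P v = 0 → φ v = 0 → v = 0) →
      ∀ᶠ y in 𝓝 0, y ∈ M → (heightMap P g φ y).2 = 0 → y ∈ X := by
    intro φ hφ
    obtain ⟨r, s, hr, hrδ, -, -, hsg, hinv⟩ := h.exists_height_param hM hkn hXM hφ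
    filter_upwards [hinv] with y hy hyM hy0
    have h1 := (hy hyM).1
    have h2 : heightMap P g φ y = (P y, 0) := Prod.ext rfl hy0
    have h3 : P y ∈ ball (0 : RSpace k) r := by
      rw [mem_ball_zero_iff] at h1 ⊢
      exact (norm_fst_le _).trans_lt h1
    rw [← (hy hyM).2, h2, hsg _ h3]
    exact h.section_mem (Metric.ball_subset_ball hrδ h3)
  obtain ⟨φ, hφφ₀, hφpos⟩ := h.exists_height_pos hconn (φ := φ₀) (by
    filter_upwards [hXφ (φ := φ₀) fun v hv => hφ₀ v (by rwa [← SetLike.mem_coe, hS]), hN]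
      with y hy hyN hyY h0
    exact hXY.le_bot ⟨hy ((hmem y hyN).1 (Or.inl hyY)).1 h0, hyY⟩)
  have hφ : ∀ v ∈ tangentVectors M 0, P v = 0 → φ v = 0 → v = 0 := by
    intro v hv h1 h2
    refine hφ₀ v (by rwa [← SetLike.mem_coe, hS]) h1 ?_
    rcases hφφ₀ with rfl | rfl
    · exact h2
    · simpa using h2
  obtain ⟨r, s, hr, hrδ, hs, hsM, hsg, hinv⟩ := h.exists_height_param hM hkn hXM hφ
  have hs0 : s 0 = 0 := (hsg 0 (Metric.mem_ball_self hr)).trans h.zero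
  have hsc : ContDiffAt ℝ 1 s 0 := hs.contDiffAt (Metric.ball_mem_nhds _ hr)
  have hst : Tendsto s (𝓝 0) (𝓝 0) := by
    have := hsc.continuousAt.tendsto
    rwa [hs0] at this
  have hX0 : ∀ q ∈ tubeSet P g δ, q ∈ X → (heightMap P g φ q).2 = 0 := by
    intro q hq hqX
    simp only [heightMap]
    rw [← (h.mem_iff q hq).1 hqX, sub_self, map_zero]
  -- The boundary coordinate as a function of base point and height: near 0, X ∪ Y is the part of
  -- `M` where it is nonnegative.
  let Z : RSpace k × ℝ → ℝ := fun b => Φ (s b) i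
  have hball : ∀ᶠ b in 𝓝 (0 : RSpace k × ℝ), b ∈ ball (0 : RSpace k × ℝ) r :=
    Metric.ball_mem_nhds _ hr
  -- A point of negative height with Z ≥ 0 would lie in X ∪ Y, where heights are 0 or positive.
  have hneg : ∀ᶠ b in 𝓝 (0 : RSpace k × ℝ), b.2 < 0 → Z b < 0 := by
    filter_upwards [hball, hst.eventually (inter_mem hN h0t), hst.eventually hφpos]
      with b hb hbN hpos hb2
    by_contra hle
    have h1 := (hmem _ hbN.1).2 ⟨(hsM b hb).1, not_lt.1 hle⟩
    have h2 := (hsM b hb).2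
    rcases h1 with h1 | h1
    · have := hpos h1
      rw [h2] at this
      exact this.not_gt hb2
    · have := hX0 _ hbN.2 h1
      rw [h2] at this
      exact hb2.ne this
  have hZc : ContDiffAt ℝ 1 Z 0 := by
    have h1 : ContDiffAt ℝ 1 Φ (s 0) := by
      rw [hs0]; exact hΦ1.contDiffAt (Φ.open_source.mem_nhds h0Φ)
    exact (EuclideanSpace.proj (𝕜 := ℝ) i).contDiff.contDiffAt.comp _ (h1.comp _ hsc)
  have hZca : ∀ᶠ b in 𝓝 (0 : RSpace k × ℝ), ContinuousAt Z b :=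
    (hZc.eventually (by simp)).mono fun b hb => hb.continuousAt
  -- At height 0, Z ≤ 0 as a limit from below, and Z ≥ 0 because the point is in `X`.
  have hzero : ∀ᶠ b in 𝓝 (0 : RSpace k × ℝ), b.2 = 0 → Z b = 0 := by
    filter_upwards [hball, hst.eventually hN, hneg.eventually_nhds, hZca] with b hb hbN hbneg hbc hb2
    have hbr : b.1 ∈ ball (0 : RSpace k) r := by
      rw [mem_ball_zero_iff] at hb ⊢
      exact (norm_fst_le _).trans_lt hb
    have hbe : b = (b.1, 0) := Prod.ext rfl hb2
    refine le_antisymm ?_ ?_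
    · have h1 : Tendsto (fun t : ℝ => (b.1, t)) (𝓝[<] 0) (𝓝 b) := by
        have : Tendsto (fun t : ℝ => (b.1, t)) (𝓝 0) (𝓝 (b.1, 0)) :=
          tendsto_const_nhds.prodMk_nhds tendsto_id
        rw [← hbe] at this
        exact this.mono_left nhdsWithin_le_nhds
      refine le_of_tendsto (hbc.tendsto.comp h1) ?_
      filter_upwards [h1.eventually hbneg, self_mem_nhdsWithin] with t ht ht0 using (ht ht0).le
    · refine ((hmem _ hbN).1 (Or.inr ?_)).2
      rw [hbe, hsg _ hbr]
      exact h.section_mem (Metric.ball_subset_ball hrδ hbr)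
  -- Some curve in `M` moves at unit speed in the boundary coordinate, and along it this coordinate
  -- is Z of the height coordinates.
  have hd : fderiv ℝ Z 0 ≠ 0 := by
    intro hZ0
    obtain ⟨A, hA, -⟩ := hM.exists_equiv
    have h1 : A.symm (EuclideanSpace.single i 1) ∈ tangentVectors M 0 := by
      rw [hM.mem_tangentVectors_iff h0M, hA.fderiv]
      intro j hj
      have : j ≠ i := fun h => by simp [h, i] at hj
      simp [this]
    obtain ⟨γ, hγ0, hγ, hγd⟩ := h1
    have h2 : Tendsto γ (𝓝 0) (𝓝 0) := by
      have := hγd.continuousAt.tendsto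
      rwa [hγ0] at this
    have h3 : HasDerivAt (fun t => Φ (γ t) i) 1 0 := by
      rw [← hγ0] at hA
      have h4 := (EuclideanSpace.proj (𝕜 := ℝ) i).hasFDerivAt.comp_hasDerivAt (0 : ℝ)
        (hA.comp_hasDerivAt (0 : ℝ) hγd)
      simpa [Function.comp_def] using h4
    have h5 : HasDerivAt (fun t => Φ (γ t) i) 0 0 := by
      have h6 : heightMap P g φ (γ 0) = 0 := by
        rw [hγ0]
        have := h.heightMap_section φ hu0
        rwa [h.zero] at this
      have h7 : HasFDerivAt (heightMap P g φ) (fderiv ℝ (heightMap P g φ) 0) (γ 0) := by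
        rw [hγ0]
        exact ((h.contDiffAt_heightMap φ h0tube).differentiableAt one_ne_zero).hasFDerivAt
      have h8 := h7.comp_hasDerivAt (0 : ℝ) hγd
      have h9 : HasFDerivAt Z (0 : RSpace k × ℝ →L[ℝ] ℝ) (heightMap P g φ (γ 0)) := by
        rw [h6, ← hZ0]
        exact (hZc.differentiableAt one_ne_zero).hasFDerivAt
      have h10 := h9.comp_hasDerivAt (0 : ℝ) h8
      rw [zero_apply] at h10
      refine h10.congr_of_eventuallyEq ?_
      filter_upwards [hγ, h2.eventually hinv] with t h11 h12
      simp only [Function.comp_apply, Z]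
      rw [(h12 h11).2]
    exact one_ne_zero (h3.unique h5)
  have hpos := exists_pos_of_neg_of_pos hZc hneg hzero hd
  obtain ⟨r', hr', hr'b⟩ := Metric.eventually_nhds_iff_ball.1
    (hpos.and (hzero.and (hball.and (hst.eventually (inter_mem hN h0t)))))
  have hht : Tendsto (heightMap P g φ) (𝓝 0) (𝓝 0) := by
    have := (h.contDiffAt_heightMap φ h0tube).continuousAt.tendsto
    have h1 := h.heightMap_section φ hu0
    rw [h.zero] at h1
    rwa [h1] at this
  obtain ⟨δ', hδ', hδ'δ, hδ'N⟩ := h.exists_tubeSet_subset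
    (inter_mem hN (inter_mem hφpos (inter_mem hinv
      (hht.eventually (Metric.ball_mem_nhds (0 : RSpace k × ℝ) hr')))))
  have hT := h.mono hδ' hδ'δ
  have hsr' : ContDiffOn ℝ 1 s (ball 0 r') := hs.mono fun b hb => (hr'b b hb).2.2.1
  have hsec : ∀ u ∈ ball (0 : RSpace k) δ', (u, (0 : ℝ)) ∈ ball (0 : RSpace k × ℝ) r' ∧
      s (u, 0) = g u := by
    intro u hu
    have h1 : heightMap P g φ (g u) ∈ ball (0 : RSpace k × ℝ) r' :=
      (hδ'N (hT.section_mem_tubeSet hu)).2.2.2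
    rw [hT.heightMap_section φ hu] at h1
    refine ⟨h1, hsg u ?_⟩
    have h2 := (hr'b _ h1).2.2.1
    rw [mem_ball_zero_iff] at h2 ⊢
    exact (norm_fst_le _).trans_lt h2
  refine ⟨δ', φ, s, ball 0 r' ∩ s ⁻¹' tubeSet P g δ', fun q hq => (hδ'N hq).1,
    ⟨hT.congr fun y hy => and_iff_left hy, inter_subset_right,
      hsr'.continuousOn.isOpen_inter_preimage Metric.isOpen_ball hT.isOpen_tubeSet,
      hsr'.mono inter_subset_left, fun u hu => ?_, fun b hb hb2 => ?_,
      fun y hy => ?_⟩, fun x hx hxt j hj => ?_⟩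
  · obtain ⟨h1, h2⟩ := hsec u hu
    refine ⟨⟨h1, ?_⟩, h2⟩
    rw [mem_preimage, h2]
    exact hT.section_mem_tubeSet hu
  · refine ⟨?_, hb.2⟩
    obtain ⟨h1, -, h3, h4⟩ := hr'b b hb.1
    refine ((hmem _ h4.1).2 ⟨(hsM b h3).1, (h1 hb2).le⟩).resolve_right fun h5 => ?_
    have := hX0 _ h4.2 h5
    rw [(hsM b h3).2] at this
    exact hb2.ne' this
  · obtain ⟨h1, h2, h3, h4⟩ := hδ'N hy.2
    have h5 := h3 ((hmem y h1).1 (Or.inl hy.1)).1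
    refine ⟨h2 hy.1, ⟨h4, ?_⟩, h5.2⟩
    rw [mem_preimage, h5.2]
    exact hy.2
  · have hPx : P x ∈ ball (0 : RSpace k) δ' := by simpa using hxt.1
    obtain ⟨h1, h2⟩ := hsec _ hPx
    have h3 : Z (P x, 0) = 0 := (hr'b _ h1).2.1 rfl
    have h4 : j = i := Fin.ext hj
    simp only [Z] at h3
    rw [h2, ← (hT.mem_iff x hxt).1 hx] at h3
    rw [h4]; exact h3

end IsTube

end


/-! ### Converse: a collar satisfies (b) and (npf) -/

noncomputable section

open Metric (ball closedBall)

variable {n k : ℕ} {X Y : Set (RSpace n)} {P : RSpace n →L[ℝ] RSpace k}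
  {g : RSpace k → RSpace n} {δ : ℝ} {φ : RSpace n →L[ℝ] ℝ} {s : RSpace k × ℝ → RSpace n}
  {B : Set (RSpace k × ℝ)}

lemma inner_unitVector_le {a b : RSpace n} {c : ℝ} (hc : 0 ≤ c)
    (h : inner ℝ a b ≤ c * ‖a‖ * ‖b‖) : inner ℝ (unitVector a) (unitVector b) ≤ c := by
  rcases eq_or_ne a 0 with rfl | ha
  · simpa [unitVector] using hc
  rcases eq_or_ne b 0 with rfl | hb
  · simpa [unitVector] using hc
  rw [inner_eq_unitVector] at h
  have h1 : 0 < ‖a‖ * ‖b‖ := mul_pos (norm_pos_iff.2 ha) (norm_pos_iff.2 hb)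
  nlinarith

/-- The symmetry a ↦ -a supplies a nonnegative element unless the set is empty, where `sSup` is 0.
-/
lemma whitneyAlpha_nonneg (y : RSpace n) : 0 ≤ whitneyAlpha X Y y := by
  rw [whitneyAlpha]
  rcases Set.eq_empty_or_nonempty {s | ∃ a ∈ normalVectors Y y,
    ∃ b ∈ tangentVectors X (nearestPoint X y),
    a ≠ 0 ∧ b ≠ 0 ∧ s = inner ℝ (unitVector a) (unitVector b)} with h | ⟨_, a, ha, b, hb, ha0, hb0, rfl⟩
  · rw [h, Real.sSup_empty]
  · apply Real.sSup_nonneg'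
    rcases le_total 0 (inner ℝ (unitVector a) (unitVector b)) with h1 | h1
    · exact ⟨_, ⟨a, ha, b, hb, ha0, hb0, rfl⟩, h1⟩
    · refine ⟨_, ⟨-a, neg_mem_normalVectors ha, b, hb, neg_ne_zero.2 ha0, hb0, rfl⟩, ?_⟩
      rw [unitVector_neg, inner_neg_left]
      linarith

lemma whitneyBeta_nonneg (y : RSpace n) : 0 ≤ whitneyBeta X Y y := by
  rw [whitneyBeta]
  rcases Set.eq_empty_or_nonempty {s | ∃ a ∈ normalVectors Y y,
    a ≠ 0 ∧ s = inner ℝ (unitVector a) (unitVector (nearestPoint X y - y))}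
    with h | ⟨_, a, ha, ha0, rfl⟩
  · rw [h, Real.sSup_empty]
  · apply Real.sSup_nonneg'
    rcases le_total 0 (inner ℝ (unitVector a) (unitVector (nearestPoint X y - y))) with h1 | h1
    · exact ⟨_, ⟨a, ha, ha0, rfl⟩, h1⟩
    · refine ⟨_, ⟨-a, neg_mem_normalVectors ha, neg_ne_zero.2 ha0, rfl⟩, ?_⟩
      rw [unitVector_neg, inner_neg_left]
      linarith

/-- If the normal directions converge at every point of `X`, the normal cone is a graph over `X`. -/
lemma normallyPseudoFlat_of_tendsto {S : Set (RSpace n)} (hcl : X ⊆ closure (S \ X))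
    (h : ∀ x ∈ X, ∃ q, Tendsto (fun y => unitVector (nearestPoint X y - y)) (𝓝[S \ X] x) (𝓝 q)) :
    NormallyPseudoFlat X S := by
  set f : RSpace n → RSpace n := fun y => unitVector (nearestPoint X y - y) with hf
  have hc := continuousOn_extendFrom (f := f) hcl h
  have hq : ∀ x ∈ X, Tendsto f (𝓝[S \ X] x) (𝓝 (extendFrom (S \ X) f x)) := fun x hx =>
    tendsto_extendFrom (h x hx)
  have hmem : ∀ x ∈ X, (x, extendFrom (S \ X) f x) ∈ normalCone X S := fun x hx =>
    haveI := mem_closure_iff_nhdsWithin_neBot.1 (hcl hx)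
    mem_normalCone_of_tendsto hx le_rfl (hq x hx)
  -- The limits depend continuously on x, and every fibre of the cone is a single point, so one
  -- continuous section passes through every point of the cone.
  refine IsOpenMap.of_sections fun z => ⟨fun x => ⟨(x, extendFrom (S \ X) f x), hmem x x.2⟩,
    ?_, ?_, fun x => rfl⟩
  · refine Continuous.continuousAt (Continuous.subtype_mk ?_ _)
    exact continuous_subtype_val.prodMk (continuousOn_iff_continuous_domRestrict.1 hc)
  · obtain ⟨⟨x, q⟩, hz⟩ := z
    have := eq_of_mem_normalCone hz (hq x hz.1)
    simp [this]

namespace IsCollar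

lemma disjoint (h : IsCollar X Y P g δ φ s B) : Disjoint X Y := by
  refine Set.disjoint_left.2 fun x hx hy => ?_
  have h1 := (h.inv x hy).1
  have h2 := (h.tube.mem_iff x (h.subset hx)).1 hx
  simp only [heightMap] at h1
  rw [← h2, sub_self, map_zero] at h1
  exact lt_irrefl _ h1

lemma exists_section (h : IsCollar X Y P g δ φ s B) {x : RSpace n} (hx : x ∈ X) :
    ∃ u ∈ ball (0 : RSpace k) δ, x = g u :=
  ⟨P x, by simpa using (h.subset hx).1, (h.tube.mem_iff x (h.subset hx)).1 hx⟩

lemma contDiffAt (h : IsCollar X Y P g δ φ s B) {b : RSpace k × ℝ} (hb : b ∈ B) :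
    ContDiffAt ℝ 1 s b := h.smooth.contDiffAt (h.isOpen.mem_nhds hb)

lemma hasStrictFDerivAt (h : IsCollar X Y P g δ φ s B) {b : RSpace k × ℝ} (hb : b ∈ B) :
    HasStrictFDerivAt s (fderiv ℝ s b) b := (h.contDiffAt hb).hasStrictFDerivAt one_ne_zero

lemma continuousAt_fderiv (h : IsCollar X Y P g δ φ s B) {b : RSpace k × ℝ} (hb : b ∈ B) :
    ContinuousAt (fderiv ℝ s) b := (h.contDiffAt hb).continuousAt_fderiv one_ne_zero

lemma fderiv_mem_tangentVectors (h : IsCollar X Y P g δ φ s B) {y : RSpace n} (hy : y ∈ Y)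
    (w : RSpace k × ℝ) : fderiv ℝ s (heightMap P g φ y) w ∈ tangentVectors Y y := by
  obtain ⟨h1, h2, h3⟩ := h.inv y hy
  set b := heightMap P g φ y
  have hline : HasDerivAt (fun t : ℝ => b + t • w) w 0 := by
    simpa using ((hasDerivAt_id (0 : ℝ)).smul_const w).const_add b
  refine ⟨fun t => s (b + t • w), by simp [h3], ?_, ?_⟩
  · have h4 : Tendsto (fun t : ℝ => b + t • w) (𝓝 0) (𝓝 b) := by
      simpa using hline.continuousAt.tendsto
    filter_upwards [h4.eventually (h.isOpen.mem_nhds h2),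
      h4.eventually ((isOpen_lt continuous_const continuous_snd).mem_nhds h1)] with t ht ht'
      using h.mem _ ht ht'
  · have h5 : HasFDerivAt s (fderiv ℝ s b) (b + (0 : ℝ) • w) := by
      rw [zero_smul, add_zero]; exact (h.hasStrictFDerivAt h2).hasFDerivAt
    exact h5.comp_hasDerivAt (0 : ℝ) hline

lemma fderiv_section (h : IsCollar X Y P g δ φ s B) {u : RSpace k}
    (hu : u ∈ ball (0 : RSpace k) δ) (v : RSpace k) :
    fderiv ℝ s (u, 0) (v, 0) = fderiv ℝ g u v := by
  have h1 : HasFDerivAt (fun u : RSpace k => (u, (0 : ℝ))) (ContinuousLinearMap.inl ℝ (RSpace k) ℝ)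
      u := (ContinuousLinearMap.inl ℝ (RSpace k) ℝ).hasFDerivAt
  have h2 : HasFDerivAt (fun u : RSpace k => s (u, 0))
      ((fderiv ℝ s (u, 0)).comp (ContinuousLinearMap.inl ℝ (RSpace k) ℝ)) u :=
    HasFDerivAt.comp u (h.hasStrictFDerivAt (h.section_zero u hu).1).hasFDerivAt h1
  have h3 := h2.congr_of_eventuallyEq (f₁ := g) (by
    filter_upwards [Metric.isOpen_ball.mem_nhds hu] with w hw using (h.section_zero w hw).2.symm)
  rw [h3.fderiv]
  rfl

lemma tendsto_heightMap (h : IsCollar X Y P g δ φ s B) {u : RSpace k}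
    (hu : u ∈ ball (0 : RSpace k) δ) : Tendsto (heightMap P g φ) (𝓝 (g u)) (𝓝 (u, 0)) := by
  rw [← h.tube.heightMap_section φ hu]
  exact (h.tube.contDiffAt_heightMap φ (h.tube.section_mem_tubeSet hu)).continuousAt.tendsto

lemma tendsto_nearest (h : IsCollar X Y P g δ φ s B) {u : RSpace k}
    (hu : u ∈ ball (0 : RSpace k) δ) :
    Tendsto (fun y => (P (nearestPoint X y), (0 : ℝ))) (𝓝 (g u)) (𝓝 (u, 0)) :=
  ((h.tube.tendsto_proj hu).comp (h.tube.tendsto_nearestPoint hu)).prodMk_nhds tendsto_const_nhds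

/-- A tangent vector of `X` at the nearest point is Ds(v, 0) there, while Ds(v, 0) at y is tangent
to `Y`. Both parameters tend to (u, 0), so the two vectors differ little by continuity of Ds. -/
lemma tendsto_whitneyAlpha (h : IsCollar X Y P g δ φ s B) {u : RSpace k}
    (hu : u ∈ ball (0 : RSpace k) δ) : Tendsto (whitneyAlpha X Y) (𝓝[Y] (g u)) (𝓝 0) := by
  rw [Metric.tendsto_nhds]
  intro ε hε
  set c := ε / 2 / (2 * ‖P‖ + 1) with hc
  have hc0 : 0 < c := by positivity
  have hcP : 2 * c * ‖P‖ ≤ ε / 2 := by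
    have : c * (2 * ‖P‖ + 1) = ε / 2 := by rw [hc]; field_simp
    nlinarith
  have hD : ∀ᶠ b in 𝓝 (u, (0 : ℝ)), ‖fderiv ℝ s b - fderiv ℝ s (u, 0)‖ < c := by
    have := (h.continuousAt_fderiv (h.section_zero u hu).1).tendsto.eventually
      (Metric.ball_mem_nhds _ hc0)
    simpa [dist_eq_norm] using this
  filter_upwards [self_mem_nhdsWithin,
    nhdsWithin_le_nhds (h.tube.eventually_nearestPoint_section hu univ_mem),
    nhdsWithin_le_nhds ((h.tendsto_heightMap hu).eventually hD),
    nhdsWithin_le_nhds ((h.tendsto_nearest hu).eventually hD)] with y hy hπ h1 h2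
  obtain ⟨-, -, hπb, -, hπ, -⟩ := hπ
  rw [Real.dist_0_eq_abs, abs_of_nonneg (whitneyAlpha_nonneg y)]
  refine (Real.sSup_le ?_ (by positivity : 0 ≤ ε / 2)).trans_lt (by linarith)
  rintro _ ⟨a, ha, b, hb, -, -, rfl⟩
  refine inner_unitVector_le (by positivity) ?_
  rw [hπ, h.tube.tangentVectors_eq hπb] at hb
  obtain ⟨v, rfl⟩ := hb
  have h3 := ha _ (h.fderiv_mem_tangentVectors hy (v, 0))
  rw [real_inner_comm] at h3
  have h4 : ‖v‖ ≤ ‖P‖ * ‖fderiv ℝ g (P (nearestPoint X y)) v‖ := by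
    have := P.le_opNorm (fderiv ℝ g (P (nearestPoint X y)) v)
    rwa [h.tube.proj_fderiv hπb] at this
  rw [← h.fderiv_section hπb] at h4 ⊢
  set b₁ : RSpace k × ℝ := (P (nearestPoint X y), 0)
  set b := heightMap P g φ y
  set w : RSpace k × ℝ := (v, 0)
  have hw : ‖w‖ = ‖v‖ := by simp [w, Prod.norm_def]
  have h5 : inner ℝ a (fderiv ℝ s b₁ w) = inner ℝ a ((fderiv ℝ s b₁ - fderiv ℝ s b) w) := by
    rw [sub_apply, inner_sub_right, h3, sub_zero]
  have h6 : ‖fderiv ℝ s b₁ - fderiv ℝ s b‖ ≤ 2 * c := by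
    have := norm_sub_le (fderiv ℝ s b₁ - fderiv ℝ s (u, 0)) (fderiv ℝ s b - fderiv ℝ s (u, 0))
    rw [sub_sub_sub_cancel_right] at this
    linarith
  rw [h5]
  calc inner ℝ a ((fderiv ℝ s b₁ - fderiv ℝ s b) w)
      ≤ ‖a‖ * ‖(fderiv ℝ s b₁ - fderiv ℝ s b) w‖ := real_inner_le_norm _ _
    _ ≤ ‖a‖ * (2 * c * (‖P‖ * ‖fderiv ℝ s b₁ w‖)) := by
        gcongr
        refine (ContinuousLinearMap.le_opNorm _ _).trans ?_
        rw [hw]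
        gcongr
    _ = 2 * c * ‖P‖ * (‖a‖ * ‖fderiv ℝ s b₁ w‖) := by ring
    _ ≤ ε / 2 * (‖a‖ * ‖fderiv ℝ s b₁ w‖) := by gcongr
    _ = ε / 2 * ‖a‖ * ‖fderiv ℝ s b₁ w‖ := by ring

/-- The secant is a difference of two values of s, hence by strict differentiability almost Ds at y
of the parameter difference, a tangent vector of `Y`. The Lipschitz bound for the height coordinates
makes the error small relative to the secant. -/
lemma tendsto_whitneyBeta (h : IsCollar X Y P g δ φ s B) {u : RSpace k}
    (hu : u ∈ ball (0 : RSpace k) δ) : Tendsto (whitneyBeta X Y) (𝓝[Y] (g u)) (𝓝 0) := by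
  rw [Metric.tendsto_nhds]
  intro ε hε
  obtain ⟨K, N, hN, hK⟩ := ((h.tube.contDiffAt_heightMap φ
    (h.tube.section_mem_tubeSet hu)).hasStrictFDerivAt one_ne_zero).exists_lipschitzOnWith
  set c := ε / 2 / (2 * K + 1) with hc
  have hc0 : 0 < c := by positivity
  have hcK : 2 * c * K ≤ ε / 2 := by
    have : c * (2 * K + 1) = ε / 2 := by rw [hc]; field_simp
    nlinarith
  have hB := (h.section_zero u hu).1
  have hD : ∀ᶠ b in 𝓝 (u, (0 : ℝ)), ‖fderiv ℝ s b - fderiv ℝ s (u, 0)‖ < c := by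
    have := (h.continuousAt_fderiv hB).tendsto.eventually (Metric.ball_mem_nhds _ hc0)
    simpa [dist_eq_norm] using this
  have hs := (hasStrictFDerivAt_iff_isLittleO.1 (h.hasStrictFDerivAt hB)).def hc0
  filter_upwards [self_mem_nhdsWithin,
    nhdsWithin_le_nhds (h.tube.eventually_nearestPoint_section hu univ_mem),
    nhdsWithin_le_nhds ((h.tendsto_heightMap hu).eventually hD),
    nhdsWithin_le_nhds (((h.tendsto_nearest hu).prodMk_nhds (h.tendsto_heightMap hu)).eventually hs),
    nhdsWithin_le_nhds hN,
    nhdsWithin_le_nhds ((h.tube.tendsto_nearestPoint hu).eventually hN)] with y hy hπ h1 h2 hyN hπN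
  obtain ⟨-, -, hπb, -, hπ, -⟩ := hπ
  rw [Real.dist_0_eq_abs, abs_of_nonneg (whitneyBeta_nonneg y)]
  refine (Real.sSup_le ?_ (by positivity : 0 ≤ ε / 2)).trans_lt (by linarith)
  rintro _ ⟨a, ha, -, rfl⟩
  refine inner_unitVector_le (by positivity) ?_
  have h3 := hK.dist_le_mul _ hπN _ hyN
  have hb₁ : heightMap P g φ (nearestPoint X y) = (P (nearestPoint X y), 0) := by
    conv_lhs => rw [hπ]
    exact h.tube.heightMap_section φ hπb
  rw [hb₁, dist_eq_norm, dist_eq_norm] at h3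
  have h4 : s (P (nearestPoint X y), 0) = nearestPoint X y :=
    (h.section_zero _ hπb).2.trans hπ.symm
  simp only [h4, (h.inv y hy).2.2] at h2
  set b₁ : RSpace k × ℝ := (P (nearestPoint X y), 0)
  set b := heightMap P g φ y
  set z := nearestPoint X y - y
  have h5 : inner ℝ (fderiv ℝ s b (b₁ - b)) a = 0 :=
    ha _ (h.fderiv_mem_tangentVectors hy (b₁ - b))
  rw [real_inner_comm] at h5
  have h6 : ‖z - fderiv ℝ s b (b₁ - b)‖ ≤ 2 * c * ‖b₁ - b‖ := by
    have h7 : z - fderiv ℝ s b (b₁ - b) = (z - fderiv ℝ s (u, 0) (b₁ - b)) -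
        (fderiv ℝ s b - fderiv ℝ s (u, 0)) (b₁ - b) := by
      rw [sub_apply]; abel
    have h8 := (ContinuousLinearMap.le_opNorm (fderiv ℝ s b - fderiv ℝ s (u, 0)) (b₁ - b)).trans
      (mul_le_mul_of_nonneg_right h1.le (norm_nonneg _))
    rw [h7]
    refine (norm_sub_le _ _).trans ?_
    linarith
  calc inner ℝ a z = inner ℝ a (z - fderiv ℝ s b (b₁ - b)) := by
        rw [inner_sub_right a z, h5, sub_zero]
    _ ≤ ‖a‖ * ‖z - fderiv ℝ s b (b₁ - b)‖ := real_inner_le_norm _ _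
    _ ≤ ‖a‖ * (2 * c * (K * ‖z‖)) := by
        gcongr
        exact h6.trans (by gcongr)
    _ = 2 * c * K * (‖a‖ * ‖z‖) := by ring
    _ ≤ ε / 2 * (‖a‖ * ‖z‖) := by gcongr
    _ = ε / 2 * ‖a‖ * ‖z‖ := by ring

theorem whitneyB (h : IsCollar X Y P g δ φ s B) : WhitneyB X Y := by
  intro x hx
  obtain ⟨u, hu, rfl⟩ := h.exists_section hx
  exact ⟨h.tendsto_whitneyAlpha hu, h.tendsto_whitneyBeta hu⟩

lemma subset_closure (h : IsCollar X Y P g δ φ s B) : X ⊆ closure Y := by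
  intro x hx
  obtain ⟨u, hu, rfl⟩ := h.exists_section hx
  obtain ⟨hB, hs⟩ := h.section_zero u hu
  have h1 : Tendsto (fun t : ℝ => (u, t)) (𝓝[>] 0) (𝓝 (u, 0)) :=
    tendsto_const_nhds.prodMk_nhds (tendsto_id.mono_left nhdsWithin_le_nhds)
  have h2 := (h.contDiffAt hB).continuousAt.tendsto.comp h1
  rw [hs] at h2
  refine mem_closure_of_tendsto h2 ?_
  filter_upwards [h1.eventually (h.isOpen.mem_nhds hB), self_mem_nhdsWithin] with t ht ht0
    using h.mem _ ht ht0

/-- Divided by the height, the segment from the graph to y tends to the height derivative of s at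
(u, 0). This limit is nonzero because `φ` takes the value 1 on it. -/
lemma tendsto_collarDir (h : IsCollar X Y P g δ φ s B) {u : RSpace k}
    (hu : u ∈ ball (0 : RSpace k) δ) :
    ∃ θ, Tendsto (collarDir P g) (𝓝[Y] (g u)) (𝓝 θ) := by
  have hB := (h.section_zero u hu).1
  set w := fderiv ℝ s (u, 0) (0, 1)
  have hnb : (𝓝[Y] (g u)).NeBot :=
    mem_closure_iff_nhdsWithin_neBot.1 (h.subset_closure (h.tube.section_mem hu))
  have h1 : Tendsto (fun y => (heightMap P g φ y).2⁻¹ • (y - g (P y))) (𝓝[Y] (g u)) (𝓝 w) := by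
    rw [Metric.tendsto_nhds]
    intro ε hε
    have hs := (hasStrictFDerivAt_iff_isLittleO.1 (h.hasStrictFDerivAt hB)).def (half_pos hε)
    have h2 := h.tendsto_heightMap hu
    have h3 : Tendsto (fun y => (P y, (0 : ℝ))) (𝓝 (g u)) (𝓝 (u, 0)) :=
      (h.tube.tendsto_proj hu).prodMk_nhds tendsto_const_nhds
    filter_upwards [self_mem_nhdsWithin,
      nhdsWithin_le_nhds ((h2.prodMk_nhds h3).eventually hs),
      nhdsWithin_le_nhds ((h.tube.tendsto_proj hu).eventually (Metric.isOpen_ball.mem_nhds hu))]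
      with y hy h4 hPy
    obtain ⟨hpos, -, hinv⟩ := h.inv y hy
    simp only [hinv, (h.section_zero _ hPy).2] at h4
    set t := (heightMap P g φ y).2
    have h5 : heightMap P g φ y - (P y, 0) = t • ((0 : RSpace k), (1 : ℝ)) :=
      Prod.ext (by simp [heightMap]) (by simp [t])
    have h6 : ‖t • ((0 : RSpace k), (1 : ℝ))‖ = t := by
      rw [norm_smul, Real.norm_of_nonneg hpos.le]; simp [Prod.norm_def]
    rw [h5, h6, map_smul] at h4
    have h7 : t⁻¹ • (y - g (P y)) - w = t⁻¹ • (y - g (P y) - t • w) := by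
      rw [smul_sub _ (y - g (P y)), inv_smul_smul₀ hpos.ne']
    rw [dist_eq_norm, h7, norm_smul, norm_inv, Real.norm_of_nonneg hpos.le,
      inv_mul_lt_iff₀ hpos]
    refine h4.trans_lt ?_
    nlinarith
  have hw : w ≠ 0 := by
    have h2 : Tendsto (fun y => φ ((heightMap P g φ y).2⁻¹ • (y - g (P y)))) (𝓝[Y] (g u))
      (𝓝 (φ w)) := (φ.continuous.tendsto w).comp h1
    have h3 : φ w = 1 := by
      refine tendsto_nhds_unique h2 (tendsto_const_nhds.congr' ?_)
      filter_upwards [self_mem_nhdsWithin] with y hy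
      rw [map_smul, smul_eq_mul]
      exact (inv_mul_cancel₀ (h.inv y hy).1.ne').symm
    intro h0
    rw [h0, map_zero] at h3
    exact zero_ne_one h3
  refine ⟨unitVector w, ((continuousAt_unitVector hw).tendsto.comp h1).congr' ?_⟩
  filter_upwards [self_mem_nhdsWithin] with y hy
  exact unitVector_smul (inv_pos.2 (h.inv y hy).1) _

theorem normallyPseudoFlat (h : IsCollar X Y P g δ φ s B) : NormallyPseudoFlat X (Y ∪ X) := by
  have h1 : (Y ∪ X) \ X = Y := by
    rw [union_sdiff_right]
    exact h.disjoint.symm.sdiff_eq_left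
  refine normallyPseudoFlat_of_tendsto (by rw [h1]; exact h.subset_closure) fun x hx => ?_
  obtain ⟨u, hu, rfl⟩ := h.exists_section hx
  obtain ⟨θ, hθ⟩ := h.tendsto_collarDir hu
  have : (𝓝[Y] (g u)).NeBot :=
    mem_closure_iff_nhdsWithin_neBot.1 (h.subset_closure (h.tube.section_mem hu))
  rw [h1]
  exact ⟨_, h.tube.tendsto_direction_of_collarDir h.disjoint hu le_rfl hθ⟩

end IsCollar

end


/-! ### Identification of the boundary, and the two directions together -/

noncomputable section

open Metric (ball closedBall)

variable {n k : ℕ} {X Y M N : Set (RSpace n)}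

lemma tangentVectors_mono_of_eventually {p : RSpace n} (h : ∀ᶠ q in 𝓝 p, q ∈ M → q ∈ N) :
    tangentVectors M p ⊆ tangentVectors N p := by
  rintro v ⟨γ, hγ0, hγ, hγd⟩
  have h1 : Tendsto γ (𝓝 0) (𝓝 p) := by
    have := hγd.continuousAt.tendsto
    rwa [hγ0] at this
  exact ⟨γ, hγ0, by filter_upwards [hγ, h1.eventually h] with t h2 h3 using h3 h2, hγd⟩

/-- Near a boundary point, a manifold with boundary contains no submanifold of the same
dimension through that point. -/
lemma IsStraightening.ne_zero_of_isSubmanifold {p : RSpace n}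
    {Φ : OpenPartialHomeomorph (RSpace n) (RSpace n)}
    (h : IsStraightening 1 M (halfModel n (k + 1)) p Φ) (hY : IsSubmanifold 1 (k + 1) Y)
    (hp : p ∈ Y) (hYM : ∀ᶠ q in 𝓝 p, q ∈ Y → q ∈ M) {i : Fin n} (hi : (i : ℕ) = k) :
    Φ p i ≠ 0 := by
  intro h0
  have hkn : k ≤ n := by have := hY.1; omega
  obtain ⟨Ψ, hΨ⟩ := hY.2 p hp
  obtain ⟨S, hS, hSd⟩ := hΨ.exists_submodule hp hY.1
  obtain ⟨A, hA, -⟩ := h.exists_equiv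
  -- At a boundary point the tangent space of `Y`, of dimension k + 1, would embed in the
  -- k-dimensional tangent space of the boundary.
  let T : S →ₗ[ℝ] RSpace k :=
    ((firstCoords n k hkn : RSpace n →ₗ[ℝ] RSpace k) ∘ₗ (A : RSpace n →ₗ[ℝ] RSpace n)).domRestrict S
  have hT : Function.Injective T := by
    rw [injective_iff_map_eq_zero]
    intro v hv
    have h1 : (v : RSpace n) ∈ tangentVectors M p :=
      tangentVectors_mono_of_eventually hYM (by rw [← hS]; exact v.2)
    have h2 := h.tangentVectors_boundary hi h0 h1
    rw [hA.fderiv] at h2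
    have h3 := inclCoords_firstCoords hkn h2
    have h4 : firstCoords n k hkn (A v) = 0 := hv
    have h5 : A (v : RSpace n) = 0 := by
      rw [← map_zero (inclCoords n k), ← h4]; exact h3.symm
    exact Subtype.ext ((map_eq_zero_iff A A.injective).1 h5)
  have := LinearMap.finrank_le_finrank_of_injective hT
  rw [hSd, finrank_euclideanSpace_fin] at this
  omega

/-- If the union of the strata is a manifold with boundary, then `X` is its boundary and the pair
satisfies Whitney's condition and is normally pseudo-flat. -/
theorem exists_whitneyB_of_isSubmanifoldWithBoundary (hX : IsSubmanifold 1 k X)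
    (hY : IsSubmanifold 1 (k + 1) Y) (hXY : Disjoint X Y) (h0 : (0 : RSpace n) ∈ X)
    (hconn : ∃ ε₀ > 0, ∀ ε, 0 < ε → ε < ε₀ → IsConnected (Y ∩ ball 0 ε))
    {U : Set (RSpace n)} (hU : IsOpen U) (h0U : (0 : RSpace n) ∈ U)
    (hM : IsSubmanifoldWithBoundary 1 (k + 1) ((Y ∪ X) ∩ U)) :
    ∃ V : Set (RSpace n), IsOpen V ∧ 0 ∈ V ∧ V ⊆ U ∧ WhitneyB (X ∩ V) (Y ∩ V) ∧
      NormallyPseudoFlat (X ∩ V) ((Y ∪ X) ∩ V) ∧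
      submanifoldBoundary 1 (k + 1) ((Y ∪ X) ∩ V) = X ∩ V := by
  obtain ⟨P, g, δ, hT⟩ := exists_isTube hX h0
  obtain ⟨Φ, hΦ⟩ := hM.2 0 ⟨Or.inr h0, h0U⟩
  obtain ⟨δ', φ, s, B, hsub, hC, hΦX⟩ := hT.exists_isCollar hY.1 hXY hconn hU h0U hΦ
  have hV := hC.tube.isOpen_tubeSet
  refine ⟨tubeSet P g δ', hV, ?_, fun q hq => (hsub hq).1, hC.whitneyB, ?_, ?_⟩
  · have := hC.tube.section_mem_tubeSet hC.tube.zero_mem_ball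
    rwa [hC.tube.zero] at this
  · rw [union_inter_distrib_right]
    exact hC.normallyPseudoFlat
  · apply Subset.antisymm
    · rintro p ⟨⟨hp, hpV⟩, Ψ, hΨ, i, hi, h1⟩
      refine ⟨hp.resolve_left fun hpY => hΨ.ne_zero_of_isSubmanifold hY hpY ?_
        (Nat.succ_injective hi) h1, hpV⟩
      filter_upwards [hV.mem_nhds hpV] with q hq hqY using ⟨Or.inl hqY, hq⟩
    · rintro p ⟨hp, hpV⟩
      -- The straightening at 0 serves at every point of `X` in the tube, since its boundary
      -- coordinate vanishes there.
      have hΦp : IsStraightening 1 ((Y ∪ X) ∩ U) (halfModel n (k + 1)) p Φ :=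
        ⟨(hsub hpV).2, hΦ.2⟩
      refine ⟨⟨Or.inr hp, hpV⟩, _, hΦp.restrOpen hV hpV fun q hq => ?_,
        ⟨k, hY.1⟩, rfl, hΦX p hp hpV _ rfl⟩
      exact ⟨fun h => ⟨h.1, (hsub hq).1⟩, fun h => ⟨h.1, hq⟩⟩

end

theorem proposition3p9
    (L : FirstOrder.Language.{u, v}) [L.Structure ℝ] (hL : IsOMinimalExpansionOfRealField L)
    {n k : ℕ} (X Y : Set (RSpace n))
    (hXdef : IsDefinableSet L X) (hYdef : IsDefinableSet L Y)
    (hX : IsSubmanifold 2 k X) (hY : IsSubmanifold 2 (k + 1) Y)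
    (hdisj : Disjoint X Y) (hfrontier : X ⊆ closure Y)
    (hclosed : IsLocallyClosed (X ∪ Y)) (h0 : (0 : RSpace n) ∈ X)
    (hconn : ∃ ε₀ > 0, ∀ ε, 0 < ε → ε < ε₀ → IsConnected (Y ∩ Metric.ball 0 ε)) :
    ((∃ U : Set (RSpace n), IsOpen U ∧ 0 ∈ U ∧
        WhitneyB (X ∩ U) (Y ∩ U) ∧ NormallyPseudoFlat (X ∩ U) ((Y ∪ X) ∩ U)) ↔
      ∃ U : Set (RSpace n), IsOpen U ∧ 0 ∈ U ∧
        IsSubmanifoldWithBoundary 1 (k + 1) ((Y ∪ X) ∩ U)) ∧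
    ∀ U : Set (RSpace n), IsOpen U → 0 ∈ U →
      IsSubmanifoldWithBoundary 1 (k + 1) ((Y ∪ X) ∩ U) →
        ∃ V : Set (RSpace n), IsOpen V ∧ 0 ∈ V ∧ V ⊆ U ∧
          submanifoldBoundary 1 (k + 1) ((Y ∪ X) ∩ V) = X ∩ V := by

  -- Class C^1 of the strata suffices for both directions.
  have hX' := hX.of_le one_le_two
  have hY' := hY.of_le one_le_two
  refine ⟨⟨fun ⟨U, hU, h0U, hb, hnpf⟩ => exists_isSubmanifoldWithBoundary hL hYdef hX' hY' hdisj
    hfrontier hclosed h0 hconn hU h0U hb hnpf, fun ⟨U, hU, h0U, hM⟩ => ?_⟩, fun U hU h0U hM => ?_⟩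
  · obtain ⟨V, hV, h0V, -, hb, hnpf, -⟩ :=
      exists_whitneyB_of_isSubmanifoldWithBoundary hX' hY' hdisj h0 hconn hU h0U hM
    exact ⟨V, hV, h0V, hb, hnpf⟩
  · obtain ⟨V, hV, h0V, hVU, -, -, hbd⟩ :=
      exists_whitneyB_of_isSubmanifoldWithBoundary hX' hY' hdisj h0 hconn hU h0U hM
    exact ⟨V, hV, h0V, hVU, hbd⟩
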